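/- Consider a discrete memoryless cognitive interference channel with state: finite input alphabets $\mathcal X_1,\mathcal X_2$, a finite state alphabet $\mathcal S$, finite output alphabets $\mathcal Y,\mathcal Z$, a state distribution $P_S$ (the state sequence $S^n$ is i.i.d. with law $P_S$), and a transition probability $P_{YZ|X_1X_2S}$, applied memorylessly. The state sequence is noncausally known at transmitter 2 and at receiver 2, and at no other terminal. A code of block length $n$ and rates $R_1,R_2\ge 0$ has message sets $\mathcal W_k=\{1,\dots,\lceil 2^{nR_k}\rceil\}$, $k=1,2$, encoders $f_1:\mathcal W_1\to\mathcal X_1^n$ and $f_2:\mathcal W_1\times\mathcal W_2\times\mathcal S^n\to\mathcal X_2^n$, and decoders $g_1:\mathcal Y^n\to\mathcal W_1$ and $g_2:\mathcal Z^n\times\mathcal S^n\to\mathcal W_1\times\mathcal W_2$. The messages $W_1,W_2$ are independent and uniformly distributed and independent of $S^n$, and $P_e^{(n)}$ is the probability that $g_1(Y^n)\ne W_1$ or $g_2(Z^n,S^n)\ne(W_1,W_2)$. A pair $(R_1,R_2)$ with $R_1,R_2\ge0$ is achievable if there is a sequence of such codes, one for each $n$, with $P_e^{(n)}\to0$ as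 $n\to\infty$; the capacity region is the closure of the set of achievable pairs. Theorem. The capacity region is the set of all pairs $(R_1,R_2)$ with $R_1\ge0$, $R_2\ge0$ that satisfy \begin{align*} R_1&\le I(X_1U;Y)-I(U;S|X_1),\\ R_2&\le I(X_2;Z|SX_1),\\ R_1+R_2&\le I(X_1X_2;Z|S),\\ R_1+R_2&\le I(X_1U;Y)+I(X_2;Z|X_1US)-I(U;S|X_1) \end{align*} for some joint distribution of the form $P_{X_1SUX_2YZ}=P_{X_1}P_SP_{UX_2|X_1S}P_{YZ|SX_1X_2}$ (with the given $P_S$ and $P_{YZ|SX_1X_2}$), where the auxiliary random variable $U$ takes values in a finite set $\mathcal U$ with $|\mathcal U|\le|\mathcal X_1||\mathcal X_2||\mathcal S|+1$. Mutual informations are in bits (logarithms to base 2). -/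

import Mathlib

noncomputable section

namespace CognitiveIC

/-! ## Information measures of random variables on a finite probability space

`p : Ω → ℝ` is a probability mass function on the finite set `Ω` and random variables are
functions on `Ω`.  All logarithms are to base two. -/

section Information

variable {Ω α β γ : Type*} [Fintype Ω] [Fintype α] [Fintype β] [Fintype γ]

/-- The probability mass function of the random variable `A`: `a ↦ Pr{A = a}`. -/
def law (p : Ω → ℝ) (A : Ω → α) (a : α) : ℝ :=
  ∑ ω, Set.indicator (A ⁻¹' {a}) p ω

/-- The entropy `H(A)` in bits. -/
def entropy (p : Ω → ℝ) (A : Ω → α) : ℝ :=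
  -∑ a, law p A a * Real.logb 2 (law p A a)

/-- The conditional entropy `H(A | B) = H(A, B) - H(B)`. -/
def condEntropy (p : Ω → ℝ) (A : Ω → α) (B : Ω → β) : ℝ :=
  entropy p (fun ω => (A ω, B ω)) - entropy p B

/-- The mutual information `I(A ; B) = H(A) - H(A | B)`. -/
def mutualInfo (p : Ω → ℝ) (A : Ω → α) (B : Ω → β) : ℝ :=
  entropy p A - condEntropy p A B

/-- The conditional mutual information `I(A ; B | C) = H(A | C) - H(A | B, C)`. -/
def condMutualInfo (p : Ω → ℝ) (A : Ω → α) (B : Ω → β) (C : Ω → γ) : ℝ :=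
  condEntropy p A C - condEntropy p A (fun ω => (B ω, C ω))

end Information

/-! ## Channel, codes, achievable rates, capacity region -/

/-- A discrete memoryless cognitive interference channel with state: input alphabets `X₁`, `X₂`,
state alphabet `S`, output alphabets `Y`, `Z` (all finite), the law of the i.i.d. state, and the
transition probability `P(y, z | x₁, x₂, s)`. -/
structure Channel (X₁ X₂ S Y Z : Type*) [Fintype X₁] [Fintype X₂] [Fintype S] [Fintype Y]
    [Fintype Z] where
  /-- The law `P_S` of one state symbol. -/
  stateLaw : S → ℝ
  stateLaw_mem : stateLaw ∈ stdSimplex ℝ S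
  /-- The transition law `trans x₁ x₂ s (y, z) = P(y, z | x₁, x₂, s)`. -/
  trans : X₁ → X₂ → S → Y × Z → ℝ
  trans_mem : ∀ x₁ x₂ s, trans x₁ x₂ s ∈ stdSimplex ℝ (Y × Z)

/-- A code of block length `n` with `M₁` and `M₂` messages, the state sequence being known
noncausally at transmitter 2 and at receiver 2. -/
structure Code (X₁ X₂ S Y Z : Type*) (n M₁ M₂ : ℕ) where
  /-- Encoder 1 sees only the first message. -/
  enc₁ : Fin M₁ → (Fin n → X₁)
  /-- Encoder 2 sees both messages and the whole state sequence. -/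
  enc₂ : Fin M₁ → Fin M₂ → (Fin n → S) → (Fin n → X₂)
  /-- Decoder 1 estimates the first message from the output of receiver 1. -/
  dec₁ : (Fin n → Y) → Fin M₁
  /-- Decoder 2 estimates both messages from the output of receiver 2 and the state sequence. -/
  dec₂ : (Fin n → Z) → (Fin n → S) → Fin M₁ × Fin M₂

section Capacity

variable {X₁ X₂ S Y Z : Type*} [Fintype X₁] [Fintype X₂] [Fintype S] [Fintype Y] [Fintype Z]

/-- The average probability of error: the messages are independent and uniform, the state is
i.i.d., the channel is memoryless, and an error occurs unless both decoders are correct. -/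
def errorProb (ch : Channel X₁ X₂ S Y Z) {n M₁ M₂ : ℕ} (c : Code X₁ X₂ S Y Z n M₁ M₂) : ℝ :=
  (1 / ((M₁ : ℝ) * (M₂ : ℝ))) * ∑ w₁ : Fin M₁, ∑ w₂ : Fin M₂,
    ∑ s : Fin n → S, ∑ y : Fin n → Y, ∑ z : Fin n → Z,
      if c.dec₁ y = w₁ ∧ c.dec₂ z s = (w₁, w₂) then 0
      else (∏ i, ch.stateLaw (s i)) *
        ∏ i, ch.trans (c.enc₁ w₁ i) (c.enc₂ w₁ w₂ s i) (s i) (y i, z i)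

/-- The number `⌈2 ^ (n R)⌉` of messages of a code of block length `n` and rate `R`. -/
def numMessages (n : ℕ) (R : ℝ) : ℕ :=
  ⌈(2 : ℝ) ^ ((n : ℝ) * R)⌉₊

/-- A pair of nonnegative rates is achievable if some sequence of codes with these rates has
average error probability tending to zero. -/
def Achievable (ch : Channel X₁ X₂ S Y Z) (R : ℝ × ℝ) : Prop :=
  0 ≤ R.1 ∧ 0 ≤ R.2 ∧
    ∃ c : (n : ℕ) → Code X₁ X₂ S Y Z n (numMessages n R.1) (numMessages n R.2),
      Filter.Tendsto (fun n => errorProb ch (c n)) Filter.atTop (nhds 0)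

/-- The capacity region: the closure of the set of achievable rate pairs. -/
def capacityRegion (ch : Channel X₁ X₂ S Y Z) : Set (ℝ × ℝ) :=
  closure {R | Achievable ch R}

/-- The joint law `P(x₁) P(s) P(u, x₂ | x₁, s) P(y, z | s, x₁, x₂)` of `(X₁, S, U, X₂, Y, Z)`, for
an input law `P(x₁)` and a conditional law `P(u, x₂ | x₁, s)`. -/
def jointLaw (ch : Channel X₁ X₂ S Y Z) {U : Type*} (pX₁ : X₁ → ℝ) (pUX₂ : X₁ → S → U × X₂ → ℝ) :
    X₁ × S × U × X₂ × Y × Z → ℝ :=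
  fun (x₁, s, u, x₂, y, z) =>
    pX₁ x₁ * ch.stateLaw s * pUX₂ x₁ s (u, x₂) * ch.trans x₁ x₂ s (y, z)

/-- The four rate constraints
`R₁ ≤ I(X₁ U; Y) - I(U; S | X₁)`, `R₂ ≤ I(X₂; Z | S X₁)`, `R₁ + R₂ ≤ I(X₁ X₂; Z | S)` and
`R₁ + R₂ ≤ I(X₁ U; Y) + I(X₂; Z | X₁ U S) - I(U; S | X₁)`
under the joint law `p` of `(X₁, S, U, X₂, Y, Z)`. -/
def RateBounds {U : Type*} [Fintype U] (p : X₁ × S × U × X₂ × Y × Z → ℝ) (R : ℝ × ℝ) : Prop :=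
  let x₁ : X₁ × S × U × X₂ × Y × Z → X₁ := fun ω => ω.1
  let s : X₁ × S × U × X₂ × Y × Z → S := fun ω => ω.2.1
  let u : X₁ × S × U × X₂ × Y × Z → U := fun ω => ω.2.2.1
  let x₂ : X₁ × S × U × X₂ × Y × Z → X₂ := fun ω => ω.2.2.2.1
  let y : X₁ × S × U × X₂ × Y × Z → Y := fun ω => ω.2.2.2.2.1
  let z : X₁ × S × U × X₂ × Y × Z → Z := fun ω => ω.2.2.2.2.2
  R.1 ≤ mutualInfo p (fun ω => (x₁ ω, u ω)) y - condMutualInfo p u s x₁ ∧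
  R.2 ≤ condMutualInfo p x₂ z (fun ω => (s ω, x₁ ω)) ∧
  R.1 + R.2 ≤ condMutualInfo p (fun ω => (x₁ ω, x₂ ω)) z s ∧
  R.1 + R.2 ≤ mutualInfo p (fun ω => (x₁ ω, u ω)) y
    + condMutualInfo p x₂ z (fun ω => (x₁ ω, u ω, s ω)) - condMutualInfo p u s x₁

end Capacity

end CognitiveIC

end

/-!
A rate pair is in the capacity region exactly if it satisfies the four constraints for some
admissible joint law; the two inclusions are `exists_mem_rateRegion_of_mem_capacityRegion` and
`mem_capacityRegion_of_mem_rateRegion`. Since `Z` depends on `U` only through `(X₁, X₂, S)`, all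
constraints are differences of entropies of `(S, U, X₁, Y)` and of conditional entropies of `Z` and
the channel noise `H(Z | X₁ X₂ S)` (`rateBounds_jointLaw_iff`).

**Converse.** Fano's inequality gives multi-letter bounds for a code of length `n`. They become
single-letter bounds at a uniformly random time `i`, with the auxiliary variable
`U = (i, W₁, Y^{i-1}, T_{i+1}^n)`. The Csiszár sum identity enters as a telescoping sum: with
`G k = H(W₁, Y^k, T_{k+1}^n)` the terms `H(U_i, T_i) - H(U_i, Y_i)` are `G (i - 1) - G i`
(`sum_entropy_auxVar`). The choice `T = S` gives the bound on `R₁`, and `T = (S, Z)` gives the last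
bound on `R₁ + R₂`. If `T = (S, Z)` also satisfies the bound on `R₁`, it is used. Otherwise the
information `I(X₁ U; Y) - I(U; S | X₁)` is smaller for `T = (S, Z)` than `R₁`, hence than for
`T = S`, while dropping `Z` increases `H(Z | X₁ U S)`; so `T = S` satisfies the last bound too
(`exists_mem_rateRegion_of_code`). The alphabet of `U` is cut down by moving mass
between its values along linear relations that preserve the joint law of `(X₁, X₂, S)` and
`H(Z | X₁ U S)` and do not decrease `H(U, S, X₁) - H(U, X₁, Y)` (`exists_weights_small_support`,
`exists_fin_mem_rateRegion`). For an alphabet of fixed size the region is closed by compactness, so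
the limit `n → ∞` stays in it.

**Achievability.** Superposition coding: codewords `x₁ (w₁)`, bins of codewords `u (w₁, a, ℓ)` with
`ℓ` ranging over the bin, and codewords `x₂ (w₁, w₂, ℓ, s)`, where the part `a` of the second
message is carried by `u`. Encoder 2 knows the state and chooses the `ℓ` with the smallest
conditional error probability, which is at least as good as drawing `ℓ` with probability
proportional to the backward law `P(s | x₁, u_ℓ)`. When the bin has rate above `I(U; S | X₁)`, the
law of the state induced by a uniform `ℓ` is close to the true one (soft covering,
`Ensemble.expect_max_sub_inducedState_le`), so the error is that of a system in which
`(x₁, u, x₂, s)` has exactly the joint law of the ensemble. There the decoders test likelihood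
ratios, and the union bound applies; no typical sets are needed. All this is one-shot
(`Ensemble.exists_code`), and is applied to `n` independent uses of a single-letter ensemble, where
the likelihood ratios concentrate by Chebyshev's inequality (`tendsto_expect_ind_prod_lt`). Decoder
2 decodes `ℓ` as well, which adds the rate `I(U; S | X₁)` of the bins to both sides of its
constraints on wrong `u`, and so leaves the second and the third bound as stated. Splitting the
second rate between `u` and `x₂` (`exists_rate_splitting`) gives the first and the last bound.
-/

noncomputable section

set_option linter.unusedSectionVars false

namespace CognitiveIC

/-! ### Sums against product weights -/

section ProductWeights

variable {ι α : Type*} [Fintype ι] [DecidableEq ι] [Fintype α]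

/-- The sum of `g` over all `f : ι → α`, weighted with `∏ i, q i (f i)`: the expectation of `g`
when the coordinates of `f` are independent and `f i` has law `q i`. -/
def expect (q : ι → α → ℝ) (g : (ι → α) → ℝ) : ℝ :=
  ∑ f : ι → α, (∏ i, q i (f i)) * g f

/-- Integrating out the coordinate `i` first. -/
lemma expect_coord (q : ι → α → ℝ) (i : ι) (hi : ∑ a, q i a = 1) (G : α → (ι → α) → ℝ)
    (hG : ∀ a b f, G a (Function.update f i b) = G a f) :
    expect q (fun f => G (f i) f) = ∑ a, q i a * expect q (G a) := by
  have split : ∀ H : (ι → α) → ℝ, expect q H = ∑ a, q i a *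
      ∑ f : {j // j ≠ i} → α, (∏ j : {j // j ≠ i}, q j (f j)) *
        H ((Equiv.funSplitAt i α).symm (a, f)) := by
    intro H
    rw [expect, ← (Equiv.funSplitAt i α).symm.sum_comp, Fintype.sum_prod_type]
    refine Finset.sum_congr rfl fun a _ => ?_
    rw [Finset.mul_sum]
    refine Finset.sum_congr rfl fun f _ => ?_
    rw [← mul_assoc]
    congr 1
    rw [Fintype.prod_eq_mul_prod_subtype_ne _ i]
    congr 1
    · simp
    · exact Finset.prod_congr rfl fun j _ => by simp [j.2]
  have upd : ∀ (a b : α) (f : {j // j ≠ i} → α),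
      Function.update ((Equiv.funSplitAt i α).symm (a, f)) i b
        = (Equiv.funSplitAt i α).symm (b, f) := by
    intro a b f
    ext j
    by_cases h : j = i
    · subst h; simp
    · simp [h]
  rw [split]
  refine Finset.sum_congr rfl fun a _ => ?_
  rw [split]
  congr 1
  have key : ∀ b, (∑ f : {j // j ≠ i} → α, (∏ j : {j // j ≠ i}, q j (f j)) *
      G a ((Equiv.funSplitAt i α).symm (b, f)))
      = ∑ f : {j // j ≠ i} → α, (∏ j : {j // j ≠ i}, q j (f j)) *
        G a ((Equiv.funSplitAt i α).symm (a, f)) := by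
    intro b
    refine Finset.sum_congr rfl fun f _ => ?_
    rw [← upd a b f, hG]
  simp_rw [key]
  rw [← Finset.sum_mul, hi, one_mul]
  simp

lemma sum_pi_prod (g : ι → α → ℝ) : ∑ f : ι → α, ∏ i, g i (f i) = ∏ i, ∑ a, g i a := by
  rw [Finset.prod_univ_sum, Fintype.piFinset_univ]

lemma expect_const (q : ι → α → ℝ) (hq : ∀ i, ∑ a, q i a = 1) (c : ℝ) :
    expect q (fun _ => c) = c := by
  rw [expect, ← Finset.sum_mul, sum_pi_prod]
  simp [hq]

lemma expect_apply (q : ι → α → ℝ) (hq : ∀ i, ∑ a, q i a = 1) (i : ι) (g : α → ℝ) :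
    expect q (fun f => g (f i)) = ∑ a, q i a * g a := by
  rw [expect_coord q i (hq i) (fun a _ => g a) (fun _ _ _ => rfl)]
  simp_rw [expect_const q hq]

lemma expect_apply_apply (q : ι → α → ℝ) (hq : ∀ i, ∑ a, q i a = 1) {i j : ι} (hij : j ≠ i)
    (g : α → α → ℝ) :
    expect q (fun f => g (f i) (f j)) = ∑ a, ∑ b, q i a * q j b * g a b := by
  rw [expect_coord q i (hq i) (fun a f => g a (f j))
    (fun a b f => by simp [Function.update_of_ne hij])]
  simp_rw [expect_apply q hq j, Finset.mul_sum, mul_assoc]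

lemma expect_add (q : ι → α → ℝ) (g h : (ι → α) → ℝ) :
    expect q (fun f => g f + h f) = expect q g + expect q h := by
  simp [expect, mul_add, Finset.sum_add_distrib]

lemma expect_const_mul (q : ι → α → ℝ) (c : ℝ) (g : (ι → α) → ℝ) :
    expect q (fun f => c * g f) = c * expect q g := by
  simp only [expect, Finset.mul_sum]
  exact Finset.sum_congr rfl fun _ _ => by ring

lemma expect_sum (q : ι → α → ℝ) {κ : Type*} (s : Finset κ) (g : κ → (ι → α) → ℝ) :
    expect q (fun f => ∑ k ∈ s, g k f) = ∑ k ∈ s, expect q (g k) := by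
  simp only [expect, Finset.mul_sum]
  exact Finset.sum_comm

lemma expect_mono (q : ι → α → ℝ) (hq : ∀ i a, 0 ≤ q i a) {g h : (ι → α) → ℝ}
    (hgh : ∀ f, g f ≤ h f) : expect q g ≤ expect q h :=
  Finset.sum_le_sum fun f _ =>
    mul_le_mul_of_nonneg_left (hgh f) (Finset.prod_nonneg fun i _ => hq i _)

/-- Some outcome does at least as well as the average. -/
lemma exists_le_of_expect_le (q : ι → α → ℝ) (hq : ∀ i a, 0 ≤ q i a)
    (hq1 : ∀ i, ∑ a, q i a = 1) {g : (ι → α) → ℝ} {c : ℝ} (h : expect q g ≤ c) :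
    ∃ f, g f ≤ c := by
  by_contra! hlt
  have hw : ∑ f : ι → α, ∏ i, q i (f i) = 1 := by
    have := expect_const q hq1 1
    simpa [expect] using this
  have : ∃ f ∈ (Finset.univ : Finset (ι → α)), 0 < ∏ i, q i (f i) := by
    apply Finset.exists_lt_of_sum_lt
    simp [hw]
  obtain ⟨f₀, -, hf₀⟩ := this
  have : expect q (fun _ => c) < expect q g :=
    Finset.sum_lt_sum (fun f _ => mul_le_mul_of_nonneg_left (hlt f).le
      (Finset.prod_nonneg fun i _ => hq i _)) ⟨f₀, Finset.mem_univ _,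
      mul_lt_mul_of_pos_left (hlt f₀) hf₀⟩
  rw [expect_const q hq1] at this
  linarith

/-- Chebyshev's second moment: the variance of a sum of independent centred variables. -/
lemma expect_sq_sum (q : ι → α → ℝ) (hq : ∀ i, ∑ a, q i a = 1) (g : ι → α → ℝ)
    (hg : ∀ i, ∑ a, q i a * g i a = 0) :
    expect q (fun f => (∑ i, g i (f i)) ^ 2) = ∑ i, ∑ a, q i a * g i a ^ 2 := by
  simp_rw [sq, Finset.sum_mul_sum]
  rw [expect_sum]
  refine Finset.sum_congr rfl fun i _ => ?_
  rw [expect_sum, Finset.sum_eq_single i]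
  · exact expect_apply q hq i (fun a => g i a * g i a)
  · intro j _ hj
    rw [expect_apply_apply q hq hj (fun a b => g i a * g j b)]
    have : ∀ a, ∑ b, q i a * q j b * (g i a * g j b) = 0 := by
      intro a
      rw [show (0 : ℝ) = q i a * g i a * ∑ b, q j b * g j b by rw [hg]; ring, Finset.mul_sum]
      exact Finset.sum_congr rfl fun _ _ => by ring
    simp [this]
  · simp

end ProductWeights

/-! ### Entropy of random variables on a finite probability space -/

section Entropy

variable {Ω Ω' α β γ τ : Type*} [Fintype Ω] [Fintype Ω'] [Fintype α] [Fintype β] [Fintype γ]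
  [Fintype τ]

lemma law_eq_sum_ite [DecidableEq α] (p : Ω → ℝ) (A : Ω → α) (a : α) :
    law p A a = ∑ ω, if A ω = a then p ω else 0 := by
  classical
  simp only [law, Set.indicator_apply, Set.mem_preimage, Set.mem_singleton_iff]

lemma sum_law_mul (p : Ω → ℝ) (A : Ω → α) (f : α → ℝ) :
    ∑ a, law p A a * f a = ∑ ω, p ω * f (A ω) := by
  classical
  simp_rw [law_eq_sum_ite, Finset.sum_mul]
  rw [Finset.sum_comm]
  simp

lemma sum_law (p : Ω → ℝ) (A : Ω → α) : ∑ a, law p A a = ∑ ω, p ω := by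
  simpa using sum_law_mul p A (fun _ => 1)

lemma law_nonneg {p : Ω → ℝ} (hp : ∀ ω, 0 ≤ p ω) (A : Ω → α) (a : α) : 0 ≤ law p A a :=
  Finset.sum_nonneg fun _ _ => Set.indicator_nonneg (fun _ _ => hp _) _

lemma law_mem_stdSimplex {p : Ω → ℝ} (hp : p ∈ stdSimplex ℝ Ω) (A : Ω → α) :
    law p A ∈ stdSimplex ℝ α :=
  ⟨law_nonneg hp.1 A, by rw [sum_law, hp.2]⟩

/-- The law of `f ∘ A` under `p` is the law of `f` under the law of `A`. -/
lemma law_law (p : Ω → ℝ) (A : Ω → α) (f : α → β) :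
    law (law p A) f = law p (fun ω => f (A ω)) := by
  classical
  ext b
  rw [law_eq_sum_ite, law_eq_sum_ite]
  have := sum_law_mul p A (fun a => if f a = b then 1 else 0)
  simpa using this

lemma le_law {p : Ω → ℝ} (hp : ∀ ω, 0 ≤ p ω) (A : Ω → α) (ω : Ω) : p ω ≤ law p A (A ω) := by
  classical
  rw [law_eq_sum_ite]
  have := Finset.single_le_sum (f := fun ω' => if A ω' = A ω then p ω' else 0)
    (fun i _ => by split_ifs; exacts [hp _, le_rfl]) (Finset.mem_univ ω)
  simpa using this

lemma sum_law_prod_left (p : Ω → ℝ) (A : Ω → α) (B : Ω → β) (b : β) :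
    ∑ a, law p (fun ω => (A ω, B ω)) (a, b) = law p B b := by
  classical
  simp_rw [law_eq_sum_ite]
  rw [Finset.sum_comm]
  refine Finset.sum_congr rfl fun ω _ => ?_
  by_cases h : B ω = b <;> simp [h]

lemma entropy_eq (p : Ω → ℝ) (A : Ω → α) :
    entropy p A = -∑ ω, p ω * Real.logb 2 (law p A (A ω)) := by
  rw [entropy, sum_law_mul p A (fun a => Real.logb 2 (law p A a))]

lemma entropy_law (p : Ω → ℝ) (A : Ω → α) (f : α → β) :
    entropy (law p A) f = entropy p (fun ω => f (A ω)) := by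
  rw [entropy, entropy, law_law]

/-- Gibbs' inequality: the entropy of `T` is at most its cross entropy with respect to any
subprobability `r`. -/
lemma entropy_le_cross {p : Ω → ℝ} (hp : p ∈ stdSimplex ℝ Ω) (T : Ω → τ) (r : τ → ℝ)
    (hr : ∀ t, 0 ≤ r t) (hr1 : ∑ t, r t ≤ 1) (hpos : ∀ ω, 0 < p ω → 0 < r (T ω)) :
    entropy p T ≤ -∑ ω, p ω * Real.logb 2 (r (T ω)) := by
  have hlog2 : 0 < Real.log 2 := Real.log_pos one_lt_two
  rw [entropy, neg_le_neg_iff, ← sum_law_mul p T (fun t => Real.logb 2 (r t)), ← sub_nonneg,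
    ← Finset.sum_sub_distrib]
  have h : ∀ t, (law p T t - r t) / Real.log 2 ≤
      law p T t * Real.logb 2 (law p T t) - law p T t * Real.logb 2 (r t) := by
    intro t
    rcases (law_nonneg hp.1 T t).eq_or_lt with h0 | h0
    · rw [← h0]
      have := div_nonneg (hr t) hlog2.le
      simp only [zero_sub, neg_div]
      linarith
    · have hrt : 0 < r t := by
        by_contra hcon
        classical
        rw [law_eq_sum_ite] at h0
        obtain ⟨ω, -, hω⟩ := Finset.exists_lt_of_sum_lt (s := Finset.univ)
          (f := fun _ : Ω => (0 : ℝ)) (by simpa using h0)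
        by_cases hT : T ω = t
        · rw [if_pos hT] at hω
          exact hcon (hT ▸ hpos ω hω)
        · simp [hT] at hω
      rw [← mul_sub, Real.logb, Real.logb, ← sub_div, ← mul_div_assoc]
      refine div_le_div_of_nonneg_right ?_ hlog2.le
      have := Real.log_le_sub_one_of_pos (div_pos hrt h0)
      rw [Real.log_div hrt.ne' h0.ne'] at this
      have h2 := mul_le_mul_of_nonneg_left this h0.le
      have h3 : law p T t * (r t / law p T t - 1) = r t - law p T t := by
        field_simp
      rw [h3] at h2
      nlinarith
  refine le_trans ?_ (Finset.sum_le_sum fun t _ => h t)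
  rw [← Finset.sum_div, Finset.sum_sub_distrib, sum_law, hp.2]
  exact div_nonneg (by linarith) hlog2.le

lemma law_pos {p : Ω → ℝ} (hp : ∀ ω, 0 ≤ p ω) (A : Ω → α) {ω : Ω} (h : 0 < p ω) :
    0 < law p A (A ω) :=
  h.trans_le (le_law hp A ω)

/-- The conditional form of Gibbs' inequality. -/
lemma condEntropy_le_cross {p : Ω → ℝ} (hp : p ∈ stdSimplex ℝ Ω) (A : Ω → α) (B : Ω → β)
    (κ : β → α → ℝ) (hκ : ∀ b a, 0 ≤ κ b a) (hκ1 : ∀ b, ∑ a, κ b a ≤ 1)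
    (hpos : ∀ ω, 0 < p ω → 0 < κ (B ω) (A ω)) :
    condEntropy p A B ≤ -∑ ω, p ω * Real.logb 2 (κ (B ω) (A ω)) := by
  have h := entropy_le_cross hp (fun ω => (A ω, B ω)) (fun t => κ t.2 t.1 * law p B t.2)
    (fun t => mul_nonneg (hκ _ _) (law_nonneg hp.1 _ _)) ?_
    (fun ω hω => mul_pos (hpos ω hω) (law_pos hp.1 B hω))
  · rw [condEntropy, entropy_eq p B]
    have h2 : ∀ ω, p ω * Real.logb 2 (κ (B ω) (A ω) * law p B (B ω))
        = p ω * Real.logb 2 (κ (B ω) (A ω)) + p ω * Real.logb 2 (law p B (B ω)) := by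
      intro ω
      rcases (hp.1 ω).eq_or_lt with h0 | h0
      · simp [← h0]
      · rw [Real.logb_mul (hpos ω h0).ne' (law_pos hp.1 B h0).ne', mul_add]
    simp only [h2, Finset.sum_add_distrib] at h
    linarith
  · rw [Fintype.sum_prod_type_right]
    simp only [← Finset.sum_mul]
    calc ∑ b, (∑ a, κ b a) * law p B b ≤ ∑ b, 1 * law p B b :=
          Finset.sum_le_sum fun b _ => mul_le_mul_of_nonneg_right (hκ1 b) (law_nonneg hp.1 _ _)
      _ = 1 := by simp [sum_law, hp.2]

/-- Equality in the conditional Gibbs inequality for the true conditional law. -/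
lemma condEntropy_eq_of_kernel {p : Ω → ℝ} (hp : ∀ ω, 0 ≤ p ω) (A : Ω → α) (B : Ω → β)
    (κ : β → α → ℝ)
    (h : ∀ a b, law p (fun ω => (A ω, B ω)) (a, b) = law p B b * κ b a) :
    condEntropy p A B = -∑ ω, p ω * Real.logb 2 (κ (B ω) (A ω)) := by
  rw [condEntropy, entropy_eq, entropy_eq]
  simp only [h]
  rw [← neg_add', ← sub_eq_add_neg, ← Finset.sum_sub_distrib]
  congr 1
  refine Finset.sum_congr rfl fun ω _ => ?_
  rcases (hp ω).eq_or_lt with h0 | h0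
  · simp [← h0]
  · have h1 := law_pos hp B h0
    have h2 : 0 < law p B (B ω) * κ (B ω) (A ω) := by
      rw [← h]; exact law_pos hp (fun ω => (A ω, B ω)) h0
    rw [Real.logb_mul h1.ne' (pos_of_mul_pos_right h2 h1.le).ne']
    ring

/-- A random variable that is determined by another has at most the entropy of the latter. -/
lemma entropy_le_of_determined {p : Ω → ℝ} (hp : ∀ ω, 0 ≤ p ω) {A : Ω → α} {B : Ω → β}
    (h : ∀ ω ω', A ω = A ω' → B ω = B ω') : entropy p B ≤ entropy p A := by
  classical
  rw [entropy_eq, entropy_eq, neg_le_neg_iff]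
  refine Finset.sum_le_sum fun ω _ => ?_
  rcases (hp ω).eq_or_lt with h0 | h0
  · simp [← h0]
  · refine mul_le_mul_of_nonneg_left (Real.logb_le_logb_of_le one_lt_two (law_pos hp A h0) ?_) h0.le
    rw [law_eq_sum_ite, law_eq_sum_ite]
    refine Finset.sum_le_sum fun ω' _ => ?_
    split_ifs with h1 h2
    · rfl
    · exact absurd (h _ _ h1) h2
    · exact hp _
    · rfl

/-- Random variables that determine each other have the same entropy. -/
lemma entropy_congr {p : Ω → ℝ} (hp : ∀ ω, 0 ≤ p ω) {A : Ω → α} {B : Ω → β}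
    (h : ∀ ω ω', A ω = A ω' ↔ B ω = B ω') : entropy p A = entropy p B :=
  le_antisymm (entropy_le_of_determined hp fun ω ω' => (h ω ω').2)
    (entropy_le_of_determined hp fun ω ω' => (h ω ω').1)

/-- Conditioning on more reduces entropy. -/
lemma condEntropy_comp_le {p : Ω → ℝ} (hp : p ∈ stdSimplex ℝ Ω) (A : Ω → α) (B : Ω → β)
    (f : β → γ) : condEntropy p A B ≤ condEntropy p A (fun ω => f (B ω)) := by
  have h := condEntropy_le_cross hp A B
    (fun b a => law p (fun ω => (A ω, f (B ω))) (a, f b) / law p (fun ω => f (B ω)) (f b))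
    (fun b a => div_nonneg (law_nonneg hp.1 _ _) (law_nonneg hp.1 _ _)) ?_
    (fun ω hω => div_pos (law_pos hp.1 (fun ω => (A ω, f (B ω))) hω)
      (law_pos hp.1 (fun ω => f (B ω)) hω))
  · refine h.trans_eq ?_
    rw [condEntropy, entropy_eq, entropy_eq, ← neg_add', ← sub_eq_add_neg,
      ← Finset.sum_sub_distrib]
    congr 1
    refine Finset.sum_congr rfl fun ω _ => ?_
    rcases (hp.1 ω).eq_or_lt with h0 | h0
    · simp [← h0]
    · rw [Real.logb_div (law_pos hp.1 (fun ω => (A ω, f (B ω))) h0).ne'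
        (law_pos hp.1 (fun ω => f (B ω)) h0).ne', mul_sub]
  · intro b
    rw [← Finset.sum_div, sum_law_prod_left p A (fun ω => f (B ω))]
    exact div_self_le_one _

/-- Conditional entropy of a tuple is subadditive, also when each component is conditioned on less
than the whole. -/
lemma condEntropy_pi_le {ι : Type*} [Fintype ι] [DecidableEq ι] {p : Ω → ℝ}
    (hp : p ∈ stdSimplex ℝ Ω) (A : Ω → ι → α) (B : Ω → β) (f : ι → β → γ) :
    condEntropy p A B ≤ ∑ i, condEntropy p (fun ω => A ω i) (fun ω => f i (B ω)) := by
  have h := condEntropy_le_cross hp A B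
    (fun b a => ∏ i, (law p (fun ω => (A ω i, f i (B ω))) (a i, f i b) /
      law p (fun ω => f i (B ω)) (f i b)))
    (fun b a => Finset.prod_nonneg fun i _ => div_nonneg (law_nonneg hp.1 _ _)
      (law_nonneg hp.1 _ _)) ?_
    (fun ω hω => Finset.prod_pos fun i _ => div_pos (law_pos hp.1 (fun ω => (A ω i, f i (B ω))) hω)
      (law_pos hp.1 (fun ω => f i (B ω)) hω))
  · refine h.trans_eq ?_
    simp_rw [condEntropy, entropy_eq]
    rw [Finset.sum_sub_distrib, Finset.sum_neg_distrib, Finset.sum_neg_distrib, ← neg_add',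
      ← sub_eq_add_neg, Finset.sum_comm, Finset.sum_comm (s := Finset.univ (α := ι)),
      ← Finset.sum_sub_distrib]
    congr 1
    refine Finset.sum_congr rfl fun ω _ => ?_
    rw [← Finset.sum_sub_distrib]
    rcases (hp.1 ω).eq_or_lt with h0 | h0
    · simp [← h0]
    · rw [Real.logb_prod _ _ fun i _ => (div_pos (law_pos hp.1 (fun ω => (A ω i, f i (B ω))) h0)
        (law_pos hp.1 (fun ω => f i (B ω)) h0)).ne', Finset.mul_sum]
      refine Finset.sum_congr rfl fun i _ => ?_
      rw [Real.logb_div (law_pos hp.1 (fun ω => (A ω i, f i (B ω))) h0).ne'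
        (law_pos hp.1 (fun ω => f i (B ω)) h0).ne', mul_sub]
  · intro b
    have := Finset.prod_univ_sum (fun _ : ι => (Finset.univ : Finset α))
      (fun i a => law p (fun ω => (A ω i, f i (B ω))) (a, f i b) /
      law p (fun ω => f i (B ω)) (f i b))
    rw [Fintype.piFinset_univ] at this
    rw [← this]
    refine Finset.prod_le_one (fun i _ => Finset.sum_nonneg fun a _ => div_nonneg
      (law_nonneg hp.1 _ _) (law_nonneg hp.1 _ _)) fun i _ => ?_
    rw [← Finset.sum_div, sum_law_prod_left p (fun ω => A ω i) (fun ω => f i (B ω))]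
    exact div_self_le_one _

lemma entropy_of_subsingleton {p : Ω → ℝ} (hp : p ∈ stdSimplex ℝ Ω) [Subsingleton α]
    (A : Ω → α) : entropy p A = 0 := by
  classical
  rw [entropy_eq]
  have : ∀ ω, law p A (A ω) = 1 := by
    intro ω
    rw [law_eq_sum_ite, ← hp.2]
    exact Finset.sum_congr rfl fun ω' _ => by rw [if_pos (Subsingleton.elim _ _)]
  simp [this]

lemma entropy_pi_le {ι : Type*} [Fintype ι] [DecidableEq ι] {p : Ω → ℝ}
    (hp : p ∈ stdSimplex ℝ Ω) (A : Ω → ι → α) :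
    entropy p A ≤ ∑ i, entropy p (fun ω => A ω i) := by
  have h := condEntropy_pi_le hp A (fun _ => ()) (fun _ x => x)
  simp only [condEntropy, entropy_of_subsingleton hp (fun _ => ()), sub_zero] at h
  rw [entropy_congr hp.1 (B := A) (fun _ _ => by simp)] at h
  refine h.trans_eq (Finset.sum_congr rfl fun i _ => ?_)
  exact entropy_congr hp.1 (fun _ _ => by simp)

/-- Fano's inequality, with the error event measured through any `e` that is at least the
probability of a wrong guess. -/
lemma fano {p : Ω → ℝ} (hp : p ∈ stdSimplex ℝ Ω) (A : Ω → α) (B : Ω → β) (g : β → α)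
    {M : ℝ} (hM : Fintype.card α ≤ M) (hM1 : 1 ≤ M) {e : ℝ}
    (he : ∑ ω, p ω * (Set.indicator {ω | g (B ω) ≠ A ω} 1 ω) ≤ e) :
    condEntropy p A B ≤ 1 + e * Real.logb 2 M := by
  classical
  have hM0 : 0 < M := by linarith
  have hl : 0 ≤ Real.logb 2 M := Real.logb_nonneg one_lt_two hM1
  -- the guess gets probability one half, and the rest is spread evenly
  have h := condEntropy_le_cross hp A B
    (fun b a => if g b = a then 1 / 2 else 1 / 2 * M⁻¹)
    (fun b a => by positivity) ?_ (fun ω _ => by split_ifs <;> positivity)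
  · refine h.trans ?_
    have : ∀ ω, -(p ω * Real.logb 2 (if g (B ω) = A ω then 1 / 2 else 1 / 2 * M⁻¹))
        = p ω + (p ω * (Set.indicator {ω | g (B ω) ≠ A ω} 1 ω)) * Real.logb 2 M := by
      intro ω
      have h2 : Real.logb 2 (1 / 2) = -1 := by
        rw [one_div, Real.logb_inv, Real.logb_self_eq_one one_lt_two]
      by_cases hg : g (B ω) = A ω
      · simp only [hg, if_true, h2]; simp [hg]
      · rw [if_neg hg, Real.logb_mul (by norm_num) (by positivity), h2, Real.logb_inv]
        simp [hg]; ring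
    rw [← Finset.sum_neg_distrib]
    simp_rw [this]
    rw [Finset.sum_add_distrib, hp.2, ← Finset.sum_mul]
    gcongr
  · intro b
    calc ∑ a, (if g b = a then (1 : ℝ) / 2 else 1 / 2 * M⁻¹)
        ≤ ∑ a, ((if g b = a then (1 : ℝ) / 2 else 0) + 1 / 2 * M⁻¹) := by
          refine Finset.sum_le_sum fun a _ => ?_
          split_ifs
          · have : 0 ≤ 1 / 2 * M⁻¹ := by positivity
            linarith
          · simp
      _ = 1 / 2 + Fintype.card α * (1 / 2 * M⁻¹) := by
          rw [Finset.sum_add_distrib]; simp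
      _ ≤ 1 / 2 + M * (1 / 2 * M⁻¹) := by gcongr
      _ = 1 := by field_simp; norm_num

end Entropy

/-! ### The rate constraints in terms of entropies -/

section Constraints

variable {Ω α β γ : Type*} [Fintype Ω] [Fintype α] [Fintype β] [Fintype γ]

lemma condEntropy_law (p : Ω → ℝ) {τ : Type*} [Fintype τ] (T : Ω → τ) (A : τ → α) (B : τ → β) :
    condEntropy (law p T) A B = condEntropy p (fun ω => A (T ω)) (fun ω => B (T ω)) := by
  rw [condEntropy, condEntropy, entropy_law, entropy_law]

lemma condMutualInfo_comm {p : Ω → ℝ} (hp : ∀ ω, 0 ≤ p ω) (A : Ω → α) (B : Ω → β) (C : Ω → γ) :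
    condMutualInfo p A B C = condEntropy p B C - condEntropy p B (fun ω => (A ω, C ω)) := by
  simp only [condMutualInfo, condEntropy]
  rw [entropy_congr hp (A := fun ω => (A ω, B ω, C ω)) (B := fun ω => (B ω, A ω, C ω))
    (fun ω ω' => by simp; tauto)]
  ring

lemma condEntropy_nonneg {p : Ω → ℝ} (hp : ∀ ω, 0 ≤ p ω) (A : Ω → α) (B : Ω → β) :
    0 ≤ condEntropy p A B :=
  sub_nonneg.2 (entropy_le_of_determined hp fun ω ω' => by simp)

lemma condEntropy_le_entropy {p : Ω → ℝ} (hp : p ∈ stdSimplex ℝ Ω) (A : Ω → α) (B : Ω → β) :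
    condEntropy p A B ≤ entropy p A := by
  refine (condEntropy_comp_le hp A B (fun _ => ())).trans_eq ?_
  rw [condEntropy, entropy_of_subsingleton hp (fun _ => ()), sub_zero]
  exact entropy_congr hp.1 fun _ _ => by simp

end Constraints

section Region

variable {X₁ X₂ S Y Z U : Type*} [Fintype X₁] [Fintype X₂] [Fintype S] [Fintype Y] [Fintype Z]
  [Fintype U]

/-- The channel law of the second output alone. -/
def transZ (ch : Channel X₁ X₂ S Y Z) (x₁ : X₁) (x₂ : X₂) (s : S) (z : Z) : ℝ :=
  ∑ y, ch.trans x₁ x₂ s (y, z)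

lemma sum_transZ (ch : Channel X₁ X₂ S Y Z) (x₁ : X₁) (x₂ : X₂) (s : S) :
    ∑ z, transZ ch x₁ x₂ s z = 1 := by
  rw [← (ch.trans_mem x₁ x₂ s).2, Fintype.sum_prod_type_right]
  rfl

lemma sum_jointLaw_mul (ch : Channel X₁ X₂ S Y Z) (pX₁ : X₁ → ℝ) (pUX₂ : X₁ → S → U × X₂ → ℝ)
    (g : X₁ × S × U × X₂ → Z → ℝ) :
    ∑ t, jointLaw ch pX₁ pUX₂ t * g (t.1, t.2.1, t.2.2.1, t.2.2.2.1) t.2.2.2.2.2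
      = ∑ x₁, ∑ s, ∑ u, ∑ x₂, pX₁ x₁ * ch.stateLaw s * pUX₂ x₁ s (u, x₂) *
        ∑ z, transZ ch x₁ x₂ s z * g (x₁, s, u, x₂) z := by
  simp_rw [Fintype.sum_prod_type, jointLaw]
  refine Finset.sum_congr rfl fun x₁ _ => Finset.sum_congr rfl fun s _ =>
    Finset.sum_congr rfl fun u _ => Finset.sum_congr rfl fun x₂ _ => ?_
  rw [Finset.sum_comm, Finset.mul_sum]
  refine Finset.sum_congr rfl fun z _ => ?_
  rw [transZ, Finset.sum_mul, Finset.mul_sum]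
  exact Finset.sum_congr rfl fun y _ => by ring

lemma sum_jointLaw_mul_input (ch : Channel X₁ X₂ S Y Z) (pX₁ : X₁ → ℝ)
    (pUX₂ : X₁ → S → U × X₂ → ℝ) (g : X₁ × S × U × X₂ → ℝ) :
    ∑ t, jointLaw ch pX₁ pUX₂ t * g (t.1, t.2.1, t.2.2.1, t.2.2.2.1)
      = ∑ x₁, ∑ s, ∑ u, ∑ x₂, pX₁ x₁ * ch.stateLaw s * pUX₂ x₁ s (u, x₂) * g (x₁, s, u, x₂) := by
  rw [sum_jointLaw_mul ch pX₁ pUX₂ fun v _ => g v]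
  simp_rw [← Finset.sum_mul, sum_transZ, one_mul]

lemma jointLaw_mem_stdSimplex (ch : Channel X₁ X₂ S Y Z) {pX₁ : X₁ → ℝ}
    (hX₁ : pX₁ ∈ stdSimplex ℝ X₁) {pUX₂ : X₁ → S → U × X₂ → ℝ}
    (hUX₂ : ∀ x₁ s, pUX₂ x₁ s ∈ stdSimplex ℝ (U × X₂)) :
    jointLaw ch pX₁ pUX₂ ∈ stdSimplex ℝ (X₁ × S × U × X₂ × Y × Z) := by
  refine ⟨fun t => mul_nonneg (mul_nonneg (mul_nonneg (hX₁.1 _) (ch.stateLaw_mem.1 _))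
    ((hUX₂ _ _).1 _)) ((ch.trans_mem _ _ _).1 _), ?_⟩
  have h := sum_jointLaw_mul_input ch pX₁ pUX₂ fun _ => 1
  have h2 : ∀ x₁ s, ∑ u, ∑ x₂, pUX₂ x₁ s (u, x₂) = 1 := fun x₁ s => by
    rw [← Fintype.sum_prod_type (f := pUX₂ x₁ s)]; exact (hUX₂ x₁ s).2
  simpa [← Finset.mul_sum, h2, ch.stateLaw_mem.2, hX₁.2] using h

/-- Given all inputs of the channel, possibly together with `U`, the output `Z` has the law
`transZ`. -/
lemma law_output_jointLaw {β : Type*} [Fintype β] (ch : Channel X₁ X₂ S Y Z) (pX₁ : X₁ → ℝ)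
    (pUX₂ : X₁ → S → U × X₂ → ℝ) (f : X₁ × S × U × X₂ → β) (κ : β → Z → ℝ)
    (hκ : ∀ v, κ (f v) = transZ ch v.1 v.2.2.2 v.2.1) (z : Z) (b : β) :
    law (jointLaw ch pX₁ pUX₂) (fun t => (t.2.2.2.2.2, f (t.1, t.2.1, t.2.2.1, t.2.2.2.1))) (z, b)
      = law (jointLaw ch pX₁ pUX₂) (fun t => f (t.1, t.2.1, t.2.2.1, t.2.2.2.1)) b * κ b z := by
  classical
  have h1 := sum_jointLaw_mul ch pX₁ pUX₂ fun v z' => if (z', f v) = (z, b) then 1 else 0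
  have h2 := sum_jointLaw_mul_input ch pX₁ pUX₂ fun v => if f v = b then 1 else 0
  rw [law_eq_sum_ite, law_eq_sum_ite]
  simp only [mul_ite, mul_one, mul_zero] at h1 h2
  rw [h1, h2]
  simp_rw [Finset.sum_mul]
  refine Finset.sum_congr rfl fun x₁ _ => Finset.sum_congr rfl fun s _ =>
    Finset.sum_congr rfl fun u _ => Finset.sum_congr rfl fun x₂ _ => ?_
  by_cases hb : f (x₁, s, u, x₂) = b
  · have := hκ (x₁, s, u, x₂)
    rw [hb] at this
    simp [hb, this]
  · simp [hb]

/-- The entropy `H(Z | X₁ X₂ S)` left in the second output by the channel noise. -/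
def noise (ch : Channel X₁ X₂ S Y Z) (p : X₁ × S × U × X₂ × Y × Z → ℝ) : ℝ :=
  -∑ t, p t * Real.logb 2 (transZ ch t.1 t.2.2.2.1 t.2.1 t.2.2.2.2.2)

lemma condEntropy_output (ch : Channel X₁ X₂ S Y Z) {β : Type*} [Fintype β] {pX₁ : X₁ → ℝ}
    {pUX₂ : X₁ → S → U × X₂ → ℝ} (h0 : ∀ t, 0 ≤ jointLaw ch pX₁ pUX₂ t)
    (f : X₁ × S × U × X₂ → β) (κ : β → Z → ℝ)
    (hκ : ∀ v, κ (f v) = transZ ch v.1 v.2.2.2 v.2.1) :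
    condEntropy (jointLaw ch pX₁ pUX₂) (fun t => t.2.2.2.2.2)
      (fun t => f (t.1, t.2.1, t.2.2.1, t.2.2.2.1)) = noise ch (jointLaw ch pX₁ pUX₂) := by
  rw [condEntropy_eq_of_kernel h0 _ _ κ (law_output_jointLaw ch pX₁ pUX₂ f κ hκ), noise]
  simp [hκ]

/-- The rate constraints, with the terms that involve `X₂` reduced to the channel noise. -/
lemma rateBounds_jointLaw_iff (ch : Channel X₁ X₂ S Y Z) {pX₁ : X₁ → ℝ}
    {pUX₂ : X₁ → S → U × X₂ → ℝ} {p : X₁ × S × U × X₂ × Y × Z → ℝ}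
    (hp : p = jointLaw ch pX₁ pUX₂) (h0 : ∀ t, 0 ≤ p t) (R : ℝ × ℝ) :
    RateBounds p R ↔
      R.1 ≤ entropy p (fun t => t.2.2.2.2.1) - condEntropy p (fun t => t.2.1) (fun t => t.1)
        + (entropy p (fun t => (t.2.2.1, t.2.1, t.1))
          - entropy p (fun t => (t.2.2.1, t.1, t.2.2.2.2.1))) ∧
      R.2 ≤ condEntropy p (fun t => t.2.2.2.2.2) (fun t => (t.2.1, t.1)) - noise ch p ∧
      R.1 + R.2 ≤ condEntropy p (fun t => t.2.2.2.2.2) (fun t => t.2.1) - noise ch p ∧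
      R.1 + R.2 ≤ entropy p (fun t => t.2.2.2.2.1) - condEntropy p (fun t => t.2.1) (fun t => t.1)
        + (entropy p (fun t => (t.2.2.1, t.2.1, t.1))
          - entropy p (fun t => (t.2.2.1, t.1, t.2.2.2.2.1)))
        + (condEntropy p (fun t => t.2.2.2.2.2) (fun t => (t.1, t.2.2.1, t.2.1))
          - noise ch p) := by
  have hA : mutualInfo p (fun t => (t.1, t.2.2.1)) (fun t => t.2.2.2.2.1)
      - condMutualInfo p (fun t => t.2.2.1) (fun t => t.2.1) (fun t => t.1)
      = entropy p (fun t => t.2.2.2.2.1) - condEntropy p (fun t => t.2.1) (fun t => t.1)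
        + (entropy p (fun t => (t.2.2.1, t.2.1, t.1))
          - entropy p (fun t => (t.2.2.1, t.1, t.2.2.2.2.1))) := by
    simp only [mutualInfo, condMutualInfo, condEntropy]
    rw [entropy_congr h0 (A := fun t => ((t.1, t.2.2.1), t.2.2.2.2.1))
      (B := fun t => (t.2.2.1, t.1, t.2.2.2.2.1)) (fun _ _ => by simp; tauto),
      entropy_congr h0 (A := fun t => (t.1, t.2.2.1))
      (B := fun t => (t.2.2.1, t.1)) (fun _ _ => by simp; tauto)]
    ring
  have h0' : ∀ t, 0 ≤ jointLaw ch pX₁ pUX₂ t := hp ▸ h0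
  have hB : condMutualInfo p (fun t => t.2.2.2.1) (fun t => t.2.2.2.2.2) (fun t => (t.2.1, t.1))
      = condEntropy p (fun t => t.2.2.2.2.2) (fun t => (t.2.1, t.1)) - noise ch p := by
    rw [condMutualInfo_comm h0, hp]
    congr 1
    exact condEntropy_output ch h0' (fun v => (v.2.2.2, v.2.1, v.1))
      (fun b => transZ ch b.2.2 b.1 b.2.1) fun _ => rfl
  have hC : condMutualInfo p (fun t => (t.1, t.2.2.2.1)) (fun t => t.2.2.2.2.2) (fun t => t.2.1)
      = condEntropy p (fun t => t.2.2.2.2.2) (fun t => t.2.1) - noise ch p := by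
    rw [condMutualInfo_comm h0, hp]
    congr 1
    exact condEntropy_output ch h0' (fun v => ((v.1, v.2.2.2), v.2.1))
      (fun b => transZ ch b.1.1 b.1.2 b.2) fun _ => rfl
  have hD : condMutualInfo p (fun t => t.2.2.2.1) (fun t => t.2.2.2.2.2)
      (fun t => (t.1, t.2.2.1, t.2.1))
      = condEntropy p (fun t => t.2.2.2.2.2) (fun t => (t.1, t.2.2.1, t.2.1)) - noise ch p := by
    rw [condMutualInfo_comm h0, hp]
    congr 1
    exact condEntropy_output ch h0' (fun v => (v.2.2.2, v.1, v.2.2.1, v.2.1))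
      (fun b => transZ ch b.2.1 b.1 b.2.2.2) fun _ => rfl
  rw [RateBounds, hA, hB, hC, add_sub_right_comm, hA, hD]

/-- Any nonnegative weights on `(X₁, S, U, X₂)` under which `X₁` and `S` have the product law
factor through a conditional law of `(U, X₂)`. -/
lemma exists_conditional_law [Nonempty (U × X₂)] {r : X₁ → S → ℝ}
    (q : X₁ → S → U × X₂ → ℝ) (hq : ∀ x₁ s v, 0 ≤ q x₁ s v) (hr : ∀ x₁ s, ∑ v, q x₁ s v = r x₁ s) :
    ∃ pUX₂ : X₁ → S → U × X₂ → ℝ, (∀ x₁ s, pUX₂ x₁ s ∈ stdSimplex ℝ (U × X₂)) ∧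
      ∀ x₁ s v, r x₁ s * pUX₂ x₁ s v = q x₁ s v := by
  classical
  obtain ⟨v₀⟩ := ‹Nonempty (U × X₂)›
  refine ⟨fun x₁ s => if r x₁ s = 0 then Pi.single v₀ 1 else fun v => q x₁ s v / r x₁ s,
    fun x₁ s => ?_, fun x₁ s v => ?_⟩
  · dsimp only
    split_ifs with h
    · exact single_mem_stdSimplex ℝ v₀
    · refine ⟨fun v => div_nonneg (hq _ _ _) ?_, ?_⟩
      · rw [← hr]; exact Finset.sum_nonneg fun v _ => hq _ _ _
      · rw [← Finset.sum_div, hr, div_self h]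
  · by_cases h : r x₁ s = 0
    · rw [h, zero_mul]
      exact ((Finset.sum_eq_zero_iff_of_nonneg fun v _ => hq x₁ s v).1 ((hr x₁ s).trans h) v
        (Finset.mem_univ v)).symm
    · simp only [h, if_false]
      field_simp

end Region

/-! ### Compactness of the set of input laws -/

section Closed

variable {Ω α β γ : Type*} [Fintype Ω] [Fintype α] [Fintype β] [Fintype γ]

lemma continuous_law (A : Ω → α) (a : α) : Continuous fun p : Ω → ℝ => law p A a := by
  classical
  simp_rw [law_eq_sum_ite]
  refine continuous_finsetSum _ fun ω _ => ?_
  split_ifs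
  · exact continuous_apply ω
  · exact continuous_const

@[fun_prop]
lemma continuous_entropy (A : Ω → α) : Continuous fun p : Ω → ℝ => entropy p A := by
  refine (continuous_finsetSum _ fun a _ => ?_).neg
  have h : Continuous fun x : ℝ => x * Real.logb 2 x := by
    have := Real.continuous_mul_log.div_const (Real.log 2)
    simpa [Real.logb, mul_div_assoc] using this
  exact h.comp (continuous_law A a)

lemma continuous_condEntropy (A : Ω → α) (B : Ω → β) :
    Continuous fun p : Ω → ℝ => condEntropy p A B :=
  (continuous_entropy _).sub (continuous_entropy _)

lemma continuous_mutualInfo (A : Ω → α) (B : Ω → β) :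
    Continuous fun p : Ω → ℝ => mutualInfo p A B :=
  (continuous_entropy _).sub (continuous_condEntropy _ _)

lemma continuous_condMutualInfo (A : Ω → α) (B : Ω → β) (C : Ω → γ) :
    Continuous fun p : Ω → ℝ => condMutualInfo p A B C :=
  (continuous_condEntropy _ _).sub (continuous_condEntropy _ _)

end Closed

section Region

variable {X₁ X₂ S Y Z : Type*} [Fintype X₁] [Fintype X₂] [Fintype S] [Fintype Y] [Fintype Z]

/-- The rate pairs, of either sign, that satisfy the four constraints for some auxiliary random
variable with values in `U`. -/
def rateRegion (ch : Channel X₁ X₂ S Y Z) (U : Type*) [Fintype U] : Set (ℝ × ℝ) :=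
  {R | ∃ pX₁ ∈ stdSimplex ℝ X₁, ∃ pUX₂ : X₁ → S → U × X₂ → ℝ,
    (∀ x₁ s, pUX₂ x₁ s ∈ stdSimplex ℝ (U × X₂)) ∧ RateBounds (jointLaw ch pX₁ pUX₂) R}

lemma isClosed_setOf_rateBounds (U : Type*) [Fintype U] :
    IsClosed {v : (X₁ × S × U × X₂ × Y × Z → ℝ) × (ℝ × ℝ) | RateBounds v.1 v.2} := by
  have hR₁ : Continuous fun v : (X₁ × S × U × X₂ × Y × Z → ℝ) × (ℝ × ℝ) => v.2.1 := by fun_prop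
  have hR₂ : Continuous fun v : (X₁ × S × U × X₂ × Y × Z → ℝ) × (ℝ × ℝ) => v.2.2 := by fun_prop
  refine (isClosed_le hR₁ ?_).inter ((isClosed_le hR₂ ?_).inter
    ((isClosed_le (hR₁.add hR₂) ?_).inter (isClosed_le (hR₁.add hR₂) ?_)))
  · exact ((continuous_mutualInfo _ _).sub (continuous_condMutualInfo _ _ _)).comp continuous_fst
  · exact (continuous_condMutualInfo _ _ _).comp continuous_fst
  · exact (continuous_condMutualInfo _ _ _).comp continuous_fst
  · exact (((continuous_mutualInfo _ _).add (continuous_condMutualInfo _ _ _)).sub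
      (continuous_condMutualInfo _ _ _)).comp continuous_fst

lemma isClosed_rateRegion (ch : Channel X₁ X₂ S Y Z) (U : Type*) [Fintype U] :
    IsClosed (rateRegion ch U) := by
  let K : Set ((X₁ → ℝ) × (X₁ → S → U × X₂ → ℝ)) :=
    stdSimplex ℝ X₁ ×ˢ Set.pi Set.univ fun _ => Set.pi Set.univ fun _ => stdSimplex ℝ (U × X₂)
  have hK : IsCompact K := (isCompact_stdSimplex ℝ X₁).prod
    (isCompact_univ_pi fun _ => isCompact_univ_pi fun _ => isCompact_stdSimplex ℝ _)
  have : CompactSpace K := isCompact_iff_compactSpace.1 hK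
  have hc : Continuous fun v : K × (ℝ × ℝ) => (jointLaw ch v.1.1.1 v.1.1.2, v.2) := by
    refine Continuous.prodMk (continuous_pi fun t => ?_) continuous_snd
    simp only [jointLaw]
    fun_prop
  have h := isClosedMap_snd_of_compactSpace _
    ((isClosed_setOf_rateBounds (X₁ := X₁) (X₂ := X₂) (S := S) (Y := Y) (Z := Z) U).preimage hc)
  convert h using 1
  ext R
  constructor
  · rintro ⟨pX₁, h₁, pUX₂, h₂, hR⟩
    exact ⟨(⟨(pX₁, pUX₂), h₁, fun x₁ _ s _ => h₂ x₁ s⟩, R), hR, rfl⟩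
  · rintro ⟨⟨⟨⟨pX₁, pUX₂⟩, h₁, h₂⟩, R'⟩, hR, rfl⟩
    exact ⟨pX₁, h₁, pUX₂, fun x₁ s => h₂ x₁ trivial s trivial, hR⟩

end Region

/-! ### Bounding the size of the auxiliary alphabet -/

section Support

/-- Nonnegative weights can be moved to at most as many indices as there are linear quantities to
preserve, without decreasing a further linear quantity `a`: this is a vertex of a bounded linear
program.  Boundedness comes from the positive functional `m`, which factors through `v`. -/
lemma exists_weights_small_support {I V : Type*} [AddCommGroup V] [Module ℝ V]
    [FiniteDimensional ℝ V] (v : I → V) (m : V →ₗ[ℝ] ℝ) (a : I → ℝ) :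
    ∀ (s : Finset I) (_ : ∀ i ∈ s, 0 < m (v i)) (w : I → ℝ) (_ : ∀ i ∈ s, 0 ≤ w i),
    ∃ t ⊆ s, t.card ≤ Module.finrank ℝ V ∧ ∃ w' : I → ℝ, (∀ i ∈ t, 0 ≤ w' i) ∧
      ∑ i ∈ t, w' i • v i = ∑ i ∈ s, w i • v i ∧
      ∑ i ∈ s, w i * a i ≤ ∑ i ∈ t, w' i * a i := by
  classical
  intro s
  induction s using Finset.strongInduction with
  | H s ih =>
    intro hm w hw
    by_cases hs : s.card ≤ Module.finrank ℝ V
    · exact ⟨s, subset_rfl, hs, w, hw, rfl, le_rfl⟩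
    -- a linear relation between the vectors, oriented so that `a` does not decrease along it
    obtain ⟨c, hcv, hca, i₀, hi₀, hc₀⟩ : ∃ c : I → ℝ, ∑ i ∈ s, c i • v i = 0 ∧
        0 ≤ ∑ i ∈ s, c i * a i ∧ ∃ i ∈ s, c i ≠ 0 := by
      have hdep : ¬ LinearIndependent ℝ (fun i : s => v i) := fun h => hs (by
        simpa using h.fintype_card_le_finrank)
      obtain ⟨g, hg, ⟨i, hi⟩, hgi⟩ := Fintype.not_linearIndependent_iff.1 hdep
      let c : I → ℝ := fun i => if h : i ∈ s then g ⟨i, h⟩ else 0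
      have hc : ∑ i ∈ s, c i • v i = 0 := by
        rw [← Finset.sum_coe_sort, ← hg]
        exact Finset.sum_congr rfl fun j _ => by simp [c]
      have hci : c i ≠ 0 := by simpa [c, hi] using hgi
      rcases le_total 0 (∑ i ∈ s, c i * a i) with h | h
      · exact ⟨c, hc, h, i, hi, hci⟩
      · exact ⟨-c, by simp [hc], by simpa using h, i, hi, by simpa using hci⟩
    -- some coefficient is negative since the positive functional vanishes on the relation
    obtain ⟨i₁, hi₁, hc₁⟩ : ∃ i ∈ s, c i < 0 := by
      by_contra! hcon
      have h0 : ∑ i ∈ s, c i * m (v i) = 0 := by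
        have := congrArg m hcv
        simpa using this
      have := (Finset.sum_eq_zero_iff_of_nonneg fun i hi =>
        mul_nonneg (hcon i hi) (hm i hi).le).1 h0 i₀ hi₀
      exact hc₀ ((mul_eq_zero.1 this).resolve_right (hm i₀ hi₀).ne')
    let N := s.filter fun i => c i < 0
    obtain ⟨j, hj, hjmin⟩ := N.exists_min_image (fun i => w i / (-c i))
      ⟨i₁, by simp [N, hi₁, hc₁]⟩
    obtain ⟨hjs, hcj⟩ : j ∈ s ∧ c j < 0 := by simpa [N] using hj
    -- move along the relation until the first weight, that of `j`, vanishes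
    let r := w j / (-c j)
    have hr : 0 ≤ r := div_nonneg (hw j hjs) (by linarith)
    let w₁ : I → ℝ := fun i => w i + r * c i
    have hw₁j : w₁ j = 0 := by
      simp only [w₁, r]; field_simp [hcj.ne]; ring
    have hw₁ : ∀ i ∈ s, 0 ≤ w₁ i := by
      intro i hi
      rcases lt_or_ge (c i) 0 with h | h
      · have := hjmin i (by simp [N, hi, h])
        rw [le_div_iff₀ (by linarith)] at this
        simp only [w₁, r]; linarith
      · exact add_nonneg (hw i hi) (mul_nonneg hr h)
    obtain ⟨t, hts, htc, w', hw', hv', ha'⟩ := ih (s.erase j) (Finset.erase_ssubset hjs)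
      (fun i hi => hm i (Finset.mem_of_mem_erase hi)) w₁
      (fun i hi => hw₁ i (Finset.mem_of_mem_erase hi))
    refine ⟨t, hts.trans (Finset.erase_subset _ _), htc, w', hw', ?_, ?_⟩
    · rw [hv', Finset.sum_erase _ (by rw [hw₁j, zero_smul])]
      simp only [w₁, add_smul, Finset.sum_add_distrib, mul_smul, ← Finset.smul_sum, hcv, smul_zero,
        add_zero]
    · refine le_trans ?_ ha'
      rw [Finset.sum_erase _ (by rw [hw₁j, zero_mul])]
      simp only [w₁, add_mul, Finset.sum_add_distrib, mul_assoc, ← Finset.mul_sum]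
      exact le_add_of_nonneg_right (mul_nonneg hr hca)

end Support

section Reduction

variable {U J Ω α β : Type*} [Fintype U] [Fintype J] [Fintype Ω] [Fintype α] [Fintype β]

lemma negMulLogb_mul (w l : ℝ) :
    -(w * l * Real.logb 2 (w * l))
      = w * -(l * Real.logb 2 l) + l * -(w * Real.logb 2 w) := by
  rcases eq_or_ne w 0 with rfl | hw
  · simp
  rcases eq_or_ne l 0 with rfl | hl
  · simp
  rw [Real.logb_mul hw hl]; ring

/-- The part of `H(U, A)` contributed by the value `u` of `U`, the first component. -/
def entropyPart (p : U × Ω → ℝ) (A : Ω → α) (u : U) : ℝ :=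
  ∑ a, -(law p (fun t => (t.1, A t.2)) (u, a) * Real.logb 2 (law p (fun t => (t.1, A t.2)) (u, a)))

lemma entropy_eq_sum_part (p : U × Ω → ℝ) (A : Ω → α) :
    entropy p (fun t => (t.1, A t.2)) = ∑ u, entropyPart p A u := by
  rw [entropy, Fintype.sum_prod_type, ← Finset.sum_neg_distrib]
  exact Finset.sum_congr rfl fun u _ => by rw [entropyPart, Finset.sum_neg_distrib]

lemma law_fst_mk (p : U × Ω → ℝ) (A : Ω → α) (u : U) (a : α) :
    law p (fun t => (t.1, A t.2)) (u, a) = law (fun ω => p (u, ω)) A a := by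
  classical
  rw [law_eq_sum_ite, law_eq_sum_ite, Fintype.sum_prod_type, Finset.sum_eq_single u]
  · simp
  · intro b _ hb; simp [hb]
  · simp

lemma entropyPart_eq_zero {p : U × Ω → ℝ} (A : Ω → α) {u : U} (h : ∀ ω, p (u, ω) = 0) :
    entropyPart p A u = 0 := by
  have h0 : (fun ω => p (u, ω)) = fun _ => 0 := funext h
  simp only [entropyPart, law_fst_mk, h0]
  simp [law]

lemma entropyPart_rescale (p : U × Ω → ℝ) (w : J → ℝ) (e : J → U) (A : Ω → α) (j : J) :
    entropyPart (fun t : J × Ω => w t.1 * p (e t.1, t.2)) A j = w j * entropyPart p A (e j)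
      + (∑ ω, p (e j, ω)) * -(w j * Real.logb 2 (w j)) := by
  classical
  have h : ∀ a, law (fun t : J × Ω => w t.1 * p (e t.1, t.2)) (fun t => (t.1, A t.2)) (j, a)
      = w j * law p (fun t => (t.1, A t.2)) (e j, a) := by
    intro a
    rw [law_fst_mk, law_fst_mk, law_eq_sum_ite, law_eq_sum_ite, Finset.mul_sum]
    exact Finset.sum_congr rfl fun ω _ => by rw [mul_ite, mul_zero]
  simp only [entropyPart, h, negMulLogb_mul, Finset.sum_add_distrib, ← Finset.mul_sum,
    ← Finset.sum_mul]
  congr 2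
  simp only [law_fst_mk]
  exact sum_law _ _

/-- If the mass at each value of `U` is rescaled, the difference of two joint entropies with `U`
is rescaled part by part. -/
lemma entropy_sub_entropy_rescale (p : U × Ω → ℝ) (w : J → ℝ) (e : J → U) (A : Ω → α)
    (B : Ω → β) :
    entropy (fun t : J × Ω => w t.1 * p (e t.1, t.2)) (fun t => (t.1, A t.2))
      - entropy (fun t : J × Ω => w t.1 * p (e t.1, t.2)) (fun t => (t.1, B t.2))
      = ∑ j, w j * (entropyPart p A (e j) - entropyPart p B (e j)) := by
  rw [entropy_eq_sum_part, entropy_eq_sum_part, ← Finset.sum_sub_distrib]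
  refine Finset.sum_congr rfl fun j _ => ?_
  rw [entropyPart_rescale, entropyPart_rescale]
  ring

lemma law_comp_equiv {Ω' : Type*} [Fintype Ω'] (σ : Ω' ≃ Ω) (p : Ω → ℝ) (A : Ω → α) :
    law (fun ω => p (σ ω)) (fun ω => A (σ ω)) = law p A := by
  classical
  ext a
  rw [law_eq_sum_ite, law_eq_sum_ite, ← σ.sum_comp]

lemma entropy_comp_equiv {Ω' : Type*} [Fintype Ω'] (σ : Ω' ≃ Ω) (p : Ω → ℝ) (A : Ω → α) :
    entropy (fun ω => p (σ ω)) (fun ω => A (σ ω)) = entropy p A := by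
  rw [entropy, entropy, law_comp_equiv]

end Reduction

section Cardinality

variable {X₁ X₂ S Y Z U : Type*} [Fintype X₁] [Fintype X₂] [Fintype S] [Fintype Y] [Fintype Z]
  [Fintype U]

/-- Moves the auxiliary component to the front. -/
def auxFront : U × X₁ × S × X₂ × Y × Z ≃ X₁ × S × U × X₂ × Y × Z where
  toFun t := (t.2.1, t.2.2.1, t.1, t.2.2.2.1, t.2.2.2.2.1, t.2.2.2.2.2)
  invFun t := (t.2.2.1, t.1, t.2.1, t.2.2.2.1, t.2.2.2.2.1, t.2.2.2.2.2)
  left_inv _ := rfl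
  right_inv _ := rfl

lemma entropy_auxFront {α : Type*} [Fintype α] (p : X₁ × S × U × X₂ × Y × Z → ℝ)
    (A : X₁ × S × U × X₂ × Y × Z → α) :
    entropy p A = entropy (fun t => p (auxFront t)) (fun t => A (auxFront t)) :=
  (entropy_comp_equiv auxFront p A).symm

lemma sum_rest_congr {J : Type*} [Fintype J] {p : X₁ × S × U × X₂ × Y × Z → ℝ}
    {p' : X₁ × S × J × X₂ × Y × Z → ℝ}
    (h : law (fun t => p' (auxFront t)) Prod.snd = law (fun t => p (auxFront t)) Prod.snd)
    (g : X₁ × S × X₂ × Y × Z → ℝ) :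
    ∑ t, p' t * g (t.1, t.2.1, t.2.2.2) = ∑ t, p t * g (t.1, t.2.1, t.2.2.2) := by
  rw [← (auxFront (U := J)).sum_comp, ← (auxFront (U := U)).sum_comp]
  exact (sum_law_mul _ Prod.snd g).symm.trans (h ▸ sum_law_mul _ Prod.snd g)

lemma entropy_rest_congr {J α : Type*} [Fintype J] [Fintype α]
    {p : X₁ × S × U × X₂ × Y × Z → ℝ} {p' : X₁ × S × J × X₂ × Y × Z → ℝ}
    (h : law (fun t => p' (auxFront t)) Prod.snd = law (fun t => p (auxFront t)) Prod.snd)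
    (A : X₁ × S × X₂ × Y × Z → α) :
    entropy p' (fun t => A (t.1, t.2.1, t.2.2.2))
      = entropy p (fun t => A (t.1, t.2.1, t.2.2.2)) := by
  rw [entropy_auxFront p, entropy_auxFront p']
  exact (entropy_law _ Prod.snd A).symm.trans (h ▸ entropy_law _ Prod.snd A)

/-- Support lemma: `|𝒳₁||𝒳₂||𝒮| + 1` values of the auxiliary variable suffice. The joint law of
`(X₁, X₂, S)` and `H(Z | X₁ U S)` are preserved, and `H(U, S, X₁) - H(U, X₁, Y)` does not
decrease. -/
lemma exists_fin_mem_rateRegion (ch : Channel X₁ X₂ S Y Z) {R : ℝ × ℝ}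
    (hR : R ∈ rateRegion ch U) :
    ∃ k : ℕ, k ≤ Fintype.card X₁ * Fintype.card X₂ * Fintype.card S + 1 ∧
      R ∈ rateRegion ch (Fin k) := by
  classical
  obtain ⟨pX₁, h₁, pUX₂, h₂, hRB⟩ := hR
  set p := jointLaw ch pX₁ pUX₂ with hp
  have hpm : p ∈ stdSimplex ℝ _ := jointLaw_mem_stdSimplex ch h₁ h₂
  rw [rateBounds_jointLaw_iff ch hp hpm.1] at hRB
  let P : U × X₁ × S × X₂ × Y × Z → ℝ := fun t => p (auxFront t)
  let q : U → X₁ × X₂ × S → ℝ := fun u x =>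
    pX₁ x.1 * ch.stateLaw x.2.2 * pUX₂ x.1 x.2.2 (u, x.2.1)
  have hq0 : ∀ u x, 0 ≤ q u x := fun u x =>
    mul_nonneg (mul_nonneg (h₁.1 _) (ch.stateLaw_mem.1 _)) ((h₂ _ _).1 _)
  have hPq : ∀ u x₁ s x₂ y z, P (u, x₁, s, x₂, y, z)
      = q u (x₁, x₂, s) * ch.trans x₁ x₂ s (y, z) := fun _ _ _ _ _ _ => rfl
  let d : U → ℝ := fun u => entropyPart P (fun t => (t.2.2.2.2, t.1, t.2.1)) u
    - entropyPart P (fun t => (t.1, t.2.1)) u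
  let a : U → ℝ := fun u => entropyPart P (fun t => (t.2.1, t.1)) u
    - entropyPart P (fun t => (t.1, t.2.2.2.1)) u
  let v : U → (X₁ × X₂ × S → ℝ) × ℝ := fun u => (q u, d u)
  let m : (X₁ × X₂ × S → ℝ) × ℝ →ₗ[ℝ] ℝ :=
    (∑ x, LinearMap.proj x) ∘ₗ LinearMap.fst ℝ (X₁ × X₂ × S → ℝ) ℝ
  have hmv : ∀ u, m (v u) = ∑ x, q u x := fun u => by simp [m, v]
  have hfin : Module.finrank ℝ ((X₁ × X₂ × S → ℝ) × ℝ)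
      = Fintype.card X₁ * Fintype.card X₂ * Fintype.card S + 1 := by
    simp [mul_assoc]
  obtain ⟨t, -, htc, w, hw0, hwv, hwa⟩ := exists_weights_small_support v m a
    (Finset.univ.filter fun u => 0 < m (v u)) (fun u hu => (Finset.mem_filter.1 hu).2)
    (fun _ => 1) (fun _ _ => zero_le_one)
  -- the discarded values of `U` have no mass
  have hnull : ∀ u, ¬ 0 < m (v u) → ∀ x, q u x = 0 := by
    intro u hu x
    rw [hmv] at hu
    exact (Finset.sum_eq_zero_iff_of_nonneg fun x _ => hq0 u x).1
      (le_antisymm (not_lt.1 hu) (Finset.sum_nonneg fun x _ => hq0 u x)) x (Finset.mem_univ x)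
  have hnullP : ∀ u, ¬ 0 < m (v u) → ∀ ω, P (u, ω) = 0 := fun u hu ⟨x₁, s, x₂, y, z⟩ => by
    rw [hPq, hnull u hu, zero_mul]
  have hnulld : ∀ u, ¬ 0 < m (v u) → v u = 0 := fun u hu => by
    simp only [v, d, entropyPart_eq_zero _ (hnullP u hu), sub_zero]
    exact Prod.ext (funext fun x => hnull u hu x) rfl
  have hnulla : ∀ u, ¬ 0 < m (v u) → a u = 0 := fun u hu => by
    simp only [a, entropyPart_eq_zero _ (hnullP u hu), sub_zero]
  simp only [one_smul, one_mul] at hwv hwa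
  rw [Finset.sum_filter_of_ne fun u _ hu => by_contra fun h => hu (hnulld u h)] at hwv
  rw [Finset.sum_filter_of_ne fun u _ hu => by_contra fun h => hu (hnulla u h)] at hwa
  let e : Fin t.card ≃ t := t.equivFin.symm
  let w' : Fin t.card → ℝ := fun j => w (e j)
  have hw' : ∀ j, 0 ≤ w' j := fun j => hw0 _ (e j).2
  have hsum : ∀ f : U → ℝ, ∑ j, w' j * f (e j) = ∑ u ∈ t, w u * f u := fun f => by
    rw [← Finset.sum_coe_sort t, ← e.sum_comp]
  have hwq : ∀ x, ∑ j, w' j * q (e j) x = ∑ u, q u x := fun x => by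
    rw [hsum fun u => q u x]
    have := congrArg (fun y => y.1 x) hwv
    simpa [v, Prod.fst_sum] using this
  have hwd : ∑ j, w' j * d (e j) = ∑ u, d u := by
    rw [hsum]
    have := congrArg (fun y => y.2) hwv
    simpa [v, Prod.snd_sum] using this
  have hwa' : ∑ u, a u ≤ ∑ j, w' j * a (e j) := by rwa [hsum]
  have hqsum : ∀ x₁ s, ∑ x₂, ∑ u, q u (x₁, x₂, s) = pX₁ x₁ * ch.stateLaw s := fun x₁ s => by
    simp only [q, ← Finset.mul_sum]
    rw [← Fintype.sum_prod_type_right (f := pUX₂ x₁ s), (h₂ x₁ s).2, mul_one]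
  have : Nonempty (Fin t.card × X₂) := by
    by_contra hempty
    rw [not_nonempty_iff] at hempty
    have h0 : ∀ x₁ s, pX₁ x₁ * ch.stateLaw s = 0 := fun x₁ s => by
      rw [← hqsum]
      simp_rw [← hwq]
      rw [← Fintype.sum_prod_type_right (f := fun v => w' v.1 * q (e v.1) (x₁, v.2, s))]
      exact Fintype.sum_empty _
    have h1 : ∑ x₁, ∑ s, pX₁ x₁ * ch.stateLaw s = 1 := by
      simp [← Finset.mul_sum, ch.stateLaw_mem.2, h₁.2]
    simp [h0] at h1
  obtain ⟨pUX₂', h₂', hfac⟩ := exists_conditional_law (U := Fin t.card)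
    (r := fun x₁ s => pX₁ x₁ * ch.stateLaw s)
    (fun x₁ s (v : Fin t.card × X₂) => w' v.1 * q (e v.1) (x₁, v.2, s))
    (fun x₁ s v => mul_nonneg (hw' _) (hq0 _ _)) (fun x₁ s => by
      rw [Fintype.sum_prod_type_right, ← hqsum]
      exact Finset.sum_congr rfl fun x₂ _ => hwq (x₁, x₂, s))
  refine ⟨t.card, hfin ▸ htc, pX₁, h₁, pUX₂', h₂', ?_⟩
  set p' := jointLaw ch pX₁ pUX₂' with hp'
  have hpm' : p' ∈ stdSimplex ℝ _ := jointLaw_mem_stdSimplex ch h₁ h₂'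
  have hP' : (fun t => p' (auxFront t)) = fun t => w' t.1 * P (e t.1, t.2) := by
    ext ⟨j, x₁, s, x₂, y, z⟩
    change pX₁ x₁ * ch.stateLaw s * pUX₂' x₁ s (j, x₂) * ch.trans x₁ x₂ s (y, z) = _
    rw [hfac, hPq]; ring
  -- everything that does not involve `U` is unchanged
  have hrest : law (fun t => p' (auxFront t)) Prod.snd = law (fun t => p (auxFront t)) Prod.snd := by
    ext ⟨x₁, s, x₂, y, z⟩
    rw [hP', law_eq_sum_ite, law_eq_sum_ite, Fintype.sum_prod_type, Fintype.sum_prod_type]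
    simp only [Finset.sum_ite_eq', Finset.mem_univ, if_true]
    have := congrArg (fun b => b * ch.trans x₁ x₂ s (y, z)) (hwq (x₁, x₂, s))
    simp only [Finset.sum_mul] at this
    refine Eq.trans (Finset.sum_congr rfl fun j _ => ?_) this
    rw [hPq]; ring
  have hnoise : noise ch p' = noise ch p := congrArg Neg.neg
    (sum_rest_congr hrest fun v => Real.logb 2 (transZ ch v.1 v.2.2.1 v.2.1 v.2.2.2.2))
  have hy : entropy p' (fun t => t.2.2.2.2.1) = entropy p (fun t => t.2.2.2.2.1) :=
    entropy_rest_congr hrest fun v => v.2.2.2.1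
  have hsx : condEntropy p' (fun t => t.2.1) (fun t => t.1)
      = condEntropy p (fun t => t.2.1) (fun t => t.1) :=
    congrArg₂ (· - ·) (entropy_rest_congr hrest fun v => (v.2.1, v.1))
      (entropy_rest_congr hrest fun v => v.1)
  have hzsx : condEntropy p' (fun t => t.2.2.2.2.2) (fun t => (t.2.1, t.1))
      = condEntropy p (fun t => t.2.2.2.2.2) (fun t => (t.2.1, t.1)) :=
    congrArg₂ (· - ·) (entropy_rest_congr hrest fun v => (v.2.2.2.2, v.2.1, v.1))
      (entropy_rest_congr hrest fun v => (v.2.1, v.1))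
  have hzs : condEntropy p' (fun t => t.2.2.2.2.2) (fun t => t.2.1)
      = condEntropy p (fun t => t.2.2.2.2.2) (fun t => t.2.1) :=
    congrArg₂ (· - ·) (entropy_rest_congr hrest fun v => (v.2.2.2.2, v.2.1))
      (entropy_rest_congr hrest fun v => v.2.1)
  have ha : entropy p (fun t => (t.2.2.1, t.2.1, t.1))
      - entropy p (fun t => (t.2.2.1, t.1, t.2.2.2.2.1)) = ∑ u, a u := by
    rw [entropy_auxFront p, entropy_auxFront p, Finset.sum_sub_distrib]
    exact congrArg₂ (· - ·) (entropy_eq_sum_part P fun v => (v.2.1, v.1))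
      (entropy_eq_sum_part P fun v => (v.1, v.2.2.2.1))
  have ha' : entropy p' (fun t => (t.2.2.1, t.2.1, t.1))
      - entropy p' (fun t => (t.2.2.1, t.1, t.2.2.2.2.1)) = ∑ j, w' j * a (e j) := by
    rw [entropy_auxFront p', entropy_auxFront p', hP']
    exact entropy_sub_entropy_rescale P w' (fun j => e j) (fun v => (v.2.1, v.1))
      (fun v => (v.1, v.2.2.2.1))
  have hd : condEntropy p (fun t => t.2.2.2.2.2) (fun t => (t.1, t.2.2.1, t.2.1)) = ∑ u, d u := by
    rw [condEntropy, entropy_congr hpm.1 (B := fun t => (t.2.2.1, t.2.2.2.2.2, t.1, t.2.1))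
      (fun _ _ => by simp; tauto), entropy_congr hpm.1 (A := fun t => (t.1, t.2.2.1, t.2.1))
      (B := fun t => (t.2.2.1, t.1, t.2.1)) (fun _ _ => by simp; tauto),
      entropy_auxFront p, entropy_auxFront p, Finset.sum_sub_distrib]
    exact congrArg₂ (· - ·) (entropy_eq_sum_part P fun v => (v.2.2.2.2, v.1, v.2.1))
      (entropy_eq_sum_part P fun v => (v.1, v.2.1))
  have hd' : condEntropy p' (fun t => t.2.2.2.2.2) (fun t => (t.1, t.2.2.1, t.2.1))
      = ∑ j, w' j * d (e j) := by
    rw [condEntropy, entropy_congr hpm'.1 (B := fun t => (t.2.2.1, t.2.2.2.2.2, t.1, t.2.1))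
      (fun _ _ => by simp; tauto), entropy_congr hpm'.1 (A := fun t => (t.1, t.2.2.1, t.2.1))
      (B := fun t => (t.2.2.1, t.1, t.2.1)) (fun _ _ => by simp; tauto),
      entropy_auxFront p', entropy_auxFront p', hP']
    exact entropy_sub_entropy_rescale P w' (fun j => e j) (fun v => (v.2.2.2.2, v.1, v.2.1))
      (fun v => (v.1, v.2.1))
  rw [rateBounds_jointLaw_iff ch hp' hpm'.1, hnoise, hy, hsx, hzsx, hzs, ha', hd', hwd]
  rw [ha, hd] at hRB
  obtain ⟨hA, hB, hC, hD⟩ := hRB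
  exact ⟨by linarith, hB, hC, by linarith⟩

end Cardinality

/-! ### Time sharing and telescoping sums of entropies -/

section TimeSharing

variable {Ω α β : Type*} [Fintype Ω] [Fintype α] [Fintype β] {n : ℕ}

/-- `p` together with an independent uniform time index. -/
def timeShared (p : Ω → ℝ) (n : ℕ) (t : Ω × Fin n) : ℝ := p t.1 / n

lemma timeShared_mem_stdSimplex {p : Ω → ℝ} (hp : p ∈ stdSimplex ℝ Ω) (hn : n ≠ 0) :
    timeShared p n ∈ stdSimplex ℝ (Ω × Fin n) := by
  refine ⟨fun t => div_nonneg (hp.1 _) (Nat.cast_nonneg _), ?_⟩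
  have : (n : ℝ) ≠ 0 := Nat.cast_ne_zero.2 hn
  rw [Fintype.sum_prod_type_right]
  simp only [timeShared, ← Finset.sum_div, hp.2]
  simp [this]

lemma sum_timeShared_mul (p : Ω → ℝ) (f : Ω → Fin n → ℝ) :
    ∑ t, timeShared p n t * f t.1 t.2 = (∑ i, ∑ ω, p ω * f ω i) / n := by
  rw [Fintype.sum_prod_type_right, Finset.sum_div]
  refine Finset.sum_congr rfl fun i _ => ?_
  rw [Finset.sum_div]
  exact Finset.sum_congr rfl fun ω _ => by rw [timeShared]; ring

lemma law_timeShared (p : Ω → ℝ) (A : Ω → Fin n → α) (i : Fin n) (a : α) :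
    law (timeShared p n) (fun t => (t.2, A t.1 t.2)) (i, a) = law p (fun ω => A ω i) a / n := by
  classical
  rw [law_eq_sum_ite, law_eq_sum_ite, Fintype.sum_prod_type_right, Finset.sum_eq_single i]
  · rw [Finset.sum_div]
    exact Finset.sum_congr rfl fun ω _ => by simp [timeShared, ite_div]
  · intro j _ hj; simp [hj]
  · simp

lemma entropy_timeShared {p : Ω → ℝ} (hp : p ∈ stdSimplex ℝ Ω) (hn : n ≠ 0)
    (A : Ω → Fin n → α) :
    entropy (timeShared p n) (fun t => (t.2, A t.1 t.2))
      = Real.logb 2 n + (∑ i, entropy p (fun ω => A ω i)) / n := by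
  have hn' : (n : ℝ) ≠ 0 := Nat.cast_ne_zero.2 hn
  rw [entropy_eq]
  simp only [law_timeShared p A]
  rw [sum_timeShared_mul p fun ω i => Real.logb 2 (law p (fun ω => A ω i) (A ω i) / n)]
  have : ∀ i, ∑ ω, p ω * Real.logb 2 (law p (fun ω => A ω i) (A ω i) / n)
      = -entropy p (fun ω => A ω i) - Real.logb 2 n := by
    intro i
    rw [entropy_eq, neg_neg, ← one_mul (Real.logb 2 n), ← hp.2, Finset.sum_mul,
      ← Finset.sum_sub_distrib]
    refine Finset.sum_congr rfl fun ω _ => ?_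
    rcases (hp.1 ω).eq_or_lt with h0 | h0
    · simp [← h0]
    · rw [Real.logb_div (law_pos hp.1 (fun ω => A ω i) h0).ne' hn', mul_sub]
  simp only [this, Finset.sum_sub_distrib, Finset.sum_neg_distrib, Finset.sum_const,
    Finset.card_univ, Fintype.card_fin, nsmul_eq_mul]
  field_simp
  ring

/-- Conditional entropy is concave: sharing time does not decrease it. -/
lemma le_condEntropy_timeShared {p : Ω → ℝ} (hp : p ∈ stdSimplex ℝ Ω) (hn : n ≠ 0)
    (A : Ω → Fin n → α) (B : Ω → Fin n → β) :
    (∑ i, condEntropy p (fun ω => A ω i) (fun ω => B ω i)) / n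
      ≤ condEntropy (timeShared p n) (fun t => A t.1 t.2) (fun t => B t.1 t.2) := by
  have hq := timeShared_mem_stdSimplex hp hn
  refine le_trans (le_of_eq ?_) (condEntropy_comp_le hq (fun t => A t.1 t.2)
    (fun t => (t.2, B t.1 t.2)) Prod.snd)
  rw [condEntropy, entropy_congr hq.1 (B := fun t => (t.2, A t.1 t.2, B t.1 t.2))
    (fun _ _ => by simp; tauto), entropy_timeShared hp hn B,
    entropy_timeShared hp hn fun ω i => (A ω i, B ω i)]
  simp only [condEntropy, Finset.sum_sub_distrib, sub_div]
  ring

lemma le_entropy_timeShared {p : Ω → ℝ} (hp : p ∈ stdSimplex ℝ Ω) (hn : n ≠ 0)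
    (A : Ω → Fin n → α) :
    (∑ i, entropy p (fun ω => A ω i)) / n ≤ entropy (timeShared p n) (fun t => A t.1 t.2) := by
  have h := le_condEntropy_timeShared hp hn A (fun _ _ => ())
  simp only [condEntropy, entropy_of_subsingleton hp,
    entropy_of_subsingleton (timeShared_mem_stdSimplex hp hn), sub_zero] at h
  rw [entropy_congr (timeShared_mem_stdSimplex hp hn).1 (B := fun t => A t.1 t.2)
    (fun _ _ => by simp)] at h
  refine le_trans (le_of_eq ?_) h
  congr 1
  exact Finset.sum_congr rfl fun i _ => entropy_congr hp.1 fun _ _ => by simp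

open Classical in
/-- The components `a i` with `P i`; the other ones are hidden. -/
def mask (P : Fin n → Prop) (a : Fin n → α) (i : Fin n) : Option α :=
  if P i then some (a i) else none

lemma mask_eq_mask_iff (P : Fin n → Prop) (a b : Fin n → α) :
    mask P a = mask P b ↔ ∀ i, P i → a i = b i := by
  simp only [funext_iff, mask]
  refine forall_congr' fun i => ?_
  by_cases h : P i <;> simp [h]

variable {𝒲 τ : Type*} [Fintype 𝒲] [Fintype τ]

/-- The auxiliary variable `U_i`: the first message, the past of `y` and the future of `t`. -/
def auxVar (w : Ω → 𝒲) (y : Ω → Fin n → α) (t : Ω → Fin n → τ) (ω : Ω) (i : Fin n) :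
    𝒲 × (Fin n → Option α) × (Fin n → Option τ) :=
  (w ω, mask (fun j => j < i) (y ω), mask (fun j => i < j) (t ω))

/-- The Csiszár sum identity in the form of a telescoping sum. -/
lemma sum_entropy_auxVar {p : Ω → ℝ} (hp : ∀ ω, 0 ≤ p ω) (w : Ω → 𝒲) (y : Ω → Fin n → α)
    (t : Ω → Fin n → τ) (x : 𝒲 → Fin n → β) :
    ∑ i, entropy p (fun ω => (auxVar w y t ω i, t ω i, x (w ω) i))
      - ∑ i, entropy p (fun ω => (auxVar w y t ω i, x (w ω) i, y ω i))
      = entropy p (fun ω => (w ω, t ω)) - entropy p (fun ω => (w ω, y ω)) := by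
  let G : ℕ → ℝ := fun k => entropy p fun ω =>
    (w ω, mask (fun j => (j : ℕ) < k) (y ω), mask (fun j => k ≤ (j : ℕ)) (t ω))
  have h1 : ∀ i : Fin n, entropy p (fun ω => (auxVar w y t ω i, t ω i, x (w ω) i)) = G i := by
    intro i
    refine entropy_congr hp fun ω ω' => ?_
    simp only [auxVar, Prod.mk.injEq, mask_eq_mask_iff]
    constructor
    · rintro ⟨⟨hw, hy, ht⟩, hti, -⟩
      refine ⟨hw, hy, fun j hj => ?_⟩
      rcases (show i ≤ j from hj).eq_or_lt with rfl | h
      exacts [hti, ht j h]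
    · rintro ⟨hw, hy, ht⟩
      exact ⟨⟨hw, hy, fun j hj => ht j hj.le⟩, ht i le_rfl, by rw [hw]⟩
  have h2 : ∀ i : Fin n,
      entropy p (fun ω => (auxVar w y t ω i, x (w ω) i, y ω i)) = G (i + 1) := by
    intro i
    refine entropy_congr hp fun ω ω' => ?_
    simp only [auxVar, Prod.mk.injEq, mask_eq_mask_iff]
    constructor
    · rintro ⟨⟨hw, hy, ht⟩, -, hyi⟩
      refine ⟨hw, fun j hj => ?_, fun j hj => ht j hj⟩
      rcases (show j ≤ i from Nat.lt_succ_iff.1 hj).eq_or_lt with rfl | h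
      exacts [hyi, hy j h]
    · rintro ⟨hw, hy, ht⟩
      exact ⟨⟨hw, fun j hj => hy j (Nat.lt_succ_of_lt hj), fun j hj => ht j hj⟩, by rw [hw],
        hy i (Nat.lt_succ_self _)⟩
  have h3 : G 0 = entropy p (fun ω => (w ω, t ω)) := by
    refine entropy_congr hp fun ω ω' => ?_
    simp only [Prod.mk.injEq, mask_eq_mask_iff]
    exact ⟨fun h => ⟨h.1, funext fun i => h.2.2 i (Nat.zero_le _)⟩,
      fun h => ⟨h.1, fun i hi => absurd hi (Nat.not_lt_zero _), fun i _ => congrFun h.2 i⟩⟩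
  have h4 : G n = entropy p (fun ω => (w ω, y ω)) := by
    refine entropy_congr hp fun ω ω' => ?_
    simp only [Prod.mk.injEq, mask_eq_mask_iff]
    exact ⟨fun h => ⟨h.1, funext fun i => h.2.1 i i.2⟩,
      fun h => ⟨h.1, fun i _ => congrFun h.2 i, fun i hi => absurd i.2 (not_lt.2 hi)⟩⟩
  simp only [h1, h2]
  rw [Fin.sum_univ_eq_sum_range, Fin.sum_univ_eq_sum_range (fun i => G (i + 1)),
    ← Finset.sum_sub_distrib, Finset.sum_range_sub', h3, h4]

end TimeSharing

/-! ### The probability space of a code -/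

section CodeSpace

variable {X₁ X₂ S Y Z : Type*} [Fintype X₁] [Fintype X₂] [Fintype S] [Fintype Y] [Fintype Z]
  {n M₁ M₂ : ℕ}

/-- The joint law of the messages, the state sequence and the outputs when the code `c` is used. -/
def codeLaw (ch : Channel X₁ X₂ S Y Z) (c : Code X₁ X₂ S Y Z n M₁ M₂) :
    Fin M₁ × Fin M₂ × (Fin n → S) × (Fin n → Y × Z) → ℝ :=
  fun (w₁, w₂, s, v) => 1 / ((M₁ : ℝ) * (M₂ : ℝ)) * ((∏ i, ch.stateLaw (s i)) *
    ∏ i, ch.trans (c.enc₁ w₁ i) (c.enc₂ w₁ w₂ s i) (s i) (v i))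

lemma sum_codeLaw_mul (ch : Channel X₁ X₂ S Y Z) (c : Code X₁ X₂ S Y Z n M₁ M₂)
    (f : Fin M₁ × Fin M₂ × (Fin n → S) × (Fin n → Y × Z) → ℝ) :
    ∑ ω, codeLaw ch c ω * f ω = 1 / ((M₁ : ℝ) * (M₂ : ℝ)) * ∑ w₁, ∑ w₂,
      expect (fun _ => ch.stateLaw) fun s =>
        expect (fun i => ch.trans (c.enc₁ w₁ i) (c.enc₂ w₁ w₂ s i) (s i)) fun v =>
          f (w₁, w₂, s, v) := by
  simp only [Fintype.sum_prod_type (α₁ := Fin M₁), Fintype.sum_prod_type (α₁ := Fin M₂),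
    Fintype.sum_prod_type (α₁ := Fin n → S), expect, Finset.mul_sum, codeLaw]
  refine Finset.sum_congr rfl fun _ _ => Finset.sum_congr rfl fun _ _ =>
    Finset.sum_congr rfl fun _ _ => Finset.sum_congr rfl fun _ _ => by ring

lemma codeLaw_mem_stdSimplex (ch : Channel X₁ X₂ S Y Z) (c : Code X₁ X₂ S Y Z n M₁ M₂)
    (h₁ : M₁ ≠ 0) (h₂ : M₂ ≠ 0) : codeLaw ch c ∈ stdSimplex ℝ _ := by
  refine ⟨fun ω => mul_nonneg (by positivity) (mul_nonneg
    (Finset.prod_nonneg fun i _ => ch.stateLaw_mem.1 _)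
    (Finset.prod_nonneg fun i _ => (ch.trans_mem _ _ _).1 _)), ?_⟩
  have := sum_codeLaw_mul ch c fun _ => 1
  simp only [mul_one] at this
  rw [this]
  have h : ∀ w₁ w₂ s, expect (fun i => ch.trans (c.enc₁ w₁ i) (c.enc₂ w₁ w₂ s i) (s i))
      (fun _ => (1 : ℝ)) = 1 := fun w₁ w₂ s => expect_const _ (fun i => (ch.trans_mem _ _ _).2) _
  simp only [h, expect_const _ fun _ => ch.stateLaw_mem.2]
  simp
  field_simp

/-- The error probability is the probability of the error event. -/
lemma errorProb_eq_sum_codeLaw (ch : Channel X₁ X₂ S Y Z) (c : Code X₁ X₂ S Y Z n M₁ M₂) :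
    errorProb ch c = ∑ ω, codeLaw ch c ω *
      if c.dec₁ (fun i => (ω.2.2.2 i).1) = ω.1 ∧
        c.dec₂ (fun i => (ω.2.2.2 i).2) ω.2.2.1 = (ω.1, ω.2.1) then 0 else 1 := by
  rw [sum_codeLaw_mul, errorProb]
  congr 1
  refine Finset.sum_congr rfl fun w₁ _ => Finset.sum_congr rfl fun w₂ _ => ?_
  rw [expect]
  refine Finset.sum_congr rfl fun s _ => ?_
  rw [expect, Finset.mul_sum, ← (Equiv.arrowProdEquivProdArrow (Fin n) (fun _ => Y)
    (fun _ => Z)).symm.sum_comp, Fintype.sum_prod_type]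
  refine Finset.sum_congr rfl fun y _ => Finset.sum_congr rfl fun z _ => ?_
  by_cases h : c.dec₁ y = w₁ ∧ c.dec₂ z s = (w₁, w₂) <;>
    simp [Equiv.arrowProdEquivProdArrow, h]

lemma law_messages_state (ch : Channel X₁ X₂ S Y Z) (c : Code X₁ X₂ S Y Z n M₁ M₂)
    (w₁ : Fin M₁) (w₂ : Fin M₂) (s : Fin n → S) :
    law (codeLaw ch c) (fun ω => (ω.1, ω.2.1, ω.2.2.1)) (w₁, w₂, s)
      = 1 / ((M₁ : ℝ) * (M₂ : ℝ)) * ∏ i, ch.stateLaw (s i) := by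
  classical
  rw [law_eq_sum_ite]
  simp only [Fintype.sum_prod_type (α₁ := Fin M₁), Fintype.sum_prod_type (α₁ := Fin M₂),
    Fintype.sum_prod_type (α₁ := Fin n → S), Prod.mk.injEq]
  rw [Finset.sum_eq_single w₁ (by intro b _ hb; simp [hb]) (by simp),
    Finset.sum_eq_single w₂ (by intro b _ hb; simp [hb]) (by simp),
    Finset.sum_eq_single s (by intro b _ hb; simp [hb]) (by simp)]
  simp only [and_self, if_true, codeLaw, ← Finset.mul_sum]
  have := expect_const (fun i => ch.trans (c.enc₁ w₁ i) (c.enc₂ w₁ w₂ s i) (s i))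
    (fun i => (ch.trans_mem _ _ _).2) 1
  simp only [expect, mul_one] at this
  rw [this, mul_one]

/-- Given the messages and the state, the letters of the second output are independent and each
has the law `transZ`. -/
lemma law_output_messages_state (ch : Channel X₁ X₂ S Y Z) (c : Code X₁ X₂ S Y Z n M₁ M₂)
    (z : Fin n → Z) (b : Fin M₁ × Fin M₂ × (Fin n → S)) :
    law (codeLaw ch c) (fun ω => ((fun i => (ω.2.2.2 i).2), (ω.1, ω.2.1, ω.2.2.1))) (z, b)
      = law (codeLaw ch c) (fun ω => (ω.1, ω.2.1, ω.2.2.1)) b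
        * ∏ i, transZ ch (c.enc₁ b.1 i) (c.enc₂ b.1 b.2.1 b.2.2 i) (b.2.2 i) (z i) := by
  classical
  obtain ⟨w₁, w₂, s⟩ := b
  rw [law_messages_state, law_eq_sum_ite]
  simp only [Fintype.sum_prod_type (α₁ := Fin M₁), Fintype.sum_prod_type (α₁ := Fin M₂),
    Fintype.sum_prod_type (α₁ := Fin n → S), Prod.mk.injEq]
  rw [Finset.sum_eq_single w₁ (by intro b _ hb; simp [hb]) (by simp),
    Finset.sum_eq_single w₂ (by intro b _ hb; simp [hb]) (by simp),
    Finset.sum_eq_single s (by intro b _ hb; simp [hb]) (by simp)]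
  simp only [and_true, codeLaw]
  rw [← (Equiv.arrowProdEquivProdArrow (Fin n) (fun _ => Y) (fun _ => Z)).symm.sum_comp,
    Fintype.sum_prod_type_right, Finset.sum_eq_single z]
  · simp only [Equiv.arrowProdEquivProdArrow, Equiv.coe_fn_symm_mk, if_true, transZ]
    rw [← Finset.mul_sum, ← Finset.mul_sum, mul_assoc,
      sum_pi_prod fun i y => ch.trans (c.enc₁ w₁ i) (c.enc₂ w₁ w₂ s i) (s i) (y, z i)]
  · intro b _ hb
    simp [Equiv.arrowProdEquivProdArrow, hb]
  · simp

end CodeSpace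

section SingleLetter

variable {X₁ X₂ S Y Z τ : Type*} [Fintype X₁] [Fintype X₂] [Fintype S] [Fintype Y] [Fintype Z]
  [Fintype τ] {n M₁ M₂ : ℕ}

/-- The single-letter random variables `(X₁, S, U, X₂, Y, Z)` at a time index, where `U` consists of
the time index, the first message, the past of the first output and the future of `g (S, Z)`. -/
def singleLetter (c : Code X₁ X₂ S Y Z n M₁ M₂) (g : S → Z → τ)
    (t : (Fin M₁ × Fin M₂ × (Fin n → S) × (Fin n → Y × Z)) × Fin n) :
    X₁ × S × (Fin n × Fin M₁ × (Fin n → Option Y) × (Fin n → Option τ)) × X₂ × Y × Z :=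
  (c.enc₁ t.1.1 t.2, t.1.2.2.1 t.2,
    (t.2, auxVar (fun ω : Fin M₁ × Fin M₂ × (Fin n → S) × (Fin n → Y × Z) => ω.1)
      (fun ω i => (ω.2.2.2 i).1) (fun ω i => g (ω.2.2.1 i) (ω.2.2.2 i).2) t.1 t.2),
    c.enc₂ t.1.1 t.1.2.1 t.1.2.2.1 t.2, t.1.2.2.2 t.2)

lemma law_eq_sum_mul_ite {Ω α : Type*} [Fintype Ω] [Fintype α] [DecidableEq α] (p : Ω → ℝ)
    (A : Ω → α) (a : α) : law p A a = ∑ ω, p ω * if A ω = a then 1 else 0 := by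
  rw [law_eq_sum_ite]; simp

lemma law_singleLetter_input (ch : Channel X₁ X₂ S Y Z) (c : Code X₁ X₂ S Y Z n M₁ M₂)
    (x₁ : X₁) (s : S) :
    law (timeShared (codeLaw ch c) n) (fun t => (c.enc₁ t.1.1 t.2, t.1.2.2.1 t.2)) (x₁, s)
      = law (timeShared (codeLaw ch c) n) (fun t => c.enc₁ t.1.1 t.2) x₁ * ch.stateLaw s := by
  classical
  rw [law_eq_sum_mul_ite, law_eq_sum_mul_ite, sum_timeShared_mul (codeLaw ch c) fun ω i =>
    if (c.enc₁ ω.1 i, ω.2.2.1 i) = (x₁, s) then 1 else 0,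
    sum_timeShared_mul (codeLaw ch c) fun ω i =>
    if c.enc₁ ω.1 i = x₁ then 1 else 0, div_mul_eq_mul_div, Finset.sum_mul]
  congr 1
  refine Finset.sum_congr rfl fun i _ => ?_
  rw [sum_codeLaw_mul, sum_codeLaw_mul, mul_assoc, Finset.sum_mul]
  congr 1
  refine Finset.sum_congr rfl fun w₁ _ => ?_
  rw [Finset.sum_mul]
  refine Finset.sum_congr rfl fun w₂ _ => ?_
  have h : ∀ (s : Fin n → S) (r : ℝ),
      expect (fun i => ch.trans (c.enc₁ w₁ i) (c.enc₂ w₁ w₂ s i) (s i))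
      (fun _ => r) = r := fun s r => expect_const _ (fun i => (ch.trans_mem _ _ _).2) _
  calc _ = expect (fun _ => ch.stateLaw) (fun s' : Fin n → S =>
          if (c.enc₁ w₁ i, s' i) = (x₁, s) then (1 : ℝ) else 0) :=
        congrArg _ (funext fun s' => h s' _)
    _ = ∑ b, ch.stateLaw b * if (c.enc₁ w₁ i, b) = (x₁, s) then (1 : ℝ) else 0 :=
        expect_apply _ (fun _ => ch.stateLaw_mem.2) i
          fun b => if (c.enc₁ w₁ i, b) = (x₁, s) then (1 : ℝ) else 0
    _ = (if c.enc₁ w₁ i = x₁ then (1 : ℝ) else 0) * ch.stateLaw s := by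
        by_cases hx : c.enc₁ w₁ i = x₁ <;> simp [hx]
    _ = _ := congrArg (· * ch.stateLaw s) ((congrArg _ (funext fun s' => h s' _)).trans
        (expect_const _ (fun _ => ch.stateLaw_mem.2) _)).symm

lemma law_singleLetter (ch : Channel X₁ X₂ S Y Z) (c : Code X₁ X₂ S Y Z n M₁ M₂) (g : S → Z → τ)
    (x₁ : X₁) (s : S) (u : Fin n × Fin M₁ × (Fin n → Option Y) × (Fin n → Option τ)) (x₂ : X₂)
    (v : Y × Z) :
    law (timeShared (codeLaw ch c) n) (singleLetter c g) (x₁, s, u, x₂, v)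
      = law (timeShared (codeLaw ch c) n) (fun t => ((singleLetter c g t).1,
          (singleLetter c g t).2.1, (singleLetter c g t).2.2.1, (singleLetter c g t).2.2.2.1))
          (x₁, s, u, x₂) * ch.trans x₁ x₂ s v := by
  classical
  rw [law_eq_sum_mul_ite, law_eq_sum_mul_ite, sum_timeShared_mul (codeLaw ch c) fun ω i =>
    if singleLetter c g (ω, i) = (x₁, s, u, x₂, v) then 1 else 0,
    sum_timeShared_mul (codeLaw ch c) fun ω i =>
    if ((singleLetter c g (ω, i)).1, (singleLetter c g (ω, i)).2.1,
      (singleLetter c g (ω, i)).2.2.1, (singleLetter c g (ω, i)).2.2.2.1) = (x₁, s, u, x₂)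
      then 1 else 0, div_mul_eq_mul_div, Finset.sum_mul]
  congr 1
  refine Finset.sum_congr rfl fun i _ => ?_
  rw [sum_codeLaw_mul, sum_codeLaw_mul, mul_assoc, Finset.sum_mul]
  congr 1
  refine Finset.sum_congr rfl fun w₁ _ => ?_
  rw [Finset.sum_mul]
  refine Finset.sum_congr rfl fun w₂ _ => ?_
  rw [expect, expect, Finset.sum_mul]
  refine Finset.sum_congr rfl fun s' _ => ?_
  rw [mul_assoc]
  congr 1
  -- given everything else, the output at time `i` is independent of the other outputs
  let K : (Fin n → Y × Z) → ℝ := fun v' =>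
    if ((singleLetter c g ((w₁, w₂, s', v'), i)).1, (singleLetter c g ((w₁, w₂, s', v'), i)).2.1,
      (singleLetter c g ((w₁, w₂, s', v'), i)).2.2.1,
      (singleLetter c g ((w₁, w₂, s', v'), i)).2.2.2.1) = (x₁, s, u, x₂) then 1 else 0
  have hK : ∀ v' b, K (Function.update v' i b) = K v' := by
    intro v' b
    have hy : ∀ (P : Fin n → Prop), ¬ P i → mask P (fun j => (Function.update v' i b j).1)
        = mask P fun j => (v' j).1 := fun P hP => by
      rw [mask_eq_mask_iff]; intro j hj
      rw [Function.update_of_ne]; rintro rfl; exact hP hj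
    have hz : ∀ (P : Fin n → Prop), ¬ P i →
        mask P (fun j => g (s' j) (Function.update v' i b j).2)
        = mask P fun j => g (s' j) (v' j).2 := fun P hP => by
      rw [mask_eq_mask_iff]; intro j hj
      rw [Function.update_of_ne]; rintro rfl; exact hP hj
    have hu : (singleLetter c g ((w₁, w₂, s', Function.update v' i b), i)).2.2.1
        = (singleLetter c g ((w₁, w₂, s', v'), i)).2.2.1 := by
      simp only [singleLetter, auxVar]
      rw [hy (fun j => j < i) (lt_irrefl i), hz (fun j => i < j) (lt_irrefl i)]
    simp only [K]
    rw [hu]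
    rfl
  have h1 : (fun v' => if singleLetter c g ((w₁, w₂, s', v'), i) = (x₁, s, u, x₂, v)
      then (1 : ℝ) else 0) = fun v' => K v' * if v' i = v then 1 else 0 := by
    ext v'
    simp only [K, singleLetter, Prod.mk.injEq, ← ite_and, mul_ite, mul_one, mul_zero]
    congr 1
    simp only [eq_iff_iff]
    tauto
  have h2 := expect_coord (fun i => ch.trans (c.enc₁ w₁ i) (c.enc₂ w₁ w₂ s' i) (s' i)) i
    (ch.trans_mem _ _ _).2 (fun a v' => K v' * if a = v then 1 else 0)
    (fun a b v' => by rw [hK])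
  rw [h1, h2]
  have h3 : ∀ a, expect (fun i => ch.trans (c.enc₁ w₁ i) (c.enc₂ w₁ w₂ s' i) (s' i))
      (fun v' => K v' * if a = v then 1 else 0)
      = (if a = v then 1 else 0) * expect (fun i =>
        ch.trans (c.enc₁ w₁ i) (c.enc₂ w₁ w₂ s' i) (s' i)) K := fun a => by
    rw [← expect_const_mul]; congr 1; ext; ring
  simp only [h3]
  simp only [ite_mul, one_mul, zero_mul, mul_ite, mul_zero, Finset.sum_ite_eq',
    Finset.mem_univ, if_true]
  rw [mul_comm, expect, Finset.sum_mul, Finset.sum_mul]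
  refine Finset.sum_congr rfl fun v' _ => ?_
  by_cases hv : ((singleLetter c g ((w₁, w₂, s', v'), i)).1,
      (singleLetter c g ((w₁, w₂, s', v'), i)).2.1,
      (singleLetter c g ((w₁, w₂, s', v'), i)).2.2.1,
      (singleLetter c g ((w₁, w₂, s', v'), i)).2.2.2.1) = (x₁, s, u, x₂)
  · obtain ⟨rfl, rfl, -, rfl⟩ : c.enc₁ w₁ i = x₁ ∧ s' i = s ∧ _ ∧ c.enc₂ w₁ w₂ s' i = x₂ := by
      simpa only [singleLetter, Prod.mk.injEq] using hv
    rfl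
  · simp only [K, if_neg hv]; simp

lemma exists_jointLaw_eq_law_singleLetter (ch : Channel X₁ X₂ S Y Z)
    (c : Code X₁ X₂ S Y Z n M₁ M₂) (g : S → Z → τ) (hn : n ≠ 0) (h₁ : M₁ ≠ 0) (h₂ : M₂ ≠ 0) :
    ∃ pX₁ ∈ stdSimplex ℝ X₁,
      ∃ pUX₂ : X₁ → S → (Fin n × Fin M₁ × (Fin n → Option Y) × (Fin n → Option τ)) × X₂ → ℝ,
      (∀ x₁ s, pUX₂ x₁ s ∈ stdSimplex ℝ _) ∧
      law (timeShared (codeLaw ch c) n) (singleLetter c g) = jointLaw ch pX₁ pUX₂ := by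
  classical
  have hp := timeShared_mem_stdSimplex (codeLaw_mem_stdSimplex ch c h₁ h₂) hn
  set p := timeShared (codeLaw ch c) n
  have hne : Nonempty ((Fin n × Fin M₁ × (Fin n → Option Y) × (Fin n → Option τ)) × X₂) := by
    by_contra hempty
    rw [not_nonempty_iff] at hempty
    have : IsEmpty ((Fin M₁ × Fin M₂ × (Fin n → S) × (Fin n → Y × Z)) × Fin n) :=
      ⟨fun t => hempty.false ((singleLetter c g t).2.2.1, (singleLetter c g t).2.2.2.1)⟩
    simpa using hp.2
  obtain ⟨pUX₂, hUX₂, hfac⟩ := exists_conditional_law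
    (r := fun x₁ s => law p (fun t => c.enc₁ t.1.1 t.2) x₁ * ch.stateLaw s)
    (fun x₁ s v => law p (fun t => ((singleLetter c g t).1,
          (singleLetter c g t).2.1, (singleLetter c g t).2.2.1, (singleLetter c g t).2.2.2.1))
          (x₁, s, v.1, v.2)) (fun x₁ s v => law_nonneg hp.1 _ _) (fun x₁ s => by
      have h := congrFun (law_law p (fun t => ((singleLetter c g t).1,
          (singleLetter c g t).2.1, (singleLetter c g t).2.2.1, (singleLetter c g t).2.2.2.1))
          (fun v => (v.1, v.2.1))) (x₁, s)
      rw [← law_singleLetter_input]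
      refine Eq.trans ?_ h
      rw [law_eq_sum_ite _ _ (x₁, s)]
      simp only [Fintype.sum_prod_type (α₁ := X₁), Fintype.sum_prod_type (α₁ := S), Prod.mk.injEq]
      rw [Finset.sum_eq_single x₁ (by intro b _ hb; simp [hb]) (by simp),
        Finset.sum_eq_single s (by intro b _ hb; simp [hb]) (by simp)]
      simp)
  refine ⟨law p (fun t => c.enc₁ t.1.1 t.2), law_mem_stdSimplex hp _, pUX₂, hUX₂, ?_⟩
  ext ⟨x₁, s, u, x₂, y, z⟩
  rw [law_singleLetter]
  exact congrArg (· * ch.trans x₁ x₂ s (y, z)) (hfac x₁ s (u, x₂)).symm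

end SingleLetter

/-! ### The converse -/

section Converse

variable {X₁ X₂ S Y Z τ : Type*} [Fintype X₁] [Fintype X₂] [Fintype S] [Fintype Y] [Fintype Z]
  [Fintype τ] {n M₁ M₂ : ℕ}

/-- `n` times the noise entropy `H(Z | X₁ X₂ S)` of a code. -/
def codeNoise (ch : Channel X₁ X₂ S Y Z) (c : Code X₁ X₂ S Y Z n M₁ M₂) : ℝ :=
  -∑ i, ∑ ω, codeLaw ch c ω * Real.logb 2
    (transZ ch (c.enc₁ ω.1 i) (c.enc₂ ω.1 ω.2.1 ω.2.2.1 i) (ω.2.2.1 i) (ω.2.2.2 i).2)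

/-- `n` times the entropy of a state symbol. -/
def codeStateEntropy (ch : Channel X₁ X₂ S Y Z) (c : Code X₁ X₂ S Y Z n M₁ M₂) : ℝ :=
  -∑ i, ∑ ω, codeLaw ch c ω * Real.logb 2 (ch.stateLaw (ω.2.2.1 i))

lemma stateLaw_pos_of_codeLaw_pos {ch : Channel X₁ X₂ S Y Z} {c : Code X₁ X₂ S Y Z n M₁ M₂}
    {ω : Fin M₁ × Fin M₂ × (Fin n → S) × (Fin n → Y × Z)} (h : 0 < codeLaw ch c ω) (i : Fin n) :
    0 < ch.stateLaw (ω.2.2.1 i) := by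
  refine lt_of_le_of_ne (ch.stateLaw_mem.1 _) fun h0 => h.ne' ?_
  have : ∏ i, ch.stateLaw (ω.2.2.1 i) = 0 := Finset.prod_eq_zero (Finset.mem_univ i) h0.symm
  change 1 / ((M₁ : ℝ) * (M₂ : ℝ)) * ((∏ i, ch.stateLaw (ω.2.2.1 i)) * _) = 0
  rw [this]; ring

lemma transZ_pos_of_codeLaw_pos {ch : Channel X₁ X₂ S Y Z} {c : Code X₁ X₂ S Y Z n M₁ M₂}
    {ω : Fin M₁ × Fin M₂ × (Fin n → S) × (Fin n → Y × Z)} (h : 0 < codeLaw ch c ω) (i : Fin n) :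
    0 < transZ ch (c.enc₁ ω.1 i) (c.enc₂ ω.1 ω.2.1 ω.2.2.1 i) (ω.2.2.1 i) (ω.2.2.2 i).2 := by
  refine lt_of_lt_of_le (lt_of_le_of_ne ((ch.trans_mem _ _ _).1 (ω.2.2.2 i)) fun h0 => h.ne' ?_)
    (Finset.single_le_sum (f := fun y => ch.trans (c.enc₁ ω.1 i) (c.enc₂ ω.1 ω.2.1 ω.2.2.1 i)
      (ω.2.2.1 i) (y, (ω.2.2.2 i).2)) (fun y _ => (ch.trans_mem _ _ _).1 _)
      (Finset.mem_univ (ω.2.2.2 i).1))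
  have : ∏ i, ch.trans (c.enc₁ ω.1 i) (c.enc₂ ω.1 ω.2.1 ω.2.2.1 i) (ω.2.2.1 i) (ω.2.2.2 i) = 0 :=
    Finset.prod_eq_zero (Finset.mem_univ i) h0.symm
  change 1 / ((M₁ : ℝ) * (M₂ : ℝ)) * (_ * ∏ i, ch.trans (c.enc₁ ω.1 i)
    (c.enc₂ ω.1 ω.2.1 ω.2.2.1 i) (ω.2.2.1 i) (ω.2.2.2 i)) = 0
  rw [this]; ring

lemma sum_codeLaw_mul_logb_prod (ch : Channel X₁ X₂ S Y Z) (c : Code X₁ X₂ S Y Z n M₁ M₂)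
    (h₁ : M₁ ≠ 0) (h₂ : M₂ ≠ 0) {a : ℝ} (ha : 0 < a) :
    -∑ ω, codeLaw ch c ω * Real.logb 2 (1 / a * ∏ i, ch.stateLaw (ω.2.2.1 i))
      = Real.logb 2 a + codeStateEntropy ch c := by
  have hp := codeLaw_mem_stdSimplex ch c h₁ h₂
  have hlog : Real.logb 2 a = ∑ ω, codeLaw ch c ω * Real.logb 2 a := by
    rw [← Finset.sum_mul, hp.2, one_mul]
  rw [codeStateEntropy, Finset.sum_comm, hlog, ← sub_eq_add_neg, neg_eq_iff_eq_neg, neg_sub,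
    ← Finset.sum_sub_distrib]
  refine Finset.sum_congr rfl fun ω _ => ?_
  rcases (hp.1 ω).eq_or_lt with h0 | h0
  · simp [← h0]
  · have hs := fun i => stateLaw_pos_of_codeLaw_pos h0 i
    rw [Real.logb_mul (by positivity) (Finset.prod_pos fun i _ => hs i).ne',
      Real.logb_prod _ _ fun i _ => (hs i).ne', one_div, Real.logb_inv, ← Finset.mul_sum]
    ring

lemma entropy_messages_state (ch : Channel X₁ X₂ S Y Z) (c : Code X₁ X₂ S Y Z n M₁ M₂)
    (h₁ : M₁ ≠ 0) (h₂ : M₂ ≠ 0) :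
    entropy (codeLaw ch c) (fun ω => (ω.1, ω.2.1, ω.2.2.1))
      = Real.logb 2 M₁ + Real.logb 2 M₂ + codeStateEntropy ch c := by
  have h₁' : (0 : ℝ) < M₁ := by positivity
  have h₂' : (0 : ℝ) < M₂ := by positivity
  rw [entropy_eq, ← Real.logb_mul h₁'.ne' h₂'.ne',
    ← sum_codeLaw_mul_logb_prod ch c h₁ h₂ (mul_pos h₁' h₂')]
  simp only [law_messages_state]

lemma condEntropy_output_messages_state (ch : Channel X₁ X₂ S Y Z)
    (c : Code X₁ X₂ S Y Z n M₁ M₂) (h₁ : M₁ ≠ 0) (h₂ : M₂ ≠ 0) :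
    condEntropy (codeLaw ch c) (fun ω i => (ω.2.2.2 i).2) (fun ω => (ω.1, ω.2.1, ω.2.2.1))
      = codeNoise ch c := by
  have hp := codeLaw_mem_stdSimplex ch c h₁ h₂
  rw [condEntropy_eq_of_kernel hp.1 _ _ _ (law_output_messages_state ch c), codeNoise,
    Finset.sum_comm]
  congr 1
  refine Finset.sum_congr rfl fun ω _ => ?_
  rcases (hp.1 ω).eq_or_lt with h0 | h0
  · simp [← h0]
  · rw [Real.logb_prod _ _ fun i _ => (transZ_pos_of_codeLaw_pos h0 i).ne', Finset.mul_sum]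

lemma sum_prod_stateLaw (ch : Channel X₁ X₂ S Y Z) (n : ℕ) :
    ∑ s : Fin n → S, ∏ i, ch.stateLaw (s i) = 1 := by
  rw [sum_pi_prod fun (_ : Fin n) s => ch.stateLaw s]
  simp [ch.stateLaw_mem.2]

lemma entropy_state_le (ch : Channel X₁ X₂ S Y Z) (c : Code X₁ X₂ S Y Z n M₁ M₂)
    (h₁ : M₁ ≠ 0) (h₂ : M₂ ≠ 0) :
    entropy (codeLaw ch c) (fun ω => ω.2.2.1) ≤ codeStateEntropy ch c := by
  have h := entropy_le_cross (codeLaw_mem_stdSimplex ch c h₁ h₂) (fun ω => ω.2.2.1)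
    (fun s => 1 / 1 * ∏ i, ch.stateLaw (s i))
    (fun s => mul_nonneg (by norm_num) (Finset.prod_nonneg fun i _ => ch.stateLaw_mem.1 _))
    (by simp [sum_prod_stateLaw]) (fun ω hω => mul_pos (by norm_num)
      (Finset.prod_pos fun i _ => stateLaw_pos_of_codeLaw_pos hω i))
  rwa [sum_codeLaw_mul_logb_prod ch c h₁ h₂ one_pos, Real.logb_one, zero_add] at h

lemma entropy_le_logb_card {Ω α : Type*} [Fintype Ω] [Fintype α] {p : Ω → ℝ}
    (hp : p ∈ stdSimplex ℝ Ω) (A : Ω → α) (h : Fintype.card α ≠ 0) :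
    entropy p A ≤ Real.logb 2 (Fintype.card α) := by
  have h' : (0 : ℝ) < Fintype.card α := by positivity
  refine (entropy_le_cross hp A (fun _ => (Fintype.card α : ℝ)⁻¹) (fun _ => by positivity)
    (by simp [h'.ne']) (fun _ _ => by positivity)).trans_eq ?_
  rw [← Finset.sum_mul, hp.2, Real.logb_inv]; ring

lemma entropy_message_state (ch : Channel X₁ X₂ S Y Z) (c : Code X₁ X₂ S Y Z n M₁ M₂)
    (h₁ : M₁ ≠ 0) (h₂ : M₂ ≠ 0) :
    entropy (codeLaw ch c) (fun ω => (ω.1, ω.2.2.1))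
      = Real.logb 2 M₁ + codeStateEntropy ch c := by
  have hp := codeLaw_mem_stdSimplex ch c h₁ h₂
  apply le_antisymm
  · have h2 := condEntropy_le_entropy hp (fun ω => ω.1) (fun ω => ω.2.2.1)
    have h3 := entropy_le_logb_card hp (fun ω => ω.1) (by simpa using h₁)
    rw [Fintype.card_fin] at h3
    rw [condEntropy] at h2
    have := entropy_state_le ch c h₁ h₂
    linarith
  · have h2 := condEntropy_le_entropy hp (fun ω => ω.2.1) (fun ω => (ω.1, ω.2.2.1))
    have h3 := entropy_le_logb_card hp (fun ω => ω.2.1) (by simpa using h₂)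
    rw [Fintype.card_fin] at h3
    rw [condEntropy, entropy_congr hp.1 (B := fun ω => (ω.1, ω.2.1, ω.2.2.1))
      (fun _ _ => by simp; tauto), entropy_messages_state ch c h₁ h₂] at h2
    linarith

lemma condEntropy_message_output_le (ch : Channel X₁ X₂ S Y Z) (c : Code X₁ X₂ S Y Z n M₁ M₂)
    (h₁ : M₁ ≠ 0) (h₂ : M₂ ≠ 0) :
    condEntropy (codeLaw ch c) (fun ω => ω.1) (fun ω i => (ω.2.2.2 i).1)
      ≤ 1 + errorProb ch c * Real.logb 2 ((M₁ : ℝ) * M₂) := by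
  have hp := codeLaw_mem_stdSimplex ch c h₁ h₂
  have h₁' : (1 : ℝ) ≤ M₁ := by exact_mod_cast Nat.one_le_iff_ne_zero.2 h₁
  have h₂' : (1 : ℝ) ≤ M₂ := by exact_mod_cast Nat.one_le_iff_ne_zero.2 h₂
  refine fano hp _ _ c.dec₁ (by rw [Fintype.card_fin]; nlinarith) (by nlinarith) ?_
  rw [errorProb_eq_sum_codeLaw]
  refine Finset.sum_le_sum fun ω _ => mul_le_mul_of_nonneg_left ?_ (hp.1 ω)
  rw [Set.indicator_apply]
  by_cases h : c.dec₁ (fun i => (ω.2.2.2 i).1) = ω.1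
  · simp only [Set.mem_ofPred_eq, h, ne_eq, not_true_eq_false, if_false]
    split_ifs <;> norm_num
  · simp [h]

lemma condEntropy_messages_output_le (ch : Channel X₁ X₂ S Y Z) (c : Code X₁ X₂ S Y Z n M₁ M₂)
    (h₁ : M₁ ≠ 0) (h₂ : M₂ ≠ 0) :
    condEntropy (codeLaw ch c) (fun ω => (ω.1, ω.2.1))
      (fun ω => ((fun i => (ω.2.2.2 i).2), ω.2.2.1))
      ≤ 1 + errorProb ch c * Real.logb 2 ((M₁ : ℝ) * M₂) := by
  have hp := codeLaw_mem_stdSimplex ch c h₁ h₂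
  have h₁' : (1 : ℝ) ≤ M₁ := by exact_mod_cast Nat.one_le_iff_ne_zero.2 h₁
  have h₂' : (1 : ℝ) ≤ M₂ := by exact_mod_cast Nat.one_le_iff_ne_zero.2 h₂
  refine fano hp _ _ (fun b => c.dec₂ b.1 b.2) (by simp) (by nlinarith) ?_
  rw [errorProb_eq_sum_codeLaw]
  refine Finset.sum_le_sum fun ω _ => mul_le_mul_of_nonneg_left ?_ (hp.1 ω)
  rw [Set.indicator_apply]
  by_cases h : c.dec₂ (fun i => (ω.2.2.2 i).2) ω.2.2.1 = (ω.1, ω.2.1)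
  · simp only [Set.mem_ofPred_eq, h, ne_eq, not_true_eq_false, if_false]
    split_ifs <;> norm_num
  · simp [h]

lemma mem_rateRegion_of_singleLetter (ch : Channel X₁ X₂ S Y Z) (c : Code X₁ X₂ S Y Z n M₁ M₂)
    (hn : n ≠ 0) (h₁ : M₁ ≠ 0) (h₂ : M₂ ≠ 0) (g : S → Z → τ) {R : ℝ × ℝ}
    {p : (Fin M₁ × Fin M₂ × (Fin n → S) × (Fin n → Y × Z)) × Fin n → ℝ}
    (hp : p = timeShared (codeLaw ch c) n)
    {T : (Fin M₁ × Fin M₂ × (Fin n → S) × (Fin n → Y × Z)) × Fin n → X₁ × S ×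
      (Fin n × Fin M₁ × (Fin n → Option Y) × (Fin n → Option τ)) × X₂ × Y × Z}
    (hT : T = singleLetter c g)
    (hA : R.1 ≤ entropy p (fun t => (T t).2.2.2.2.1)
        - condEntropy p (fun t => (T t).2.1) (fun t => (T t).1)
        + (entropy p (fun t => ((T t).2.2.1, (T t).2.1, (T t).1))
          - entropy p (fun t => ((T t).2.2.1, (T t).1, (T t).2.2.2.2.1))))
    (hB : R.2 ≤ condEntropy p (fun t => (T t).2.2.2.2.2) (fun t => ((T t).2.1, (T t).1))
      - codeNoise ch c / n)
    (hC : R.1 + R.2 ≤ condEntropy p (fun t => (T t).2.2.2.2.2) (fun t => (T t).2.1)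
      - codeNoise ch c / n)
    (hD : R.1 + R.2 ≤ entropy p (fun t => (T t).2.2.2.2.1)
        - condEntropy p (fun t => (T t).2.1) (fun t => (T t).1)
        + (entropy p (fun t => ((T t).2.2.1, (T t).2.1, (T t).1))
          - entropy p (fun t => ((T t).2.2.1, (T t).1, (T t).2.2.2.2.1)))
        + (condEntropy p (fun t => (T t).2.2.2.2.2)
          (fun t => ((T t).1, (T t).2.2.1, (T t).2.1)) - codeNoise ch c / n)) :
    R ∈ rateRegion ch (Fin n × Fin M₁ × (Fin n → Option Y) × (Fin n → Option τ)) := by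
  have hq := timeShared_mem_stdSimplex (codeLaw_mem_stdSimplex ch c h₁ h₂) hn
  obtain ⟨pX₁, hX₁, pUX₂, hUX₂, hlaw⟩ := exists_jointLaw_eq_law_singleLetter ch c g hn h₁ h₂
  refine ⟨pX₁, hX₁, pUX₂, hUX₂, ?_⟩
  have hnoise : noise ch (law (timeShared (codeLaw ch c) n) (singleLetter c g))
      = codeNoise ch c / n := by
    rw [noise, codeNoise, neg_div, sum_law_mul _ (singleLetter c g) fun t : X₁ × S ×
      (Fin n × Fin M₁ × (Fin n → Option Y) × (Fin n → Option τ)) × X₂ × Y × Z =>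
      Real.logb 2 (transZ ch t.1 t.2.2.2.1 t.2.1 t.2.2.2.2.2)]
    exact congrArg Neg.neg (sum_timeShared_mul (codeLaw ch c) fun ω i => Real.logb 2
      (transZ ch (c.enc₁ ω.1 i) (c.enc₂ ω.1 ω.2.1 ω.2.2.1 i) (ω.2.2.1 i) (ω.2.2.2 i).2))
  rw [← hlaw, rateBounds_jointLaw_iff ch hlaw (law_nonneg hq.1 _), hnoise]
  subst hp hT
  simp only [entropy_law, condEntropy_law]
  exact ⟨hA, hB, hC, hD⟩

lemma div_le_condEntropy_timeShared_output {β γ : Type*} [Fintype β] [Fintype γ]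
    (ch : Channel X₁ X₂ S Y Z) (c : Code X₁ X₂ S Y Z n M₁ M₂)
    (hn : n ≠ 0) (h₁ : M₁ ≠ 0) (h₂ : M₂ ≠ 0)
    (B : Fin M₁ × Fin M₂ × (Fin n → S) × (Fin n → Y × Z) → β) (f : Fin n → β → γ) :
    condEntropy (codeLaw ch c) (fun ω i => (ω.2.2.2 i).2) B / n
      ≤ condEntropy (timeShared (codeLaw ch c) n) (fun t => (t.1.2.2.2 t.2).2)
        (fun t => f t.2 (B t.1)) := by
  have hp := codeLaw_mem_stdSimplex ch c h₁ h₂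
  refine le_trans ?_ (le_condEntropy_timeShared hp hn (fun ω i => (ω.2.2.2 i).2)
    (fun ω i => f i (B ω)))
  exact div_le_div_of_nonneg_right (condEntropy_pi_le hp _ _ f) (Nat.cast_nonneg _)

/-- The single-letter form of `I(W₁; Yⁿ)` plus what the future of `g (S, Z)` contributes. -/
lemma le_singleLetter_first (ch : Channel X₁ X₂ S Y Z) (c : Code X₁ X₂ S Y Z n M₁ M₂)
    (hn : n ≠ 0) (h₁ : M₁ ≠ 0) (h₂ : M₂ ≠ 0) (g : S → Z → τ) :
    (entropy (codeLaw ch c) (fun ω => (ω.1, fun i => g (ω.2.2.1 i) (ω.2.2.2 i).2))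
      - codeStateEntropy ch c
      - condEntropy (codeLaw ch c) (fun ω => ω.1) (fun ω i => (ω.2.2.2 i).1)) / n
    ≤ entropy (timeShared (codeLaw ch c) n) (fun t => (singleLetter c g t).2.2.2.2.1)
      - condEntropy (timeShared (codeLaw ch c) n) (fun t => (singleLetter c g t).2.1)
        (fun t => (singleLetter c g t).1)
      + (entropy (timeShared (codeLaw ch c) n) (fun t => ((singleLetter c g t).2.2.1,
          g (t.1.2.2.1 t.2) (t.1.2.2.2 t.2).2, (singleLetter c g t).1))
        - entropy (timeShared (codeLaw ch c) n) (fun t => ((singleLetter c g t).2.2.1,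
          (singleLetter c g t).1, (singleLetter c g t).2.2.2.2.1))) := by
  have hp := codeLaw_mem_stdSimplex ch c h₁ h₂
  have hq := timeShared_mem_stdSimplex hp hn
  have hn' : (0 : ℝ) < n := by positivity
  have hy : entropy (codeLaw ch c) (fun ω i => (ω.2.2.2 i).1) / n
      ≤ entropy (timeShared (codeLaw ch c) n) (fun t => (singleLetter c g t).2.2.2.2.1) :=
    (div_le_div_of_nonneg_right (entropy_pi_le hp _) hn'.le).trans
      (le_entropy_timeShared hp hn fun ω i => (ω.2.2.2 i).1)
  have hs : condEntropy (timeShared (codeLaw ch c) n) (fun t => (singleLetter c g t).2.1)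
        (fun t => (singleLetter c g t).1) ≤ codeStateEntropy ch c / n := by
    refine (condEntropy_le_entropy hq _ _).trans ?_
    refine (entropy_le_cross hq _ ch.stateLaw ch.stateLaw_mem.1 ch.stateLaw_mem.2.le
      fun t ht => ?_).trans_eq ?_
    · exact stateLaw_pos_of_codeLaw_pos
        ((div_pos_iff_of_pos_right hn').1 (show 0 < codeLaw ch c t.1 / n from ht)) t.2
    · rw [codeStateEntropy, neg_div]
      exact congrArg Neg.neg (sum_timeShared_mul (codeLaw ch c) fun ω i =>
        Real.logb 2 (ch.stateLaw (ω.2.2.1 i)))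
  let u := auxVar (fun ω : Fin M₁ × Fin M₂ × (Fin n → S) × (Fin n → Y × Z) => ω.1)
      (fun ω i => (ω.2.2.2 i).1) (fun ω i => g (ω.2.2.1 i) (ω.2.2.2 i).2)
  have e1 := entropy_timeShared hp hn
    fun ω i => (u ω i, g (ω.2.2.1 i) (ω.2.2.2 i).2, c.enc₁ ω.1 i)
  have e2 := entropy_timeShared hp hn fun ω i => (u ω i, c.enc₁ ω.1 i, (ω.2.2.2 i).1)
  have e3 := sum_entropy_auxVar hp.1 (fun ω => ω.1)
    (fun ω i => (ω.2.2.2 i).1) (fun ω i => g (ω.2.2.1 i) (ω.2.2.2 i).2) c.enc₁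
  rw [entropy_congr hq.1 (B := fun t => ((singleLetter c g t).2.2.1,
    g (t.1.2.2.1 t.2) (t.1.2.2.2 t.2).2, (singleLetter c g t).1))
    (fun _ _ => by simp only [singleLetter, Prod.mk.injEq, u]; tauto)] at e1
  rw [entropy_congr hq.1 (B := fun t => ((singleLetter c g t).2.2.1,
    (singleLetter c g t).1, (singleLetter c g t).2.2.2.2.1))
    (fun _ _ => by simp only [singleLetter, Prod.mk.injEq, u]; tauto)] at e2
  rw [e1, e2, condEntropy]
  have e4 := congrArg (· / (n : ℝ)) e3
  simp only [sub_div] at e4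
  simp only [sub_div]
  linarith

/-- The weak converse for one code: its rates, reduced by a Fano term, satisfy the single-letter
constraints. The auxiliary variable contains the future of the state, and also the future of the
second output unless this violates the constraint on the first rate. -/
lemma exists_mem_rateRegion_of_code (ch : Channel X₁ X₂ S Y Z) (c : Code X₁ X₂ S Y Z n M₁ M₂)
    (hn : n ≠ 0) (h₁ : M₁ ≠ 0) (h₂ : M₂ ≠ 0) :
    ∃ k ≤ Fintype.card X₁ * Fintype.card X₂ * Fintype.card S + 1,
      ((Real.logb 2 M₁ - (1 + errorProb ch c * Real.logb 2 ((M₁ : ℝ) * M₂))) / n,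
        (Real.logb 2 M₂ - (1 + errorProb ch c * Real.logb 2 ((M₁ : ℝ) * M₂))) / n)
        ∈ rateRegion ch (Fin k) := by
  have hp := codeLaw_mem_stdSimplex ch c h₁ h₂
  have hq := timeShared_mem_stdSimplex hp hn
  have hn' : (0 : ℝ) < n := by positivity
  have f1 := condEntropy_message_output_le ch c h₁ h₂
  have f2 := condEntropy_messages_output_le ch c h₁ h₂
  set φ := 1 + errorProb ch c * Real.logb 2 ((M₁ : ℝ) * M₂)
  have m1 := entropy_message_state ch c h₁ h₂
  have m2 := entropy_messages_state ch c h₁ h₂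
  have m3 := entropy_state_le ch c h₁ h₂
  have m4 := condEntropy_output_messages_state ch c h₁ h₂
  rw [condEntropy] at f2 m4
  rw [entropy_congr hp.1 (B := fun ω => ((fun i => (ω.2.2.2 i).2), (ω.1, ω.2.1, ω.2.2.1)))
    (fun _ _ => by simp; tauto)] at f2
  have b1 := div_le_condEntropy_timeShared_output ch c hn h₁ h₂ (fun ω => (ω.2.2.1, ω.1))
    (fun i b => (b.1 i, c.enc₁ b.2 i))
  have b2 := div_le_condEntropy_timeShared_output ch c hn h₁ h₂ (fun ω => ω.2.2.1)
    (fun i b => b i)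
  have a1 := le_singleLetter_first ch c hn h₁ h₂ fun s _ => s
  have a2 := le_singleLetter_first ch c hn h₁ h₂ fun s z => (s, z)
  set p := timeShared (codeLaw ch c) n with hpdef
  set V := singleLetter c (fun s _ => s) with hV
  set U := singleLetter c (fun s z => (s, z)) with hU
  have hB : (Real.logb 2 M₂ - φ) / n ≤ condEntropy p (fun t => (t.1.2.2.2 t.2).2)
      (fun t => (t.1.2.2.1 t.2, c.enc₁ t.1.1 t.2)) - codeNoise ch c / n := by
    rw [le_sub_iff_add_le, ← add_div]
    refine (div_le_div_of_nonneg_right ?_ hn'.le).trans b1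
    rw [condEntropy, entropy_congr hp.1 (A := fun ω => (ω.2.2.1, ω.1))
      (B := fun ω => (ω.1, ω.2.2.1)) (fun _ _ => by simp; tauto), m1]
    have := entropy_le_of_determined hp.1 (A := fun ω => ((fun i => (ω.2.2.2 i).2), ω.2.2.1, ω.1))
      (B := fun ω => ((fun i => (ω.2.2.2 i).2), ω.2.2.1)) (fun _ _ => by simp; tauto)
    linarith
  have hC : (Real.logb 2 M₁ - φ) / n + (Real.logb 2 M₂ - φ) / n
      ≤ condEntropy p (fun t => (t.1.2.2.2 t.2).2) (fun t => t.1.2.2.1 t.2)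
        - codeNoise ch c / n := by
    rw [le_sub_iff_add_le, ← add_div, ← add_div]
    refine (div_le_div_of_nonneg_right ?_ hn'.le).trans b2
    have := condEntropy_nonneg hp.1 (fun ω => ω.1) (fun ω i => (ω.2.2.2 i).1)
    rw [condEntropy]
    linarith
  have hAV : (Real.logb 2 M₁ - φ) / n ≤ entropy p (fun t => (V t).2.2.2.2.1)
      - condEntropy p (fun t => (V t).2.1) (fun t => (V t).1)
      + (entropy p (fun t => ((V t).2.2.1, (V t).2.1, (V t).1))
        - entropy p (fun t => ((V t).2.2.1, (V t).1, (V t).2.2.2.2.1))) := by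
    refine le_trans (div_le_div_of_nonneg_right ?_ hn'.le) a1
    rw [m1]
    linarith
  have hDU : (Real.logb 2 M₁ - φ) / n + (Real.logb 2 M₂ - φ) / n
      ≤ entropy p (fun t => (U t).2.2.2.2.1)
        - condEntropy p (fun t => (U t).2.1) (fun t => (U t).1)
        + (entropy p (fun t => ((U t).2.2.1, (U t).2.1, (U t).1))
          - entropy p (fun t => ((U t).2.2.1, (U t).1, (U t).2.2.2.2.1)))
        + (condEntropy p (fun t => (U t).2.2.2.2.2)
          (fun t => ((U t).1, (U t).2.2.1, (U t).2.1)) - codeNoise ch c / n) := by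
    have h : entropy p (fun t => ((U t).2.2.1, (U t).2.1, (U t).1))
        + condEntropy p (fun t => (U t).2.2.2.2.2) (fun t => ((U t).1, (U t).2.2.1, (U t).2.1))
        = entropy p (fun t => ((U t).2.2.1, (t.1.2.2.1 t.2, (t.1.2.2.2 t.2).2), (U t).1)) := by
      rw [condEntropy, entropy_congr hq.1 (A := fun t => ((U t).2.2.1, (U t).2.1, (U t).1))
        (B := fun t => ((U t).1, (U t).2.2.1, (U t).2.1)) (fun _ _ => by simp; tauto),
        add_sub_cancel]
      exact entropy_congr hq.1 fun _ _ => by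
        simp only [hU, singleLetter, Prod.mk.injEq]; tauto
    have h3 : (Real.logb 2 M₁ - φ) / n + (Real.logb 2 M₂ - φ) / n + codeNoise ch c / n
        ≤ (entropy (codeLaw ch c) (fun ω => (ω.1, fun i => (ω.2.2.1 i, (ω.2.2.2 i).2)))
          - codeStateEntropy ch c
          - condEntropy (codeLaw ch c) (fun ω => ω.1) (fun ω i => (ω.2.2.2 i).1)) / n := by
      rw [← add_div, ← add_div]
      refine div_le_div_of_nonneg_right ?_ hn'.le
      have := entropy_le_of_determined hp.1
        (A := fun ω => (ω.1, fun i => (ω.2.2.1 i, (ω.2.2.2 i).2)))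
        (B := fun ω => ((fun i => (ω.2.2.2 i).2), ω.2.2.1)) (fun _ _ => by
          simp only [Prod.mk.injEq, funext_iff]; exact fun h => ⟨fun i => (h.2 i).2, fun i => (h.2 i).1⟩)
      linarith
    linarith
  by_cases hAU : (Real.logb 2 M₁ - φ) / n ≤ entropy p (fun t => (U t).2.2.2.2.1)
      - condEntropy p (fun t => (U t).2.1) (fun t => (U t).1)
      + (entropy p (fun t => ((U t).2.2.1, (U t).2.1, (U t).1))
        - entropy p (fun t => ((U t).2.2.1, (U t).1, (U t).2.2.2.2.1)))
  · exact exists_fin_mem_rateRegion ch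
      (mem_rateRegion_of_singleLetter ch c hn h₁ h₂ _ hpdef hU hAU hB hC hDU)
  · refine exists_fin_mem_rateRegion ch
      (mem_rateRegion_of_singleLetter ch c hn h₁ h₂ _ hpdef hV hAV hB hC ?_)
    -- dropping the future of `Z` from the auxiliary variable increases `H(Z | X₁ U S)`
    have hd : condEntropy p (fun t => (U t).2.2.2.2.2)
          (fun t => ((U t).1, (U t).2.2.1, (U t).2.1))
        ≤ condEntropy p (fun t => (V t).2.2.2.2.2)
          (fun t => ((V t).1, (V t).2.2.1, (V t).2.1)) := by
      refine (condEntropy_comp_le hq (fun t => (U t).2.2.2.2.2)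
          (fun t => ((U t).1, (U t).2.2.1, (U t).2.1)) fun b =>
          (b.1, (b.2.1.1, b.2.1.2.1, b.2.1.2.2.1, fun j => (b.2.1.2.2.2 j).map Prod.fst),
            b.2.2)).trans_eq ?_
      refine congrArg (condEntropy p (fun t => (V t).2.2.2.2.2)) (funext fun t => ?_)
      simp only [hU, hV, singleLetter, auxVar, Prod.mk.injEq, true_and, and_true]
      ext j
      by_cases h : t.2 < j <;> simp [mask, h]
    linarith

end Converse

open Filter Topology

/-! ### The converse in the limit -/

section ConverseLimit

lemma rpow_le_numMessages (n : ℕ) (R : ℝ) : (2 : ℝ) ^ ((n : ℝ) * R) ≤ numMessages n R :=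
  Nat.le_ceil _

lemma numMessages_pos (n : ℕ) (R : ℝ) : 0 < numMessages n R :=
  Nat.ceil_pos.2 (by positivity)

lemma numMessages_le (n : ℕ) {R : ℝ} (hR : 0 ≤ R) :
    (numMessages n R : ℝ) ≤ 2 * (2 : ℝ) ^ ((n : ℝ) * R) := by
  have h1 : (1 : ℝ) ≤ (2 : ℝ) ^ ((n : ℝ) * R) :=
    Real.one_le_rpow one_le_two (by positivity)
  have := Nat.ceil_lt_add_one (a := (2 : ℝ) ^ ((n : ℝ) * R)) (by positivity)
  rw [numMessages]
  linarith

lemma tendsto_logb_numMessages {R : ℝ} (hR : 0 ≤ R) :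
    Tendsto (fun n : ℕ => Real.logb 2 (numMessages n R) / n) atTop (𝓝 R) := by
  have hu : Tendsto (fun n : ℕ => R + 1 / (n : ℝ)) atTop (𝓝 R) := by
    simpa using tendsto_const_nhds.add (tendsto_one_div_atTop_nhds_zero_nat (𝕜 := ℝ))
  have hM : ∀ n, (0 : ℝ) < numMessages n R := fun n => by exact_mod_cast numMessages_pos n R
  refine tendsto_of_tendsto_of_tendsto_of_le_of_le' tendsto_const_nhds hu ?_ ?_
  · filter_upwards [eventually_gt_atTop 0] with n hn
    have hn' : (0 : ℝ) < n := by exact_mod_cast hn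
    rw [le_div_iff₀ hn', mul_comm, Real.le_logb_iff_rpow_le one_lt_two (hM n)]
    exact rpow_le_numMessages n R
  · filter_upwards [eventually_gt_atTop 0] with n hn
    have hn' : (0 : ℝ) < n := by exact_mod_cast hn
    rw [div_le_iff₀ hn', Real.logb_le_iff_le_rpow one_lt_two (hM n)]
    refine (numMessages_le n hR).trans_eq ?_
    rw [add_mul, one_div, inv_mul_cancel₀ hn'.ne', Real.rpow_add two_pos, Real.rpow_one,
      mul_comm R]
    ring

variable {X₁ X₂ S Y Z : Type*} [Fintype X₁] [Fintype X₂] [Fintype S] [Fintype Y] [Fintype Z]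

/-- The converse: the capacity region is contained in the single-letter region. -/
lemma exists_mem_rateRegion_of_mem_capacityRegion (ch : Channel X₁ X₂ S Y Z) {R : ℝ × ℝ}
    (hR : R ∈ capacityRegion ch) : 0 ≤ R.1 ∧ 0 ≤ R.2 ∧
      ∃ k ≤ Fintype.card X₁ * Fintype.card X₂ * Fintype.card S + 1,
        R ∈ rateRegion ch (Fin k) := by
  let N := Fintype.card X₁ * Fintype.card X₂ * Fintype.card S + 1
  let Γ : Set (ℝ × ℝ) := ⋃ k ∈ Finset.range (N + 1), rateRegion ch (Fin k)
  have hΓ : IsClosed Γ := isClosed_biUnion_finset fun k _ => isClosed_rateRegion ch (Fin k)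
  have hmem : ∀ {R}, R ∈ Γ ↔ ∃ k ≤ N, R ∈ rateRegion ch (Fin k) := fun {R} => by
    simp [Γ]
  have hclosed : IsClosed ({R : ℝ × ℝ | 0 ≤ R.1} ∩ ({R : ℝ × ℝ | 0 ≤ R.2} ∩ Γ)) :=
    (isClosed_le continuous_const continuous_fst).inter
      ((isClosed_le continuous_const continuous_snd).inter hΓ)
  suffices h : {R | Achievable ch R} ⊆ {R : ℝ × ℝ | 0 ≤ R.1} ∩ ({R : ℝ × ℝ | 0 ≤ R.2} ∩ Γ) by
    obtain ⟨h1, h2, h3⟩ := closure_minimal h hclosed hR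
    exact ⟨h1, h2, hmem.1 h3⟩
  rintro R ⟨h1, h2, c, hc⟩
  refine ⟨h1, h2, ?_⟩
  have l1 := tendsto_logb_numMessages h1
  have l2 := tendsto_logb_numMessages h2
  have lφ : Tendsto (fun n : ℕ => (1 + errorProb ch (c n) * Real.logb 2
      ((numMessages n R.1 : ℝ) * numMessages n R.2)) / n) atTop (𝓝 0) := by
    have := (tendsto_one_div_atTop_nhds_zero_nat (𝕜 := ℝ)).add (hc.mul (l1.add l2))
    simp only [zero_mul, add_zero] at this
    refine this.congr fun n => ?_
    have h1 : (numMessages n R.1 : ℝ) ≠ 0 := by exact_mod_cast (numMessages_pos n R.1).ne'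
    have h2 : (numMessages n R.2 : ℝ) ≠ 0 := by exact_mod_cast (numMessages_pos n R.2).ne'
    rw [Real.logb_mul h1 h2]
    ring
  have lim := (l1.sub lφ).prodMk_nhds (l2.sub lφ)
  simp only [sub_zero] at lim
  refine hΓ.mem_of_tendsto lim ?_
  filter_upwards [eventually_ne_atTop 0] with n hn
  rw [← sub_div, ← sub_div, hmem]
  exact exists_mem_rateRegion_of_code ch (c n) hn (numMessages_pos n R.1).ne'
    (numMessages_pos n R.2).ne'

end ConverseLimit

/-! ### Random coding ensembles and their tests -/

section Indicator

open Classical in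
/-- The indicator of a proposition, as a real number. -/
def ind (P : Prop) : ℝ := if P then 1 else 0

lemma ind_nonneg (P : Prop) : 0 ≤ ind P := by unfold ind; split_ifs <;> norm_num

lemma ind_le_one (P : Prop) : ind P ≤ 1 := by unfold ind; split_ifs <;> norm_num

lemma ind_of_true {P : Prop} (h : P) : ind P = 1 := if_pos h

lemma ind_of_false {P : Prop} (h : ¬ P) : ind P = 0 := if_neg h

lemma ind_mono {P Q : Prop} (h : P → Q) : ind P ≤ ind Q := by
  by_cases hP : P
  · rw [ind_of_true hP, ind_of_true (h hP)]
  · rw [ind_of_false hP]; exact ind_nonneg Q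

lemma ind_or_le (P Q : Prop) : ind (P ∨ Q) ≤ ind P + ind Q := by
  by_cases hP : P
  · rw [ind_of_true hP]; linarith [ind_nonneg Q, ind_le_one (P ∨ Q)]
  · rw [ind_of_false hP, zero_add]; exact ind_mono fun h => h.resolve_left hP

lemma ind_exists_le_sum {ι : Type*} (s : Finset ι) (P : ι → Prop) :
    ind (∃ i ∈ s, P i) ≤ ∑ i ∈ s, ind (P i) := by
  by_cases h : ∃ i ∈ s, P i
  · obtain ⟨i, hi, hP⟩ := h
    refine (ind_le_one _).trans ?_
    rw [← ind_of_true hP]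
    exact Finset.single_le_sum (f := fun i => ind (P i)) (fun _ _ => ind_nonneg _) hi
  · rw [ind_of_false h]; exact Finset.sum_nonneg fun _ _ => ind_nonneg _

/-- Markov's inequality for a threshold: `θ r ≤ k` happens with `r`-weight at most `k / θ`. -/
lemma mul_ind_le_div {θ r k : ℝ} (hθ : 0 < θ) (hk : 0 ≤ k) : r * ind (θ * r ≤ k) ≤ k / θ := by
  by_cases h : θ * r ≤ k
  · rw [ind_of_true h, mul_one, le_div_iff₀ hθ, mul_comm]; exact h
  · rw [ind_of_false h, mul_zero]; positivity

end Indicator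

lemma expect_mul_apply {ι α : Type*} [Fintype ι] [DecidableEq ι] [Fintype α] (q : ι → α → ℝ)
    (hq : ∀ i, ∑ a, q i a = 1) {i j : ι} (hij : j ≠ i) (φ ψ : α → ℝ) :
    expect q (fun f => φ (f i) * ψ (f j)) = (∑ a, q i a * φ a) * ∑ a, q j a * ψ a := by
  rw [expect_apply_apply q hq hij fun a b => φ a * ψ b, Finset.sum_mul_sum]
  exact Finset.sum_congr rfl fun _ _ => Finset.sum_congr rfl fun _ _ => by ring

lemma sum_comm_three {α β γ : Type*} [Fintype α] [Fintype β] [Fintype γ] (F : α → β → γ → ℝ) :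
    ∑ a, ∑ b, ∑ c, F a b c = ∑ c, ∑ a, ∑ b, F a b c := by
  rw [Finset.sum_comm (s := Finset.univ (α := γ))]
  exact Finset.sum_congr rfl fun a _ => Finset.sum_comm

lemma sum_marginal_mul {α β : Type*} [Fintype α] [Fintype β] (g : α × β → ℝ) (h : β → ℝ) :
    ∑ b, (∑ a, g (a, b)) * h b = ∑ v, g v * h v.2 := by
  rw [Fintype.sum_prod_type_right]
  exact Finset.sum_congr rfl fun b _ => Finset.sum_mul _ _ _

/-- A random coding ensemble: the laws `a = P(x₁)`, `b = P(u | x₁)`, `d = P(x₂ | x₁, u, s)`, the law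
`σ` of the state, the backward law `ρ = P(s | x₁, u)` and the channel `W`.  The backward law is
constrained only through its average over `u`; where `P(u | x₁) = 0` it need not be normalised. -/
structure Ensemble (X₁ U S X₂ Y Z : Type*) [Fintype X₁] [Fintype U] [Fintype S] [Fintype X₂]
    [Fintype Y] [Fintype Z] where
  a : X₁ → ℝ
  a_mem : a ∈ stdSimplex ℝ X₁
  b : X₁ → U → ℝ
  b_mem : ∀ x₁, b x₁ ∈ stdSimplex ℝ U
  ρ : X₁ → U → S → ℝ
  ρ_nonneg : ∀ x₁ u s, 0 ≤ ρ x₁ u s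
  σ : S → ℝ
  σ_mem : σ ∈ stdSimplex ℝ S
  sum_b_ρ : ∀ x₁ s, ∑ u, b x₁ u * ρ x₁ u s = σ s
  d : X₁ → U → S → X₂ → ℝ
  d_mem : ∀ x₁ u s, d x₁ u s ∈ stdSimplex ℝ X₂
  W : X₁ → X₂ → S → Y × Z → ℝ
  W_mem : ∀ x₁ x₂ s, W x₁ x₂ s ∈ stdSimplex ℝ (Y × Z)

namespace Ensemble

variable {X₁ U S X₂ Y Z : Type*} [Fintype X₁] [Fintype U] [Fintype S] [Fintype X₂]
    [Fintype Y] [Fintype Z] (E : Ensemble X₁ U S X₂ Y Z)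

/-- The law of the outputs given `(X₁, U, S)`. -/
def outGivenXUS (x₁ : X₁) (u : U) (s : S) (v : Y × Z) : ℝ := ∑ x₂, E.d x₁ u s x₂ * E.W x₁ x₂ s v

/-- The law of the state and the outputs given `X₁`. -/
def outGivenX (x₁ : X₁) (s : S) (v : Y × Z) : ℝ :=
  ∑ u, E.b x₁ u * (E.ρ x₁ u s * E.outGivenXUS x₁ u s v)

/-- The law of the state and the outputs. -/
def out (s : S) (v : Y × Z) : ℝ := ∑ x₁, E.a x₁ * E.outGivenX x₁ s v

/-- The law of the second output given the inputs. -/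
def outZ (x₁ : X₁) (x₂ : X₂) (s : S) (z : Z) : ℝ := ∑ y, E.W x₁ x₂ s (y, z)

/-- The law of the first output given `(X₁, U)`. -/
def lawYGivenXU (x₁ : X₁) (u : U) (y : Y) : ℝ :=
  ∑ s, E.ρ x₁ u s * ∑ z, E.outGivenXUS x₁ u s (y, z)

/-- The law of the first output. -/
def lawY (y : Y) : ℝ := ∑ s, ∑ z, E.out s (y, z)

/-- The law of the state and the second output. -/
def lawSZ (s : S) (z : Z) : ℝ := ∑ y, E.out s (y, z)

/-- The law of the state and the second output given `X₁`. -/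
def lawSZGivenX (x₁ : X₁) (s : S) (z : Z) : ℝ := ∑ y, E.outGivenX x₁ s (y, z)

/-- The law of the second output given `(X₁, U, S)`. -/
def lawZGivenXUS (x₁ : X₁) (u : U) (s : S) (z : Z) : ℝ := ∑ y, E.outGivenXUS x₁ u s (y, z)

/-- The test of receiver 1: `(x₁, u)` explains `y` better than chance by the factor `θ`. -/
def testY (θ : ℝ) (x₁ : X₁) (u : U) (y : Y) : Prop := θ * E.lawY y ≤ E.lawYGivenXU x₁ u y

/-- The test of receiver 2 against wrong `(x₁, u, x₂)`. -/
def testXUX (θ : ℝ) (x₁ : X₁) (u : U) (x₂ : X₂) (s : S) (z : Z) : Prop :=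
  θ * E.lawSZ s z ≤ E.ρ x₁ u s * E.outZ x₁ x₂ s z

/-- The test of receiver 2 against wrong `(u, x₂)`. -/
def testUX (θ : ℝ) (x₁ : X₁) (u : U) (x₂ : X₂) (s : S) (z : Z) : Prop :=
  θ * E.lawSZGivenX x₁ s z ≤ E.ρ x₁ u s * E.outZ x₁ x₂ s z

/-- The test of receiver 2 against wrong `x₂`. -/
def testX (θ : ℝ) (x₁ : X₁) (u : U) (x₂ : X₂) (s : S) (z : Z) : Prop :=
  θ * E.lawZGivenXUS x₁ u s z ≤ E.outZ x₁ x₂ s z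

/-- The expectation of `φ (X₁, U, S, X₂, (Y, Z))`. -/
def mean (φ : X₁ → U → S → X₂ → Y × Z → ℝ) : ℝ :=
  ∑ s, ∑ v, ∑ x₁, E.a x₁ * ∑ u, E.b x₁ u * ∑ x₂, E.d x₁ u s x₂ *
    (E.ρ x₁ u s * (E.W x₁ x₂ s v * φ x₁ u s x₂ v))

lemma outGivenXUS_nonneg (x₁ : X₁) (u : U) (s : S) (v : Y × Z) : 0 ≤ E.outGivenXUS x₁ u s v :=
  Finset.sum_nonneg fun _ _ => mul_nonneg ((E.d_mem _ _ _).1 _) ((E.W_mem _ _ _).1 _)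

lemma outZ_nonneg (x₁ : X₁) (x₂ : X₂) (s : S) (z : Z) : 0 ≤ E.outZ x₁ x₂ s z :=
  Finset.sum_nonneg fun _ _ => (E.W_mem _ _ _).1 _

lemma sum_outZ (x₁ : X₁) (x₂ : X₂) (s : S) : ∑ z, E.outZ x₁ x₂ s z = 1 := by
  rw [← (E.W_mem x₁ x₂ s).2, Fintype.sum_prod_type_right]; rfl

lemma sum_outGivenXUS (x₁ : X₁) (u : U) (s : S) : ∑ v, E.outGivenXUS x₁ u s v = 1 := by
  simp only [outGivenXUS]
  rw [Finset.sum_comm]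
  simp [← Finset.mul_sum, (E.W_mem _ _ _).2, (E.d_mem _ _ _).2]

lemma lawYGivenXU_nonneg (x₁ : X₁) (u : U) (y : Y) : 0 ≤ E.lawYGivenXU x₁ u y :=
  Finset.sum_nonneg fun _ _ => mul_nonneg (E.ρ_nonneg _ _ _)
    (Finset.sum_nonneg fun _ _ => E.outGivenXUS_nonneg _ _ _ _)

lemma sum_b_sum_ρ (x₁ : X₁) : ∑ u, E.b x₁ u * ∑ s, E.ρ x₁ u s = 1 := by
  simp only [Finset.mul_sum]
  rw [Finset.sum_comm]
  simp only [E.sum_b_ρ, E.σ_mem.2]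

lemma sum_lawYGivenXU (x₁ : X₁) (u : U) : ∑ y, E.lawYGivenXU x₁ u y = ∑ s, E.ρ x₁ u s := by
  simp only [lawYGivenXU]
  rw [Finset.sum_comm]
  refine Finset.sum_congr rfl fun s _ => ?_
  rw [← Finset.mul_sum, ← Fintype.sum_prod_type, sum_outGivenXUS, mul_one]

/-- A wrong pair `(x₁, u)` passes the test of receiver 1 with probability at most `1 / θ`. -/
lemma sum_testY_le {θ : ℝ} (hθ : 0 < θ) :
    ∑ s, ∑ v, E.out s v * ∑ x₁, E.a x₁ * ∑ u, E.b x₁ u * ind (E.testY θ x₁ u v.1) ≤ 1 / θ := by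
  calc _ = ∑ y, E.lawY y * ∑ x₁, E.a x₁ * ∑ u, E.b x₁ u * ind (E.testY θ x₁ u y) := by
        simp only [Fintype.sum_prod_type, lawY, Finset.sum_mul]
        rw [Finset.sum_comm]
    _ = ∑ x₁, E.a x₁ * ∑ u, E.b x₁ u * ∑ y, E.lawY y * ind (E.testY θ x₁ u y) := by
        simp only [Finset.mul_sum]
        rw [Finset.sum_comm]
        refine Finset.sum_congr rfl fun x₁ _ => ?_
        rw [Finset.sum_comm]
        exact Finset.sum_congr rfl fun u _ => Finset.sum_congr rfl fun y _ => by ring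
    _ ≤ ∑ x₁, E.a x₁ * ∑ u, E.b x₁ u * ∑ y, E.lawYGivenXU x₁ u y / θ := by
        refine Finset.sum_le_sum fun x₁ _ => mul_le_mul_of_nonneg_left
          (Finset.sum_le_sum fun u _ => mul_le_mul_of_nonneg_left
          (Finset.sum_le_sum fun y _ => ?_) ((E.b_mem _).1 _)) (E.a_mem.1 _)
        exact mul_ind_le_div hθ (E.lawYGivenXU_nonneg _ _ _)
    _ = 1 / θ := by
        simp only [← Finset.sum_div, sum_lawYGivenXU, ← mul_div_assoc, sum_b_sum_ρ, mul_one,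
          E.a_mem.2]

lemma sum_b_ρ_d_outZ (x₁ : X₁) :
    ∑ s, ∑ z, ∑ u, E.b x₁ u * ∑ x₂, E.d x₁ u s x₂ * (E.ρ x₁ u s * E.outZ x₁ x₂ s z) = 1 := by
  rw [← E.σ_mem.2]
  refine Finset.sum_congr rfl fun s _ => ?_
  rw [Finset.sum_comm, ← E.sum_b_ρ x₁ s]
  refine Finset.sum_congr rfl fun u _ => ?_
  rw [← Finset.mul_sum, Finset.sum_comm]
  simp only [← Finset.mul_sum, sum_outZ, mul_one]
  rw [← Finset.sum_mul, (E.d_mem _ _ _).2, one_mul]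

/-- Wrong `(x₁, u, x₂)` pass their test with probability at most `1 / θ`. -/
lemma sum_testXUX_le {θ : ℝ} (hθ : 0 < θ) :
    ∑ s, ∑ v, E.out s v * ∑ x₁, E.a x₁ * ∑ u, E.b x₁ u * ∑ x₂, E.d x₁ u s x₂ *
      ind (E.testXUX θ x₁ u x₂ s v.2) ≤ 1 / θ := by
  calc _ = ∑ s, ∑ z, E.lawSZ s z * ∑ x₁, E.a x₁ * ∑ u, E.b x₁ u * ∑ x₂, E.d x₁ u s x₂ *
          ind (E.testXUX θ x₁ u x₂ s z) := by
        simp only [Fintype.sum_prod_type_right, lawSZ, Finset.sum_mul]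
    _ = ∑ s, ∑ z, ∑ x₁, E.a x₁ * ∑ u, E.b x₁ u * ∑ x₂, E.d x₁ u s x₂ *
          (E.lawSZ s z * ind (E.testXUX θ x₁ u x₂ s z)) := by
        simp only [Finset.mul_sum]
        refine Finset.sum_congr rfl fun s _ => Finset.sum_congr rfl fun z _ =>
          Finset.sum_congr rfl fun x₁ _ => Finset.sum_congr rfl fun u _ =>
          Finset.sum_congr rfl fun x₂ _ => by ring
    _ ≤ ∑ s, ∑ z, ∑ x₁, E.a x₁ * ∑ u, E.b x₁ u * ∑ x₂, E.d x₁ u s x₂ *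
          (E.ρ x₁ u s * E.outZ x₁ x₂ s z / θ) := by
        refine Finset.sum_le_sum fun s _ => Finset.sum_le_sum fun z _ => Finset.sum_le_sum
          fun x₁ _ => mul_le_mul_of_nonneg_left (Finset.sum_le_sum fun u _ =>
          mul_le_mul_of_nonneg_left (Finset.sum_le_sum fun x₂ _ => mul_le_mul_of_nonneg_left
          ?_ ((E.d_mem _ _ _).1 _)) ((E.b_mem _).1 _)) (E.a_mem.1 _)
        exact mul_ind_le_div hθ (mul_nonneg (E.ρ_nonneg _ _ _) (E.outZ_nonneg _ _ _ _))
    _ = (∑ x₁, E.a x₁ * ∑ s, ∑ z, ∑ u, E.b x₁ u * ∑ x₂, E.d x₁ u s x₂ *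
          (E.ρ x₁ u s * E.outZ x₁ x₂ s z)) / θ := by
        simp only [← mul_div_assoc, ← Finset.sum_div]
        congr 1
        simp only [Finset.mul_sum (s := Finset.univ (α := S)),
          Finset.mul_sum (s := Finset.univ (α := Z))]
        rw [Finset.sum_comm (s := Finset.univ (α := X₁))]
        exact Finset.sum_congr rfl fun s _ => Finset.sum_comm
    _ = 1 / θ := by simp [sum_b_ρ_d_outZ, E.a_mem.2]

/-- Given `x₁`, wrong `(u, x₂)` pass their test with probability at most `1 / θ`. -/
lemma sum_testUX_le {θ : ℝ} (hθ : 0 < θ) :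
    ∑ s, ∑ v, ∑ x₁, E.a x₁ * (E.outGivenX x₁ s v * ∑ u, E.b x₁ u * ∑ x₂, E.d x₁ u s x₂ *
      ind (E.testUX θ x₁ u x₂ s v.2)) ≤ 1 / θ := by
  calc _ = ∑ x₁, E.a x₁ * ∑ s, ∑ z, E.lawSZGivenX x₁ s z * ∑ u, E.b x₁ u *
          ∑ x₂, E.d x₁ u s x₂ * ind (E.testUX θ x₁ u x₂ s z) := by
        rw [sum_comm_three]
        refine Finset.sum_congr rfl fun x₁ _ => ?_
        simp only [← Finset.mul_sum]
        congr 1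
        exact Finset.sum_congr rfl fun s _ => (sum_marginal_mul (E.outGivenX x₁ s) fun z =>
          ∑ u, E.b x₁ u * ∑ x₂, E.d x₁ u s x₂ * ind (E.testUX θ x₁ u x₂ s z)).symm
    _ ≤ ∑ x₁, E.a x₁ * (1 / θ) := by
        refine Finset.sum_le_sum fun x₁ _ => mul_le_mul_of_nonneg_left ?_ (E.a_mem.1 _)
        rw [← E.sum_b_ρ_d_outZ x₁]
        simp only [Finset.sum_div]
        refine Finset.sum_le_sum fun s _ => Finset.sum_le_sum fun z _ => ?_
        simp only [Finset.mul_sum (s := Finset.univ (α := U)), mul_div_assoc]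
        refine Finset.sum_le_sum fun u _ => ?_
        rw [mul_left_comm]
        refine mul_le_mul_of_nonneg_left ?_ ((E.b_mem _).1 _)
        simp only [Finset.mul_sum, Finset.sum_div, mul_div_assoc]
        refine Finset.sum_le_sum fun x₂ _ => ?_
        rw [mul_left_comm]
        refine mul_le_mul_of_nonneg_left ?_ ((E.d_mem _ _ _).1 _)
        rw [← mul_div_assoc]
        exact mul_ind_le_div hθ (mul_nonneg (E.ρ_nonneg _ _ _) (E.outZ_nonneg _ _ _ _))
    _ = 1 / θ := by rw [← Finset.sum_mul, E.a_mem.2, one_mul]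

/-- Given `(x₁, u)` and the state, a wrong `x₂` passes its test with probability at most `1 / θ`. -/
lemma sum_testX_le {θ : ℝ} (hθ : 0 < θ) :
    ∑ s, ∑ v, ∑ x₁, E.a x₁ * ∑ u, E.b x₁ u * (E.ρ x₁ u s * E.outGivenXUS x₁ u s v *
      ∑ x₂, E.d x₁ u s x₂ * ind (E.testX θ x₁ u x₂ s v.2)) ≤ 1 / θ := by
  calc _ = ∑ x₁, E.a x₁ * ∑ u, E.b x₁ u * ∑ s, E.ρ x₁ u s * ∑ z, E.lawZGivenXUS x₁ u s z *
          ∑ x₂, E.d x₁ u s x₂ * ind (E.testX θ x₁ u x₂ s z) := by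
        rw [sum_comm_three]
        refine Finset.sum_congr rfl fun x₁ _ => ?_
        simp only [← Finset.mul_sum]
        congr 1
        rw [sum_comm_three]
        refine Finset.sum_congr rfl fun u _ => ?_
        simp only [← Finset.mul_sum, mul_assoc]
        congr 1
        exact Finset.sum_congr rfl fun s _ => congrArg _
          (sum_marginal_mul (E.outGivenXUS x₁ u s) fun z =>
            ∑ x₂, E.d x₁ u s x₂ * ind (E.testX θ x₁ u x₂ s z)).symm
    _ ≤ ∑ x₁, E.a x₁ * ∑ u, E.b x₁ u * ∑ s, E.ρ x₁ u s * (1 / θ) := by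
        refine Finset.sum_le_sum fun x₁ _ => mul_le_mul_of_nonneg_left
          (Finset.sum_le_sum fun u _ => mul_le_mul_of_nonneg_left
          (Finset.sum_le_sum fun s _ => mul_le_mul_of_nonneg_left ?_ (E.ρ_nonneg _ _ _))
          ((E.b_mem _).1 _)) (E.a_mem.1 _)
        calc _ ≤ ∑ z, ∑ x₂, E.d x₁ u s x₂ * (E.outZ x₁ x₂ s z / θ) := by
              refine Finset.sum_le_sum fun z _ => ?_
              rw [Finset.mul_sum]
              refine Finset.sum_le_sum fun x₂ _ => ?_
              rw [mul_left_comm]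
              exact mul_le_mul_of_nonneg_left (mul_ind_le_div hθ (E.outZ_nonneg _ _ _ _))
                ((E.d_mem _ _ _).1 _)
          _ = 1 / θ := by
              rw [Finset.sum_comm]
              simp only [← Finset.mul_sum, ← Finset.sum_div, sum_outZ]
              rw [← Finset.sum_mul, (E.d_mem _ _ _).2, one_mul]
    _ = 1 / θ := by
        simp only [← Finset.sum_mul]
        have h : ∀ x₁, ∑ u, E.b x₁ u * ((∑ s, E.ρ x₁ u s) * (1 / θ)) = 1 / θ := fun x₁ => by
          simp only [← mul_assoc, ← Finset.sum_mul, sum_b_sum_ρ, one_mul]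
        simp only [h]
        rw [← Finset.sum_mul, E.a_mem.2, one_mul]

end Ensemble

/-! ### Superposition codebooks and soft covering -/

namespace Ensemble

variable {X₁ U S X₂ Y Z : Type*} [Fintype X₁] [Fintype U] [Fintype S] [Fintype X₂]
    [Fintype Y] [Fintype Z] (E : Ensemble X₁ U S X₂ Y Z)
  {𝒲₁ 𝒲₂ 𝒜 Λ : Type*} [Fintype 𝒲₁] [Fintype 𝒲₂] [Fintype 𝒜] [Fintype Λ] [DecidableEq 𝒲₁]
  [DecidableEq 𝒲₂] [DecidableEq 𝒜] [DecidableEq Λ] [DecidableEq S] (α : 𝒲₂ → 𝒜)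

/-- The index of the `u`-codeword that belongs to an `x₂`-codeword: the part `α w₂` of the second
message is carried by `u`. -/
def cloud (j : 𝒲₁ × 𝒲₂ × Λ × S) : 𝒲₁ × 𝒜 × Λ := (j.1, α j.2.1, j.2.2.1)

/-- The expectation over superposition codebooks: independent `x₁ (w₁)`, then `u (w₁, a, ℓ)` given
`x₁ (w₁)`, then `x₂ (w₁, w₂, ℓ, s)` given `x₁ (w₁)`, `u (w₁, α w₂, ℓ)` and `s`. -/
def avg (F : (𝒲₁ → X₁) → (𝒲₁ × 𝒜 × Λ → U) → (𝒲₁ × 𝒲₂ × Λ × S → X₂) → ℝ) : ℝ :=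
  expect (fun _ => E.a) fun f => expect (fun i : 𝒲₁ × 𝒜 × Λ => E.b (f i.1)) fun g =>
    expect (fun j => E.d (f j.1) (g (cloud α j)) j.2.2.2) fun h => F f g h

lemma avg_add (F G : (𝒲₁ → X₁) → (𝒲₁ × 𝒜 × Λ → U) → (𝒲₁ × 𝒲₂ × Λ × S → X₂) → ℝ) :
    E.avg α (fun f g h => F f g h + G f g h) = E.avg α F + E.avg α G := by
  simp only [avg, expect_add]

lemma avg_const_mul (c : ℝ)
    (F : (𝒲₁ → X₁) → (𝒲₁ × 𝒜 × Λ → U) → (𝒲₁ × 𝒲₂ × Λ × S → X₂) → ℝ) :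
    E.avg α (fun f g h => c * F f g h) = c * E.avg α F := by
  simp only [avg, expect_const_mul]

lemma avg_sum {κ : Type*} (s : Finset κ)
    (F : κ → (𝒲₁ → X₁) → (𝒲₁ × 𝒜 × Λ → U) → (𝒲₁ × 𝒲₂ × Λ × S → X₂) → ℝ) :
    E.avg α (fun f g h => ∑ k ∈ s, F k f g h) = ∑ k ∈ s, E.avg α (F k) := by
  simp only [avg, expect_sum]

lemma exists_le_of_avg_le
    {F : (𝒲₁ → X₁) → (𝒲₁ × 𝒜 × Λ → U) → (𝒲₁ × 𝒲₂ × Λ × S → X₂) → ℝ} {c : ℝ}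
    (h : E.avg α F ≤ c) : ∃ f g h, F f g h ≤ c := by
  obtain ⟨f, hf⟩ := exists_le_of_expect_le _ (fun _ => E.a_mem.1) (fun _ => E.a_mem.2) h
  obtain ⟨g, hg⟩ := exists_le_of_expect_le _ (fun i => (E.b_mem _).1) (fun i => (E.b_mem _).2) hf
  obtain ⟨k, hk⟩ := exists_le_of_expect_le _ (fun j => (E.d_mem _ _ _).1)
    (fun j => (E.d_mem _ _ _).2) hg
  exact ⟨f, g, k, hk⟩

/-- The weight of state `s` and outputs `v` when the codeword with index `j` is sent. -/
def sent (j : 𝒲₁ × 𝒲₂ × Λ × S) (v : Y × Z) (f : 𝒲₁ → X₁) (g : 𝒲₁ × 𝒜 × Λ → U)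
    (h : 𝒲₁ × 𝒲₂ × Λ × S → X₂) : ℝ :=
  E.ρ (f j.1) (g (cloud α j)) j.2.2.2 * E.W (f j.1) (h j) j.2.2.2 v

/-- The codeword that is sent has the joint law of the ensemble. -/
lemma avg_sent_mul (j : 𝒲₁ × 𝒲₂ × Λ × S) (v : Y × Z) (φ : X₁ → U → X₂ → ℝ) :
    E.avg α (fun f g h => E.sent α j v f g h * φ (f j.1) (g (cloud α j)) (h j))
      = ∑ x₁, E.a x₁ * ∑ u, E.b x₁ u * ∑ x₂, E.d x₁ u j.2.2.2 x₂ *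
        (E.ρ x₁ u j.2.2.2 * (E.W x₁ x₂ j.2.2.2 v * φ x₁ u x₂)) := by
  simp only [avg, sent]
  have h1 : ∀ f : 𝒲₁ → X₁, ∀ g : 𝒲₁ × 𝒜 × Λ → U,
      expect (fun j => E.d (f j.1) (g (cloud α j)) j.2.2.2) (fun h =>
        E.ρ (f j.1) (g (cloud α j)) j.2.2.2 * E.W (f j.1) (h j) j.2.2.2 v
          * φ (f j.1) (g (cloud α j)) (h j))
      = ∑ x₂, E.d (f j.1) (g (cloud α j)) j.2.2.2 x₂ * (E.ρ (f j.1) (g (cloud α j)) j.2.2.2 *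
          (E.W (f j.1) x₂ j.2.2.2 v * φ (f j.1) (g (cloud α j)) x₂)) := by
    intro f g
    rw [expect_apply _ (fun j => (E.d_mem _ _ _).2) j fun x₂ =>
      E.ρ (f j.1) (g (cloud α j)) j.2.2.2 * E.W (f j.1) x₂ j.2.2.2 v
          * φ (f j.1) (g (cloud α j)) x₂]
    exact Finset.sum_congr rfl fun x₂ _ => by ring
  simp only [h1]
  have h2 : ∀ f : 𝒲₁ → X₁, expect (fun i : 𝒲₁ × 𝒜 × Λ => E.b (f i.1)) (fun g =>
      ∑ x₂, E.d (f j.1) (g (cloud α j)) j.2.2.2 x₂ * (E.ρ (f j.1) (g (cloud α j)) j.2.2.2 *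
          (E.W (f j.1) x₂ j.2.2.2 v * φ (f j.1) (g (cloud α j)) x₂)))
      = ∑ u, E.b (f j.1) u * ∑ x₂, E.d (f j.1) u j.2.2.2 x₂ * (E.ρ (f j.1) u j.2.2.2 *
          (E.W (f j.1) x₂ j.2.2.2 v * φ (f j.1) u x₂)) := fun f =>
    expect_apply _ (fun i => (E.b_mem _).2) (cloud α j) fun u =>
      ∑ x₂, E.d (f j.1) u j.2.2.2 x₂ * (E.ρ (f j.1) u j.2.2.2 *
          (E.W (f j.1) x₂ j.2.2.2 v * φ (f j.1) u x₂))
  simp only [h2]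
  exact expect_apply _ (fun _ => E.a_mem.2) j.1 fun x₁ =>
    ∑ u, E.b x₁ u * ∑ x₂, E.d x₁ u j.2.2.2 x₂ * (E.ρ x₁ u j.2.2.2 *
          (E.W x₁ x₂ j.2.2.2 v * φ x₁ u x₂))

/-- Averaging out the `x₂`-codeword that is sent. -/
lemma expect_sent (j : 𝒲₁ × 𝒲₂ × Λ × S) (v : Y × Z) (f : 𝒲₁ → X₁) (g : 𝒲₁ × 𝒜 × Λ → U) :
    expect (fun j => E.d (f j.1) (g (cloud α j)) j.2.2.2) (fun h => E.sent α j v f g h)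
      = E.ρ (f j.1) (g (cloud α j)) j.2.2.2
        * E.outGivenXUS (f j.1) (g (cloud α j)) j.2.2.2 v := by
  simp only [sent]
  rw [expect_const_mul, expect_apply _ (fun j => (E.d_mem _ _ _).2) j fun x₂ =>
    E.W (f j.1) x₂ j.2.2.2 v]
  rfl

/-- Averaging out the `x₂`-codeword that is sent, together with another `x₂`-codeword. -/
lemma expect_sent_mul {j j' : 𝒲₁ × 𝒲₂ × Λ × S} (hj : j' ≠ j) (v : Y × Z) (f : 𝒲₁ → X₁)
    (g : 𝒲₁ × 𝒜 × Λ → U) (φ : X₁ → U → X₂ → ℝ) :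
    expect (fun j => E.d (f j.1) (g (cloud α j)) j.2.2.2) (fun h =>
        E.sent α j v f g h * φ (f j'.1) (g (cloud α j')) (h j'))
      = E.ρ (f j.1) (g (cloud α j)) j.2.2.2
        * E.outGivenXUS (f j.1) (g (cloud α j)) j.2.2.2 v
        * ∑ x₂, E.d (f j'.1) (g (cloud α j')) j'.2.2.2 x₂ * φ (f j'.1) (g (cloud α j')) x₂ := by
  simp only [sent, mul_assoc]
  rw [expect_const_mul, expect_mul_apply _ (fun j => (E.d_mem _ _ _).2) hj
    (fun x₂ => E.W (f j.1) x₂ j.2.2.2 v) fun x₂ => φ (f j'.1) (g (cloud α j')) x₂]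
  rfl

/-- A pair `(x₁, u)` of another first message is independent of what is sent. -/
lemma avg_sent_mul_other (j : 𝒲₁ × 𝒲₂ × Λ × S) {i : 𝒲₁ × 𝒜 × Λ} (hi : i.1 ≠ j.1) (v : Y × Z)
    (φ : X₁ → U → ℝ) :
    E.avg α (fun f g h => E.sent α j v f g h * φ (f i.1) (g i))
      = E.out j.2.2.2 v * ∑ x₁, E.a x₁ * ∑ u, E.b x₁ u * φ x₁ u := by
  have hi' : i ≠ cloud α j := fun h => hi (congrArg Prod.fst h)
  have h1 : ∀ f : 𝒲₁ → X₁, ∀ g : 𝒲₁ × 𝒜 × Λ → U,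
      expect (fun j => E.d (f j.1) (g (cloud α j)) j.2.2.2)
        (fun h => E.sent α j v f g h * φ (f i.1) (g i))
      = E.ρ (f j.1) (g (cloud α j)) j.2.2.2
        * E.outGivenXUS (f j.1) (g (cloud α j)) j.2.2.2 v * φ (f i.1) (g i) := by
    intro f g
    simp only [mul_comm _ (φ (f i.1) (g i))]
    rw [expect_const_mul, expect_sent]
  have h2 : ∀ f : 𝒲₁ → X₁, expect (fun i : 𝒲₁ × 𝒜 × Λ => E.b (f i.1)) (fun g =>
      E.ρ (f j.1) (g (cloud α j)) j.2.2.2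
        * E.outGivenXUS (f j.1) (g (cloud α j)) j.2.2.2 v * φ (f i.1) (g i))
      = E.outGivenX (f j.1) j.2.2.2 v * ∑ u, E.b (f i.1) u * φ (f i.1) u := fun f =>
    expect_mul_apply _ (fun i => (E.b_mem _).2) hi'
      (fun u => E.ρ (f j.1) u j.2.2.2 * E.outGivenXUS (f j.1) u j.2.2.2 v) (φ (f i.1))
  simp only [avg, h1, h2]
  exact expect_mul_apply _ (fun _ => E.a_mem.2) hi (fun x₁ => E.outGivenX x₁ j.2.2.2 v)
    fun x₁ => ∑ u, E.b x₁ u * φ x₁ u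

/-- The codewords of another first message are independent of what is sent. -/
lemma avg_sent_mul_other₁ {j j' : 𝒲₁ × 𝒲₂ × Λ × S} (hj : j'.1 ≠ j.1) (v : Y × Z)
    (φ : X₁ → U → X₂ → ℝ) :
    E.avg α (fun f g h => E.sent α j v f g h * φ (f j'.1) (g (cloud α j')) (h j'))
      = E.out j.2.2.2 v * ∑ x₁, E.a x₁ * ∑ u, E.b x₁ u * ∑ x₂, E.d x₁ u j'.2.2.2 x₂ *
        φ x₁ u x₂ := by
  have hj' : j' ≠ j := fun h => hj (congrArg Prod.fst h)
  have hi' : cloud α j' ≠ cloud α j := fun h => hj (congrArg (fun i : 𝒲₁ × 𝒜 × Λ => i.1) h)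
  have h2 : ∀ f : 𝒲₁ → X₁, expect (fun i : 𝒲₁ × 𝒜 × Λ => E.b (f i.1)) (fun g =>
      E.ρ (f j.1) (g (cloud α j)) j.2.2.2
        * E.outGivenXUS (f j.1) (g (cloud α j)) j.2.2.2 v *
        ∑ x₂, E.d (f j'.1) (g (cloud α j')) j'.2.2.2 x₂ * φ (f j'.1) (g (cloud α j')) x₂)
      = E.outGivenX (f j.1) j.2.2.2 v * ∑ u, E.b (f j'.1) u *
        ∑ x₂, E.d (f j'.1) u j'.2.2.2 x₂ * φ (f j'.1) u x₂ := fun f =>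
    expect_mul_apply _ (fun i => (E.b_mem _).2) hi'
      (fun u => E.ρ (f j.1) u j.2.2.2 * E.outGivenXUS (f j.1) u j.2.2.2 v)
      fun u => ∑ x₂, E.d (f j'.1) u j'.2.2.2 x₂ * φ (f j'.1) u x₂
  simp only [avg, E.expect_sent_mul α hj', h2]
  exact expect_mul_apply _ (fun _ => E.a_mem.2) hj (fun x₁ => E.outGivenX x₁ j.2.2.2 v)
    fun x₁ => ∑ u, E.b x₁ u * ∑ x₂, E.d x₁ u j'.2.2.2 x₂ * φ x₁ u x₂

/-- With the same first message but another `u`-codeword, `u` and `x₂` are independent of what is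
sent given `x₁`. -/
lemma avg_sent_mul_other₂ {j j' : 𝒲₁ × 𝒲₂ × Λ × S} (hw : j'.1 = j.1)
    (hi : cloud α j' ≠ cloud α j) (v : Y × Z) (φ : X₁ → U → X₂ → ℝ) :
    E.avg α (fun f g h => E.sent α j v f g h * φ (f j'.1) (g (cloud α j')) (h j'))
      = ∑ x₁, E.a x₁ * (E.outGivenX x₁ j.2.2.2 v * ∑ u, E.b x₁ u *
        ∑ x₂, E.d x₁ u j'.2.2.2 x₂ * φ x₁ u x₂) := by
  have hj' : j' ≠ j := fun h => hi (congrArg (cloud α) h)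
  have h2 : ∀ f : 𝒲₁ → X₁, expect (fun i : 𝒲₁ × 𝒜 × Λ => E.b (f i.1)) (fun g =>
      E.ρ (f j.1) (g (cloud α j)) j.2.2.2
        * E.outGivenXUS (f j.1) (g (cloud α j)) j.2.2.2 v *
        ∑ x₂, E.d (f j'.1) (g (cloud α j')) j'.2.2.2 x₂ * φ (f j'.1) (g (cloud α j')) x₂)
      = E.outGivenX (f j.1) j.2.2.2 v * ∑ u, E.b (f j'.1) u *
        ∑ x₂, E.d (f j'.1) u j'.2.2.2 x₂ * φ (f j'.1) u x₂ := fun f =>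
    expect_mul_apply _ (fun i => (E.b_mem _).2) hi
      (fun u => E.ρ (f j.1) u j.2.2.2 * E.outGivenXUS (f j.1) u j.2.2.2 v)
      fun u => ∑ x₂, E.d (f j'.1) u j'.2.2.2 x₂ * φ (f j'.1) u x₂
  simp only [avg, E.expect_sent_mul α hj', h2]
  simp only [hw]
  exact expect_apply _ (fun _ => E.a_mem.2) j.1 fun x₁ => E.outGivenX x₁ j.2.2.2 v *
    ∑ u, E.b x₁ u * ∑ x₂, E.d x₁ u j'.2.2.2 x₂ * φ x₁ u x₂

/-- With the same `u`-codeword but another `x₂`-codeword, `x₂` is independent of what is sent given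
`(x₁, u, s)`. -/
lemma avg_sent_mul_other₃ {j j' : 𝒲₁ × 𝒲₂ × Λ × S} (hj : j' ≠ j) (hi : cloud α j' = cloud α j)
    (v : Y × Z) (φ : X₁ → U → X₂ → ℝ) :
    E.avg α (fun f g h => E.sent α j v f g h * φ (f j'.1) (g (cloud α j')) (h j'))
      = ∑ x₁, E.a x₁ * ∑ u, E.b x₁ u * (E.ρ x₁ u j.2.2.2 * E.outGivenXUS x₁ u j.2.2.2 v *
        ∑ x₂, E.d x₁ u j'.2.2.2 x₂ * φ x₁ u x₂) := by
  have hw : j'.1 = j.1 := congrArg (fun i : 𝒲₁ × 𝒜 × Λ => i.1) hi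
  have h2 : ∀ f : 𝒲₁ → X₁, expect (fun i : 𝒲₁ × 𝒜 × Λ => E.b (f i.1)) (fun g =>
      E.ρ (f j.1) (g (cloud α j)) j.2.2.2
        * E.outGivenXUS (f j.1) (g (cloud α j)) j.2.2.2 v *
        ∑ x₂, E.d (f j.1) (g (cloud α j)) j'.2.2.2 x₂ * φ (f j.1) (g (cloud α j)) x₂)
      = ∑ u, E.b (f j.1) u * (E.ρ (f j.1) u j.2.2.2 * E.outGivenXUS (f j.1) u j.2.2.2 v *
        ∑ x₂, E.d (f j.1) u j'.2.2.2 x₂ * φ (f j.1) u x₂) := fun f =>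
    expect_apply _ (fun i => (E.b_mem _).2) (cloud α j)
      fun u => E.ρ (f j.1) u j.2.2.2 * E.outGivenXUS (f j.1) u j.2.2.2 v *
        ∑ x₂, E.d (f j.1) u j'.2.2.2 x₂ * φ (f j.1) u x₂
  simp only [avg, E.expect_sent_mul α hj]
  simp only [hi, hw, h2]
  exact expect_apply _ (fun _ => E.a_mem.2) j.1 fun x₁ => ∑ u, E.b x₁ u *
    (E.ρ x₁ u j.2.2.2 * E.outGivenXUS x₁ u j.2.2.2 v *
        ∑ x₂, E.d x₁ u j'.2.2.2 x₂ * φ x₁ u x₂)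

/-- The law of the state induced by a uniformly chosen bin. -/
def inducedState (w₁ : 𝒲₁) (a : 𝒜) (f : 𝒲₁ → X₁) (g : 𝒲₁ × 𝒜 × Λ → U) (s : S) : ℝ :=
  (∑ ℓ : Λ, E.ρ (f w₁) (g (w₁, a, ℓ)) s) / Fintype.card Λ

/-- Soft covering: the induced law of the state is close to the law of the state. The backward law
is truncated at `θ σ`, and the fluctuation of the truncated sum is bounded by its variance. -/
lemma expect_max_sub_inducedState_le [Nonempty Λ] (w₁ : 𝒲₁) (a : 𝒜) (f : 𝒲₁ → X₁) (s : S)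
    {θ δ : ℝ} (hθ : 0 < θ) (hδ : 0 < δ) :
    expect (fun i : 𝒲₁ × 𝒜 × Λ => E.b (f i.1))
      (fun g => max (E.σ s - E.inducedState w₁ a f g s) 0)
    ≤ ∑ u, E.b (f w₁) u * (E.ρ (f w₁) u s * ind (θ * E.σ s < E.ρ (f w₁) u s))
      + E.σ s * (δ + θ / (Fintype.card Λ * δ)) := by
  set L : ℝ := (Fintype.card Λ : ℝ) with hL
  have hL0 : 0 < L := by rw [hL]; exact_mod_cast Fintype.card_pos
  have hσ := E.σ_mem.1 s
  set x := f w₁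
  let r : U → ℝ := fun u => E.ρ x u s * ind (E.ρ x u s ≤ θ * E.σ s)
  have hr0 : ∀ u, 0 ≤ r u := fun u => mul_nonneg (E.ρ_nonneg _ _ _) (ind_nonneg _)
  have hrρ : ∀ u, r u ≤ E.ρ x u s := fun u =>
    mul_le_of_le_one_right (E.ρ_nonneg _ _ _) (ind_le_one _)
  let m : ℝ := ∑ u, E.b x u * r u
  have hm0 : 0 ≤ m := Finset.sum_nonneg fun u _ => mul_nonneg ((E.b_mem _).1 _) (hr0 u)
  have htail : E.σ s - m = ∑ u, E.b x u * (E.ρ x u s * ind (θ * E.σ s < E.ρ x u s)) := by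
    have hσs := E.sum_b_ρ x s
    calc E.σ s - m = ∑ u, (E.b x u * E.ρ x u s - E.b x u * r u) := by
          rw [Finset.sum_sub_distrib, hσs]
      _ = _ := ?_
    refine Finset.sum_congr rfl fun u _ => ?_
    simp only [r]
    by_cases h : E.ρ x u s ≤ θ * E.σ s
    · rw [ind_of_true h, ind_of_false (not_lt.2 h)]; ring
    · rw [ind_of_false h, ind_of_true (not_le.1 h)]; ring
  have hmσ : m ≤ E.σ s := by
    rw [← E.sum_b_ρ x s]
    exact Finset.sum_le_sum fun u _ => mul_le_mul_of_nonneg_left (hrρ u) ((E.b_mem _).1 _)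
  let G : 𝒲₁ × 𝒜 × Λ → U → ℝ := fun i u => if i.1 = w₁ ∧ i.2.1 = a then (r u - m) / L else 0
  have hG : ∀ g : 𝒲₁ × 𝒜 × Λ → U, ∑ i, G i (g i) = (∑ ℓ, r (g (w₁, a, ℓ))) / L - m := by
    intro g
    simp only [G, Fintype.sum_prod_type]
    rw [Finset.sum_eq_single w₁ (by intro b _ hb; simp [hb]) (by simp),
      Finset.sum_eq_single a (by intro b _ hb; simp [hb]) (by simp)]
    simp only [and_self, if_true]
    rw [← Finset.sum_div, Finset.sum_sub_distrib, sub_div]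
    simp only [Finset.sum_const, Finset.card_univ, nsmul_eq_mul, ← hL]
    rw [mul_div_cancel_left₀ _ hL0.ne']
  have hG0 : ∀ i : 𝒲₁ × 𝒜 × Λ, ∑ u, E.b (f i.1) u * G i u = 0 := by
    intro i
    by_cases hi : i.1 = w₁ ∧ i.2.1 = a
    · simp only [G, hi, and_self, if_true]
      change ∑ u, E.b x u * ((r u - m) / L) = 0
      simp only [← mul_div_assoc, ← Finset.sum_div, mul_sub, Finset.sum_sub_distrib,
        ← Finset.sum_mul, (E.b_mem x).2, one_mul]
      simp [m]
    · simp [G, hi]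
  have hpt : ∀ g : 𝒲₁ × 𝒜 × Λ → U, max (E.σ s - E.inducedState w₁ a f g s) 0
      ≤ (E.σ s - m + δ * E.σ s) + 1 / (δ * E.σ s) * (∑ i, G i (g i)) ^ 2 := by
    intro g
    rw [hG]
    have hq : (∑ ℓ, r (g (w₁, a, ℓ))) / L ≤ E.inducedState w₁ a f g s :=
      div_le_div_of_nonneg_right (Finset.sum_le_sum fun ℓ _ => hrρ _) hL0.le
    have hq0 : 0 ≤ (∑ ℓ, r (g (w₁, a, ℓ))) / L :=
      div_nonneg (Finset.sum_nonneg fun ℓ _ => hr0 _) hL0.le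
    set q := (∑ ℓ, r (g (w₁, a, ℓ))) / L
    have h4 : 0 ≤ 1 / (δ * E.σ s) * (q - m) ^ 2 := by positivity
    rcases hσ.eq_or_lt with h0 | h0
    · rw [max_eq_right (by rw [← h0]; linarith)]
      rw [← h0] at hmσ ⊢
      simp
      linarith
    · refine max_le ?_ (by nlinarith [mul_pos hδ h0])
      suffices h : m - q ≤ δ * E.σ s + 1 / (δ * E.σ s) * (q - m) ^ 2 by linarith
      have hp := mul_pos hδ h0
      rw [one_div, inv_mul_eq_div]
      by_cases hc : m - q ≤ δ * E.σ s
      · have : 0 ≤ (q - m) ^ 2 / (δ * E.σ s) := by positivity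
        linarith
      · have : m - q ≤ (q - m) ^ 2 / (δ * E.σ s) := by
          rw [le_div_iff₀ hp]; nlinarith
        linarith
  have hvar : expect (fun i : 𝒲₁ × 𝒜 × Λ => E.b (f i.1)) (fun g => (∑ i, G i (g i)) ^ 2)
      ≤ θ * E.σ s ^ 2 / L := by
    rw [expect_sq_sum _ (fun i => (E.b_mem _).2) G hG0]
    have h5 : ∑ i : 𝒲₁ × 𝒜 × Λ, ∑ u, E.b (f i.1) u * G i u ^ 2
        = L * ∑ u, E.b x u * ((r u - m) / L) ^ 2 := by
      simp only [G, Fintype.sum_prod_type]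
      rw [Finset.sum_eq_single w₁ (by intro b _ hb; simp [hb]) (by simp),
        Finset.sum_eq_single a (by intro b _ hb; simp [hb]) (by simp)]
      simp [hL, x]
    rw [h5, le_div_iff₀ hL0]
    calc L * (∑ u, E.b x u * ((r u - m) / L) ^ 2) * L
        = ∑ u, E.b x u * (r u - m) ^ 2 := by
          rw [mul_comm L, mul_assoc, Finset.sum_mul]
          refine Finset.sum_congr rfl fun u _ => ?_
          field_simp
      _ = ∑ u, E.b x u * r u ^ 2 - m ^ 2 := by
          have : ∀ u, E.b x u * (r u - m) ^ 2
              = E.b x u * r u ^ 2 - 2 * m * (E.b x u * r u) + m ^ 2 * E.b x u := fun u => by ring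
          simp only [this, Finset.sum_add_distrib, Finset.sum_sub_distrib, ← Finset.mul_sum,
            (E.b_mem x).2]
          change _ - 2 * m * m + _ = _
          ring
      _ ≤ ∑ u, E.b x u * (E.ρ x u s * (θ * E.σ s)) := by
          have : ∑ u, E.b x u * r u ^ 2 ≤ ∑ u, E.b x u * (E.ρ x u s * (θ * E.σ s)) := by
            refine Finset.sum_le_sum fun u _ => mul_le_mul_of_nonneg_left ?_ ((E.b_mem _).1 _)
            rw [sq]
            refine mul_le_mul (hrρ u) ?_ (hr0 u) (E.ρ_nonneg _ _ _)
            simp only [r]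
            by_cases h : E.ρ x u s ≤ θ * E.σ s
            · rw [ind_of_true h, mul_one]; exact h
            · rw [ind_of_false h, mul_zero]; positivity
          nlinarith [sq_nonneg m]
      _ = θ * E.σ s ^ 2 := by
          simp only [← mul_assoc, ← Finset.sum_mul, E.sum_b_ρ]; ring
  have hlast : 1 / (δ * E.σ s) * expect (fun i : 𝒲₁ × 𝒜 × Λ => E.b (f i.1))
      (fun g => (∑ i, G i (g i)) ^ 2) ≤ E.σ s * (θ / (L * δ)) := by
    refine (mul_le_mul_of_nonneg_left hvar (by positivity)).trans_eq ?_
    rcases hσ.eq_or_lt with h0 | h0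
    · rw [← h0]; simp
    · field_simp
  refine (expect_mono _ (fun i => (E.b_mem _).1) hpt).trans ?_
  rw [expect_add, expect_const _ (fun i => (E.b_mem _).2), expect_const_mul, ← htail]
  linarith

end Ensemble

/-! ### The one-shot coding theorem -/

/-- Decoding by a test: an error requires that the true message fails the test or that a wrong one
passes it. -/
lemma exists_decoder {𝒲 O : Type*} [Nonempty 𝒲] (T : 𝒲 → O → Prop) :
    ∃ dec : O → 𝒲, ∀ o w, dec o ≠ w → ¬ T w o ∨ ∃ w', w' ≠ w ∧ T w' o := by
  classical
  refine ⟨fun o => if h : ∃ w, T w o then h.choose else Classical.arbitrary 𝒲, fun o w hw => ?_⟩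
  by_cases hT : T w o
  · have h : ∃ w, T w o := ⟨w, hT⟩
    simp only [h, dif_pos] at hw
    exact Or.inr ⟨h.choose, hw, h.choose_spec⟩
  · exact Or.inl hT

namespace Ensemble

variable {X₁ U S X₂ Y Z : Type*} [Fintype X₁] [Fintype U] [Fintype S] [Fintype X₂]
    [Fintype Y] [Fintype Z] (E : Ensemble X₁ U S X₂ Y Z)
  {𝒲₁ 𝒲₂ 𝒜 Λ : Type*} [Fintype 𝒲₁] [Fintype 𝒲₂] [Fintype 𝒜] [Fintype Λ] [DecidableEq 𝒲₁]
  [DecidableEq 𝒲₂] [DecidableEq 𝒜] [DecidableEq Λ] [DecidableEq S] (α : 𝒲₂ → 𝒜)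

lemma sent_nonneg (j : 𝒲₁ × 𝒲₂ × Λ × S) (v : Y × Z) (f : 𝒲₁ → X₁) (g : 𝒲₁ × 𝒜 × Λ → U)
    (h : 𝒲₁ × 𝒲₂ × Λ × S → X₂) : 0 ≤ E.sent α j v f g h :=
  mul_nonneg (E.ρ_nonneg _ _ _) ((E.W_mem _ _ _).1 _)

/-- The indices of the codewords `(w₁, a, ℓ)` with a wrong first message. -/
def wrongClouds (𝒜 Λ : Type*) [Fintype 𝒜] [Fintype Λ] (w₁ : 𝒲₁) : Finset (𝒲₁ × 𝒜 × Λ) :=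
  (Finset.univ.erase w₁) ×ˢ Finset.univ

/-- The indices of the `x₂`-codewords that carry the true first message and a wrong second
message, and whose `u`-codeword is not the one that is sent. -/
def wrongSatellites (w₂ : 𝒲₂) (ℓ : Λ) : Finset (𝒲₂ × Λ) :=
  ((Finset.univ.erase w₂) ×ˢ Finset.univ).filter fun k => ¬ (α k.1 = α w₂ ∧ k.2 = ℓ)

/-- The wrong second messages that share the `u`-codeword that is sent. -/
def siblings (w₂ : 𝒲₂) : Finset 𝒲₂ := (Finset.univ.erase w₂).filter fun k => α k = α w₂

lemma card_wrongClouds (w₁ : 𝒲₁) : ((wrongClouds 𝒜 Λ w₁).card : ℝ)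
    = (Fintype.card 𝒲₁ - 1) * Fintype.card 𝒜 * Fintype.card Λ := by
  rw [wrongClouds, Finset.card_product, Finset.card_erase_of_mem (Finset.mem_univ _),
    Finset.card_univ, Finset.card_univ, Fintype.card_prod, Nat.cast_mul,
    Nat.cast_sub (Fintype.card_pos_iff.2 ⟨w₁⟩)]
  push_cast
  ring

lemma card_wrongSatellites_le (w₂ : 𝒲₂) (ℓ : Λ) : ((wrongSatellites α w₂ ℓ).card : ℝ)
    ≤ (Fintype.card 𝒲₂ - 1) * Fintype.card Λ := by
  have h : (wrongSatellites α w₂ ℓ).card ≤ (Fintype.card 𝒲₂ - 1) * Fintype.card Λ := by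
    refine (Finset.card_filter_le _ _).trans_eq ?_
    rw [Finset.card_product, Finset.card_erase_of_mem (Finset.mem_univ _), Finset.card_univ,
      Finset.card_univ]
  refine (Nat.cast_le.2 h).trans_eq ?_
  rw [Nat.cast_mul, Nat.cast_sub (Fintype.card_pos_iff.2 ⟨w₂⟩), Nat.cast_one]

/-- The union bound on the event that one of the receivers errs when the codeword `(w₁, w₂, ℓ, s)`
is sent. -/
def unionBound (θY θC θB θD : ℝ) (w₁ : 𝒲₁) (w₂ : 𝒲₂) (ℓ : Λ) (s : S) (v : Y × Z)
    (f : 𝒲₁ → X₁) (g : 𝒲₁ × 𝒜 × Λ → U) (h : 𝒲₁ × 𝒲₂ × Λ × S → X₂) : ℝ :=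
  ind (¬ E.testY θY (f w₁) (g (w₁, α w₂, ℓ)) v.1)
    + ind (¬ E.testXUX θC (f w₁) (g (w₁, α w₂, ℓ)) (h (w₁, w₂, ℓ, s)) s v.2)
    + ind (¬ E.testUX θB (f w₁) (g (w₁, α w₂, ℓ)) (h (w₁, w₂, ℓ, s)) s v.2)
    + ind (¬ E.testX θD (f w₁) (g (w₁, α w₂, ℓ)) (h (w₁, w₂, ℓ, s)) s v.2)
    + ∑ i ∈ wrongClouds 𝒜 Λ w₁, ind (E.testY θY (f i.1) (g i) v.1)
    + ∑ i ∈ wrongClouds 𝒲₂ Λ w₁, ind (E.testXUX θC (f i.1) (g (i.1, α i.2.1, i.2.2))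
        (h (i.1, i.2.1, i.2.2, s)) s v.2)
    + ∑ k ∈ wrongSatellites α w₂ ℓ, ind (E.testUX θB (f w₁) (g (w₁, α k.1, k.2))
        (h (w₁, k.1, k.2, s)) s v.2)
    + ∑ k ∈ siblings α w₂, ind (E.testX θD (f w₁) (g (w₁, α k, ℓ)) (h (w₁, k, ℓ, s)) s v.2)

lemma sum_avg_sent_mul (w₁ : 𝒲₁) (w₂ : 𝒲₂) (ℓ : Λ) (φ : X₁ → U → S → X₂ → Y × Z → ℝ) :
    ∑ s, ∑ v, E.avg α (fun f g h => E.sent α (w₁, w₂, ℓ, s) v f g h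
      * φ (f w₁) (g (w₁, α w₂, ℓ)) s (h (w₁, w₂, ℓ, s)) v) = E.mean φ :=
  Finset.sum_congr rfl fun s _ => Finset.sum_congr rfl fun v _ =>
    E.avg_sent_mul α (w₁, w₂, ℓ, s) v fun x₁ u x₂ => φ x₁ u s x₂ v

lemma sum_avg_sent_mul_testY_le {θ : ℝ} (hθ : 0 < θ) (w₁ : 𝒲₁) (w₂ : 𝒲₂) (ℓ : Λ) :
    ∑ s, ∑ v, E.avg α (fun f g h => E.sent α (w₁, w₂, ℓ, s) v f g h
      * ∑ i ∈ wrongClouds 𝒜 Λ w₁, ind (E.testY θ (f i.1) (g i) v.1))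
    ≤ (Fintype.card 𝒲₁ - 1) * Fintype.card 𝒜 * Fintype.card Λ / θ := by
  have h1 : ∀ s v, E.avg α (fun f g h => E.sent α (w₁, w₂, ℓ, s) v f g h
      * ∑ i ∈ wrongClouds 𝒜 Λ w₁, ind (E.testY θ (f i.1) (g i) v.1))
      = (wrongClouds 𝒜 Λ w₁).card * (E.out s v * ∑ x₁, E.a x₁ * ∑ u, E.b x₁ u *
        ind (E.testY θ x₁ u v.1)) := by
    intro s v
    simp only [Finset.mul_sum (s := wrongClouds 𝒜 Λ w₁)]
    rw [avg_sum, ← nsmul_eq_mul, ← Finset.sum_const]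
    refine Finset.sum_congr rfl fun i hi => ?_
    exact E.avg_sent_mul_other α (w₁, w₂, ℓ, s)
      (Finset.ne_of_mem_erase (Finset.mem_product.1 hi).1) v
      fun x₁ u => ind (E.testY θ x₁ u v.1)
  simp only [h1]
  simp only [← Finset.mul_sum (a := ((wrongClouds 𝒜 Λ w₁).card : ℝ))]
  rw [card_wrongClouds, div_eq_mul_one_div]
  refine mul_le_mul_of_nonneg_left (E.sum_testY_le hθ) ?_
  rw [← card_wrongClouds w₁]
  positivity

lemma sum_avg_sent_mul_testXUX_le {θ : ℝ} (hθ : 0 < θ) (w₁ : 𝒲₁) (w₂ : 𝒲₂) (ℓ : Λ) :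
    ∑ s, ∑ v, E.avg α (fun f g h => E.sent α (w₁, w₂, ℓ, s) v f g h
      * ∑ i ∈ wrongClouds 𝒲₂ Λ w₁, ind (E.testXUX θ (f i.1) (g (i.1, α i.2.1, i.2.2))
        (h (i.1, i.2.1, i.2.2, s)) s v.2))
    ≤ (Fintype.card 𝒲₁ - 1) * Fintype.card 𝒲₂ * Fintype.card Λ / θ := by
  have h1 : ∀ s v, E.avg α (fun f g h => E.sent α (w₁, w₂, ℓ, s) v f g h
      * ∑ i ∈ wrongClouds 𝒲₂ Λ w₁, ind (E.testXUX θ (f i.1) (g (i.1, α i.2.1, i.2.2))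
        (h (i.1, i.2.1, i.2.2, s)) s v.2))
      = (wrongClouds 𝒲₂ Λ w₁).card * (E.out s v * ∑ x₁, E.a x₁ * ∑ u, E.b x₁ u *
        ∑ x₂, E.d x₁ u s x₂ * ind (E.testXUX θ x₁ u x₂ s v.2)) := by
    intro s v
    simp only [Finset.mul_sum (s := wrongClouds 𝒲₂ Λ w₁)]
    rw [avg_sum, ← nsmul_eq_mul, ← Finset.sum_const]
    exact Finset.sum_congr rfl fun i hi =>
      E.avg_sent_mul_other₁ α (j := (w₁, w₂, ℓ, s)) (j' := (i.1, i.2.1, i.2.2, s))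
      (Finset.ne_of_mem_erase (Finset.mem_product.1 hi).1) v
      fun x₁ u x₂ => ind (E.testXUX θ x₁ u x₂ s v.2)
  simp only [h1]
  simp only [← Finset.mul_sum (a := ((wrongClouds 𝒲₂ Λ w₁).card : ℝ))]
  rw [card_wrongClouds, div_eq_mul_one_div]
  refine mul_le_mul_of_nonneg_left (E.sum_testXUX_le hθ) ?_
  rw [← card_wrongClouds w₁]
  positivity

lemma sum_avg_sent_mul_testUX_le {θ : ℝ} (hθ : 0 < θ) (w₁ : 𝒲₁) (w₂ : 𝒲₂) (ℓ : Λ) :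
    ∑ s, ∑ v, E.avg α (fun f g h => E.sent α (w₁, w₂, ℓ, s) v f g h
      * ∑ k ∈ wrongSatellites α w₂ ℓ, ind (E.testUX θ (f w₁) (g (w₁, α k.1, k.2))
        (h (w₁, k.1, k.2, s)) s v.2))
    ≤ (Fintype.card 𝒲₂ - 1) * Fintype.card Λ / θ := by
  have h1 : ∀ s v, E.avg α (fun f g h => E.sent α (w₁, w₂, ℓ, s) v f g h
      * ∑ k ∈ wrongSatellites α w₂ ℓ, ind (E.testUX θ (f w₁) (g (w₁, α k.1, k.2))
        (h (w₁, k.1, k.2, s)) s v.2))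
      = (wrongSatellites α w₂ ℓ).card * (∑ x₁, E.a x₁ * (E.outGivenX x₁ s v * ∑ u, E.b x₁ u *
        ∑ x₂, E.d x₁ u s x₂ * ind (E.testUX θ x₁ u x₂ s v.2))) := by
    intro s v
    simp only [Finset.mul_sum (s := wrongSatellites α w₂ ℓ)]
    rw [avg_sum, ← nsmul_eq_mul, ← Finset.sum_const]
    refine Finset.sum_congr rfl fun k hk => ?_
    have hk' := (Finset.mem_filter.1 hk).2
    refine E.avg_sent_mul_other₂ α (j := (w₁, w₂, ℓ, s)) (j' := (w₁, k.1, k.2, s)) rfl ?_ v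
      fun x₁ u x₂ => ind (E.testUX θ x₁ u x₂ s v.2)
    intro h
    simp only [cloud, Prod.mk.injEq, true_and] at h
    exact hk' h
  simp only [h1]
  simp only [← Finset.mul_sum (a := ((wrongSatellites α w₂ ℓ).card : ℝ))]
  rw [div_eq_mul_one_div]
  exact mul_le_mul (card_wrongSatellites_le α w₂ ℓ) (E.sum_testUX_le hθ)
    (Finset.sum_nonneg fun s _ => Finset.sum_nonneg fun v _ => Finset.sum_nonneg fun x₁ _ =>
      mul_nonneg (E.a_mem.1 _) (mul_nonneg (Finset.sum_nonneg fun u _ =>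
        mul_nonneg ((E.b_mem _).1 _) (mul_nonneg (E.ρ_nonneg _ _ _) (E.outGivenXUS_nonneg _ _ _ _)))
        (Finset.sum_nonneg fun u _ => mul_nonneg ((E.b_mem _).1 _) (Finset.sum_nonneg fun x₂ _ =>
          mul_nonneg ((E.d_mem _ _ _).1 _) (ind_nonneg _)))))
    ((Nat.cast_nonneg _).trans (card_wrongSatellites_le α w₂ ℓ))

lemma sum_avg_sent_mul_testX_le {θ : ℝ} (hθ : 0 < θ) (w₁ : 𝒲₁) (w₂ : 𝒲₂) (ℓ : Λ) {K : ℝ}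
    (hK : ((siblings α w₂).card : ℝ) ≤ K) :
    ∑ s, ∑ v, E.avg α (fun f g h => E.sent α (w₁, w₂, ℓ, s) v f g h
      * ∑ k ∈ siblings α w₂, ind (E.testX θ (f w₁) (g (w₁, α k, ℓ)) (h (w₁, k, ℓ, s)) s v.2))
    ≤ K / θ := by
  have h1 : ∀ s v, E.avg α (fun f g h => E.sent α (w₁, w₂, ℓ, s) v f g h
      * ∑ k ∈ siblings α w₂, ind (E.testX θ (f w₁) (g (w₁, α k, ℓ)) (h (w₁, k, ℓ, s)) s v.2))
      = (siblings α w₂).card * (∑ x₁, E.a x₁ * ∑ u, E.b x₁ u * (E.ρ x₁ u s *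
        E.outGivenXUS x₁ u s v * ∑ x₂, E.d x₁ u s x₂ * ind (E.testX θ x₁ u x₂ s v.2))) := by
    intro s v
    simp only [Finset.mul_sum (s := siblings α w₂)]
    rw [avg_sum, ← nsmul_eq_mul, ← Finset.sum_const]
    refine Finset.sum_congr rfl fun k hk => ?_
    have hk' := Finset.mem_filter.1 hk
    refine E.avg_sent_mul_other₃ α (j := (w₁, w₂, ℓ, s)) (j' := (w₁, k, ℓ, s)) ?_ ?_ v
      fun x₁ u x₂ => ind (E.testX θ x₁ u x₂ s v.2)
    · intro h
      simp only [Prod.mk.injEq, true_and, and_true] at h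
      exact Finset.ne_of_mem_erase hk'.1 h
    · simp only [cloud, hk'.2]
  simp only [h1]
  simp only [← Finset.mul_sum (a := ((siblings α w₂).card : ℝ))]
  rw [div_eq_mul_one_div]
  exact mul_le_mul hK (E.sum_testX_le hθ)
    (Finset.sum_nonneg fun s _ => Finset.sum_nonneg fun v _ => Finset.sum_nonneg fun x₁ _ =>
      mul_nonneg (E.a_mem.1 _) (Finset.sum_nonneg fun u _ => mul_nonneg ((E.b_mem _).1 _)
        (mul_nonneg (mul_nonneg (E.ρ_nonneg _ _ _) (E.outGivenXUS_nonneg _ _ _ _))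
        (Finset.sum_nonneg fun x₂ _ => mul_nonneg ((E.d_mem _ _ _).1 _) (ind_nonneg _)))))
    ((Nat.cast_nonneg _).trans hK)

/-- The random coding bound: the probability that the codeword that is sent fails a test, and the
expected number of wrong codewords that pass. Here `M₁` and `M₂` count the messages, `Ma` the parts
of the second message that `u` can carry, `L` the members of a bin, and `K` bounds the number of
wrong second messages with the same `u`. -/
def codingBound (M₁ M₂ Ma K L θY θC θB θD : ℝ) : ℝ :=
  E.mean (fun x₁ u _ _ v => ind (¬ E.testY θY x₁ u v.1))
    + E.mean (fun x₁ u s x₂ v => ind (¬ E.testXUX θC x₁ u x₂ s v.2))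
    + E.mean (fun x₁ u s x₂ v => ind (¬ E.testUX θB x₁ u x₂ s v.2))
    + E.mean (fun x₁ u s x₂ v => ind (¬ E.testX θD x₁ u x₂ s v.2))
    + (M₁ - 1) * Ma * L / θY + (M₁ - 1) * M₂ * L / θC + (M₂ - 1) * L / θB + K / θD

lemma sum_avg_sent_mul_unionBound_le {θY θC θB θD : ℝ} (hY : 0 < θY) (hC : 0 < θC) (hB : 0 < θB)
    (hD : 0 < θD) (w₁ : 𝒲₁) (w₂ : 𝒲₂) (ℓ : Λ) {K : ℝ} (hK : ((siblings α w₂).card : ℝ) ≤ K) :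
    ∑ s, ∑ v, E.avg α (fun f g h => E.sent α (w₁, w₂, ℓ, s) v f g h
      * E.unionBound α θY θC θB θD w₁ w₂ ℓ s v f g h)
    ≤ E.codingBound (Fintype.card 𝒲₁) (Fintype.card 𝒲₂) (Fintype.card 𝒜) K (Fintype.card Λ)
        θY θC θB θD := by
  simp only [unionBound, mul_add, avg_add, Finset.sum_add_distrib]
  unfold codingBound
  refine add_le_add (add_le_add (add_le_add (add_le_add (add_le_add (add_le_add (add_le_add
    ?_ ?_) ?_) ?_) (E.sum_avg_sent_mul_testY_le α hY w₁ w₂ ℓ))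
    (E.sum_avg_sent_mul_testXUX_le α hC w₁ w₂ ℓ)) (E.sum_avg_sent_mul_testUX_le α hB w₁ w₂ ℓ))
    (E.sum_avg_sent_mul_testX_le α hD w₁ w₂ ℓ hK)
  · exact (E.sum_avg_sent_mul α w₁ w₂ ℓ fun x₁ u _ _ v => ind (¬ E.testY θY x₁ u v.1)).le
  · exact (E.sum_avg_sent_mul α w₁ w₂ ℓ
      fun x₁ u s x₂ v => ind (¬ E.testXUX θC x₁ u x₂ s v.2)).le
  · exact (E.sum_avg_sent_mul α w₁ w₂ ℓ
      fun x₁ u s x₂ v => ind (¬ E.testUX θB x₁ u x₂ s v.2)).le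
  · exact (E.sum_avg_sent_mul α w₁ w₂ ℓ
      fun x₁ u s x₂ v => ind (¬ E.testX θD x₁ u x₂ s v.2)).le

/-- The probability that the backward law exceeds `θ` times the law of the state. -/
def tailProb (θ : ℝ) : ℝ :=
  ∑ x₁, E.a x₁ * ∑ s, ∑ u, E.b x₁ u * (E.ρ x₁ u s * ind (θ * E.σ s < E.ρ x₁ u s))

lemma sum_avg_max_sub_inducedState_le [Nonempty Λ] (w₁ : 𝒲₁) (a : 𝒜)
    {θ δ : ℝ} (hθ : 0 < θ) (hδ : 0 < δ) :
    ∑ s, E.avg α (fun f g (_ : 𝒲₁ × 𝒲₂ × Λ × S → X₂) =>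
      max (E.σ s - E.inducedState w₁ a f g s) 0)
    ≤ E.tailProb θ + (δ + θ / (Fintype.card Λ * δ)) := by
  have h1 : ∀ s, E.avg α (fun f g (_ : 𝒲₁ × 𝒲₂ × Λ × S → X₂) =>
      max (E.σ s - E.inducedState w₁ a f g s) 0)
      ≤ ∑ x₁, E.a x₁ * ∑ u, E.b x₁ u * (E.ρ x₁ u s * ind (θ * E.σ s < E.ρ x₁ u s))
        + E.σ s * (δ + θ / (Fintype.card Λ * δ)) := by
    intro s
    have hc : ∀ (f : 𝒲₁ → X₁) (g : 𝒲₁ × 𝒜 × Λ → U) (c : ℝ),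
        expect (fun j : 𝒲₁ × 𝒲₂ × Λ × S => E.d (f j.1) (g (cloud α j)) j.2.2.2) (fun _ => c) = c :=
      fun f g c => expect_const _ (fun j => (E.d_mem _ _ _).2) c
    simp only [avg, hc]
    refine (expect_mono _ (fun _ => E.a_mem.1) fun f =>
      E.expect_max_sub_inducedState_le w₁ a f s hθ hδ).trans_eq ?_
    rw [expect_add, expect_const _ fun _ => E.a_mem.2]
    congr 1
    exact expect_apply _ (fun _ => E.a_mem.2) w₁ fun x₁ =>
      ∑ u, E.b x₁ u * (E.ρ x₁ u s * ind (θ * E.σ s < E.ρ x₁ u s))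
  refine (Finset.sum_le_sum fun s _ => h1 s).trans_eq ?_
  rw [Finset.sum_add_distrib, ← Finset.sum_mul, E.σ_mem.2, one_mul, tailProb, Finset.sum_comm]
  simp only [Finset.mul_sum]

/-- The one-shot coding theorem. Given both messages and the state, encoder 2 picks the member `ℓ`
of the bin with the smallest conditional error probability; this does as well as a random member
drawn from the backward law, up to the distance between the law of the state and the law induced by
a uniformly chosen member of the bin. -/
theorem exists_code [Nonempty 𝒲₁] [Nonempty 𝒲₂] [Nonempty Λ] {θY θC θB θD θ δ K : ℝ}
    (hY : 0 < θY) (hC : 0 < θC) (hB : 0 < θB) (hD : 0 < θD) (hθ : 0 < θ) (hδ : 0 < δ)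
    (hK : ∀ w₂, ((siblings α w₂).card : ℝ) ≤ K) :
    ∃ (enc₁ : 𝒲₁ → X₁) (enc₂ : 𝒲₁ → 𝒲₂ → S → X₂) (dec₁ : Y → 𝒲₁) (dec₂ : Z → S → 𝒲₁ × 𝒲₂),
      ∑ w₁, ∑ w₂, ∑ s, E.σ s * ∑ v, E.W (enc₁ w₁) (enc₂ w₁ w₂ s) s v *
        ind (¬ (dec₁ v.1 = w₁ ∧ dec₂ v.2 s = (w₁, w₂)))
      ≤ Fintype.card 𝒲₁ * (Fintype.card 𝒲₂ *
        (E.codingBound (Fintype.card 𝒲₁) (Fintype.card 𝒲₂) (Fintype.card 𝒜) K (Fintype.card Λ)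
          θY θC θB θD + (E.tailProb θ + (δ + θ / (Fintype.card Λ * δ))))) := by
  set L : ℝ := (Fintype.card Λ : ℝ) with hL
  have hL0 : 0 < L := by rw [hL]; exact_mod_cast Fintype.card_pos
  set T := E.codingBound (Fintype.card 𝒲₁) (Fintype.card 𝒲₂) (Fintype.card 𝒜) K L θY θC θB θD
  have havg : E.avg α (fun f g h => ∑ w₁ : 𝒲₁, ∑ w₂ : 𝒲₂, ∑ s,
      (max (E.σ s - E.inducedState w₁ (α w₂) f g s) 0 + ∑ ℓ : Λ, ∑ v, 1 / L *
        (E.sent α (w₁, w₂, ℓ, s) v f g h * E.unionBound α θY θC θB θD w₁ w₂ ℓ s v f g h)))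
      ≤ Fintype.card 𝒲₁ * (Fintype.card 𝒲₂ *
        (T + (E.tailProb θ + (δ + θ / (L * δ))))) := by
    simp only [avg_sum, avg_add, avg_const_mul, Finset.sum_add_distrib (s := Finset.univ (α := S))]
    have h1 : ∀ w₁ : 𝒲₁, ∀ w₂ : 𝒲₂,
        ∑ s, E.avg α (fun f g (_ : 𝒲₁ × 𝒲₂ × Λ × S → X₂) =>
          max (E.σ s - E.inducedState w₁ (α w₂) f g s) 0)
        + ∑ s, ∑ ℓ : Λ, ∑ v, 1 / L * E.avg α (fun f g h => E.sent α (w₁, w₂, ℓ, s) v f g h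
            * E.unionBound α θY θC θB θD w₁ w₂ ℓ s v f g h)
        ≤ T + (E.tailProb θ + (δ + θ / (L * δ))) := by
      intro w₁ w₂
      rw [add_comm]
      refine add_le_add ?_ (E.sum_avg_max_sub_inducedState_le α w₁ (α w₂) hθ hδ)
      rw [Finset.sum_comm]
      simp only [← Finset.mul_sum]
      rw [one_div, inv_mul_le_iff₀ hL0]
      refine (Finset.sum_le_sum fun ℓ _ =>
        E.sum_avg_sent_mul_unionBound_le α hY hC hB hD w₁ w₂ ℓ (hK w₂)).trans_eq ?_
      rw [Finset.sum_const, nsmul_eq_mul, Finset.card_univ]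
    refine (Finset.sum_le_sum fun w₁ _ => Finset.sum_le_sum fun w₂ _ => h1 w₁ w₂).trans_eq ?_
    simp only [Finset.sum_const, nsmul_eq_mul, Finset.card_univ]
  obtain ⟨f, g, h, hfgh⟩ := E.exists_le_of_avg_le α havg
  obtain ⟨dec₁, hdec₁⟩ := exists_decoder fun (w₁ : 𝒲₁) (y : Y) =>
    ∃ a ℓ, E.testY θY (f w₁) (g (w₁, a, ℓ)) y
  obtain ⟨dec₂, hdec₂⟩ := exists_decoder fun (w : 𝒲₁ × 𝒲₂) (o : Z × S) => ∃ ℓ,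
    E.testXUX θC (f w.1) (g (w.1, α w.2, ℓ)) (h (w.1, w.2, ℓ, o.2)) o.2 o.1 ∧
    E.testUX θB (f w.1) (g (w.1, α w.2, ℓ)) (h (w.1, w.2, ℓ, o.2)) o.2 o.1 ∧
    E.testX θD (f w.1) (g (w.1, α w.2, ℓ)) (h (w.1, w.2, ℓ, o.2)) o.2 o.1
  let e : 𝒲₁ → 𝒲₂ → S → Λ → ℝ := fun w₁ w₂ s ℓ => ∑ v, E.W (f w₁) (h (w₁, w₂, ℓ, s)) s v *
    ind (¬ (dec₁ v.1 = w₁ ∧ dec₂ (v.2, s) = (w₁, w₂)))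
  have hmin : ∀ w₁ w₂ s, ∃ ℓ, ∀ ℓ', e w₁ w₂ s ℓ ≤ e w₁ w₂ s ℓ' := fun w₁ w₂ s =>
    Finite.exists_min (e w₁ w₂ s)
  choose pick hpick using hmin
  refine ⟨f, fun w₁ w₂ s => h (w₁, w₂, pick w₁ w₂ s, s), dec₁, fun z s => dec₂ (z, s),
    le_trans ?_ hfgh⟩
  refine Finset.sum_le_sum fun w₁ _ => Finset.sum_le_sum fun w₂ _ => Finset.sum_le_sum
    fun s _ => ?_
  change E.σ s * e w₁ w₂ s (pick w₁ w₂ s) ≤ _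
  set m := e w₁ w₂ s (pick w₁ w₂ s)
  have hm0 : 0 ≤ m := Finset.sum_nonneg fun v _ => mul_nonneg ((E.W_mem _ _ _).1 _) (ind_nonneg _)
  have hm1 : m ≤ 1 := by
    rw [← (E.W_mem (f w₁) (h (w₁, w₂, pick w₁ w₂ s, s)) s).2]
    exact Finset.sum_le_sum fun v _ => mul_le_of_le_one_right ((E.W_mem _ _ _).1 _) (ind_le_one _)
  set q := E.inducedState w₁ (α w₂) f g s with hq
  have hsplit : E.σ s * m ≤ max (E.σ s - q) 0 + q * m := by
    have h2 : (E.σ s - q) * m ≤ max (E.σ s - q) 0 * m :=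
      mul_le_mul_of_nonneg_right (le_max_left _ _) hm0
    have h3 : max (E.σ s - q) 0 * m ≤ max (E.σ s - q) 0 :=
      mul_le_of_le_one_right (le_max_right _ _) hm1
    linarith [sub_mul (E.σ s) q m]
  refine hsplit.trans (add_le_add le_rfl ?_)
  have hqm : q * m = ∑ ℓ : Λ, 1 / L * (E.ρ (f w₁) (g (w₁, α w₂, ℓ)) s * m) := by
    rw [← Finset.mul_sum, ← Finset.sum_mul, hq, inducedState]
    ring
  rw [hqm]
  refine Finset.sum_le_sum fun ℓ _ => ?_
  rw [← Finset.mul_sum]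
  refine mul_le_mul_of_nonneg_left ?_ (by positivity)
  refine (mul_le_mul_of_nonneg_left (hpick w₁ w₂ s ℓ) (E.ρ_nonneg _ _ _)).trans ?_
  rw [Finset.mul_sum]
  refine Finset.sum_le_sum fun v _ => ?_
  rw [← mul_assoc]
  refine mul_le_mul_of_nonneg_left ?_ (E.sent_nonneg α (w₁, w₂, ℓ, s) v f g h)
  -- a decoder errs only if the codeword that is sent fails a test or a wrong one passes it; the
  -- sums of `unionBound` range over the wrong indices
  have himp : ¬ (dec₁ v.1 = w₁ ∧ dec₂ (v.2, s) = (w₁, w₂)) →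
      (((((((¬ E.testY θY (f w₁) (g (w₁, α w₂, ℓ)) v.1)
      ∨ (¬ E.testXUX θC (f w₁) (g (w₁, α w₂, ℓ)) (h (w₁, w₂, ℓ, s)) s v.2))
      ∨ (¬ E.testUX θB (f w₁) (g (w₁, α w₂, ℓ)) (h (w₁, w₂, ℓ, s)) s v.2))
      ∨ (¬ E.testX θD (f w₁) (g (w₁, α w₂, ℓ)) (h (w₁, w₂, ℓ, s)) s v.2))
      ∨ ∃ i ∈ wrongClouds 𝒜 Λ w₁, E.testY θY (f i.1) (g i) v.1)
      ∨ ∃ i ∈ wrongClouds 𝒲₂ Λ w₁, E.testXUX θC (f i.1) (g (i.1, α i.2.1, i.2.2))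
        (h (i.1, i.2.1, i.2.2, s)) s v.2)
      ∨ ∃ k ∈ wrongSatellites α w₂ ℓ, E.testUX θB (f w₁) (g (w₁, α k.1, k.2))
        (h (w₁, k.1, k.2, s)) s v.2)
      ∨ ∃ k ∈ siblings α w₂, E.testX θD (f w₁) (g (w₁, α k, ℓ)) (h (w₁, k, ℓ, s)) s v.2 := by
    intro herr
    rcases not_and_or.1 herr with h1 | h2
    · rcases hdec₁ _ _ h1 with h1 | ⟨w', hw', a, ℓ', ht⟩
      · exact Or.inl (Or.inl (Or.inl (Or.inl (Or.inl (Or.inl (Or.inl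
          fun ht => h1 ⟨_, _, ht⟩))))))
      · exact Or.inl (Or.inl (Or.inl (Or.inr ⟨(w', a, ℓ'), by simp [wrongClouds, hw'], ht⟩)))
    · rcases hdec₂ _ _ h2 with h2 | ⟨⟨w₁', w₂'⟩, hw', ℓ', hC', hB', hD'⟩
      · by_contra hcon
        simp only [not_or, not_not] at hcon
        obtain ⟨⟨⟨⟨⟨⟨⟨-, hC'⟩, hB'⟩, hD'⟩, -⟩, -⟩, -⟩, -⟩ := hcon
        exact h2 ⟨ℓ, hC', hB', hD'⟩
      · by_cases hw₁ : w₁' = w₁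
        · subst hw₁
          have hw₂ : w₂' ≠ w₂ := fun h => hw' (by rw [h])
          by_cases hc : α w₂' = α w₂ ∧ ℓ' = ℓ
          · obtain ⟨hα, rfl⟩ := hc
            exact Or.inr ⟨w₂', by simp [siblings, hw₂, hα], hD'⟩
          · exact Or.inl (Or.inr ⟨(w₂', ℓ'), by simpa [wrongSatellites, hw₂] using hc, hB'⟩)
        · exact Or.inl (Or.inl (Or.inr ⟨(w₁', w₂', ℓ'), by simp [wrongClouds, hw₁], hC'⟩))
  refine (ind_mono himp).trans ?_
  unfold unionBound
  refine (ind_or_le _ _).trans (add_le_add ?_ (ind_exists_le_sum _ _))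
  refine (ind_or_le _ _).trans (add_le_add ?_ (ind_exists_le_sum _ _))
  refine (ind_or_le _ _).trans (add_le_add ?_ (ind_exists_le_sum _ _))
  refine (ind_or_le _ _).trans (add_le_add ?_ (ind_exists_le_sum _ _))
  refine (ind_or_le _ _).trans (add_le_add ?_ le_rfl)
  refine (ind_or_le _ _).trans (add_le_add ?_ le_rfl)
  exact ind_or_le _ _

end Ensemble

/-! ### Independent uses of an ensemble -/

lemma sum_arrow_prod_prod {ι A B : Type*} [Fintype ι] [DecidableEq ι] [Fintype A] [Fintype B]
    (g : ι → A × B → ℝ) :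
    ∑ v : (ι → A) × (ι → B), ∏ i, g i (v.1 i, v.2 i) = ∏ i, ∑ v, g i v := by
  rw [← sum_pi_prod, ← (Equiv.arrowProdEquivProdArrow ι (fun _ => A) (fun _ => B)).sum_comp]
  rfl

lemma sum_arrow_prod {ι A B : Type*} [Fintype ι] [DecidableEq ι] [Fintype A] [Fintype B]
    (F : (ι → A × B) → ℝ) :
    ∑ f, F f = ∑ a : ι → A, ∑ b : ι → B, F fun i => (a i, b i) := by
  rw [← (Equiv.arrowProdEquivProdArrow ι (fun _ => A) (fun _ => B)).symm.sum_comp,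
    Fintype.sum_prod_type]
  rfl

lemma pi_mem_stdSimplex {ι A : Type*} [Fintype ι] [DecidableEq ι] [Fintype A] {q : ι → A → ℝ}
    (hq : ∀ i, q i ∈ stdSimplex ℝ A) : (fun f : ι → A => ∏ i, q i (f i)) ∈ stdSimplex ℝ (ι → A) :=
  ⟨fun _ => Finset.prod_nonneg fun i _ => (hq i).1 _, by
    rw [sum_pi_prod]; exact Finset.prod_eq_one fun i _ => (hq i).2⟩

namespace Ensemble

variable {X₁ U S X₂ Y Z : Type*} [Fintype X₁] [Fintype U] [Fintype S] [Fintype X₂]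
    [Fintype Y] [Fintype Z] (E : Ensemble X₁ U S X₂ Y Z)

/-- The joint law of `(X₁, S, U, X₂, Y, Z)`. -/
def joint (t : X₁ × S × U × X₂ × Y × Z) : ℝ :=
  E.a t.1 * (E.b t.1 t.2.2.1 * (E.d t.1 t.2.2.1 t.2.1 t.2.2.2.1 *
    (E.ρ t.1 t.2.2.1 t.2.1 * E.W t.1 t.2.2.2.1 t.2.1 (t.2.2.2.2.1, t.2.2.2.2.2))))

lemma mean_eq_sum_joint (φ : X₁ → U → S → X₂ → Y × Z → ℝ) :
    E.mean φ = ∑ t, E.joint t * φ t.1 t.2.2.1 t.2.1 t.2.2.2.1 (t.2.2.2.2.1, t.2.2.2.2.2) := by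
  simp only [mean, joint, Fintype.sum_prod_type (α₁ := X₁), Fintype.sum_prod_type (α₁ := S),
    Fintype.sum_prod_type (α₁ := U), Fintype.sum_prod_type (α₁ := X₂), Finset.mul_sum]
  rw [sum_comm_three]
  refine Finset.sum_congr rfl fun x₁ _ => Finset.sum_congr rfl fun s _ => ?_
  rw [← sum_comm_three fun u x₂ v => _]
  refine Finset.sum_congr rfl fun u _ => Finset.sum_congr rfl fun x₂ _ =>
    Finset.sum_congr rfl fun v _ => by ring

lemma joint_nonneg (t : X₁ × S × U × X₂ × Y × Z) : 0 ≤ E.joint t :=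
  mul_nonneg (E.a_mem.1 _) (mul_nonneg ((E.b_mem _).1 _) (mul_nonneg ((E.d_mem _ _ _).1 _)
    (mul_nonneg (E.ρ_nonneg _ _ _) ((E.W_mem _ _ _).1 _))))

lemma tailProb_eq_mean (θ : ℝ) :
    E.tailProb θ = E.mean fun x₁ u s _ _ => ind (θ * E.σ s < E.ρ x₁ u s) := by
  symm
  simp only [tailProb, mean]
  simp only [Finset.mul_sum]
  rw [sum_comm_three]
  refine Finset.sum_congr rfl fun x₁ _ => Finset.sum_congr rfl fun s _ => ?_
  rw [← sum_comm_three fun u x₂ v => _]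
  refine Finset.sum_congr rfl fun u _ => ?_
  have h : ∀ x₂ v, E.a x₁ * (E.b x₁ u * (E.d x₁ u s x₂ * (E.ρ x₁ u s * (E.W x₁ x₂ s v *
      ind (θ * E.σ s < E.ρ x₁ u s))))) = (E.a x₁ * (E.b x₁ u * (E.ρ x₁ u s *
      ind (θ * E.σ s < E.ρ x₁ u s)))) * (E.d x₁ u s x₂ * E.W x₁ x₂ s v) := fun x₂ v => by ring
  simp only [h, ← Finset.mul_sum, (E.W_mem _ _ _).2, mul_one, (E.d_mem _ _ _).2]

/-- The ensemble of `n` independent uses. -/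
def pow (n : ℕ) : Ensemble (Fin n → X₁) (Fin n → U) (Fin n → S) (Fin n → X₂) (Fin n → Y)
    (Fin n → Z) where
  a x₁ := ∏ i, E.a (x₁ i)
  a_mem := pi_mem_stdSimplex fun _ => E.a_mem
  b x₁ u := ∏ i, E.b (x₁ i) (u i)
  b_mem x₁ := pi_mem_stdSimplex fun i => E.b_mem (x₁ i)
  ρ x₁ u s := ∏ i, E.ρ (x₁ i) (u i) (s i)
  ρ_nonneg x₁ u s := Finset.prod_nonneg fun i _ => E.ρ_nonneg _ _ _
  σ s := ∏ i, E.σ (s i)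
  σ_mem := pi_mem_stdSimplex fun _ => E.σ_mem
  sum_b_ρ x₁ s := by
    simp only [← Finset.prod_mul_distrib]
    rw [sum_pi_prod fun i u => E.b (x₁ i) u * E.ρ (x₁ i) u (s i)]
    simp only [E.sum_b_ρ]
  d x₁ u s x₂ := ∏ i, E.d (x₁ i) (u i) (s i) (x₂ i)
  d_mem x₁ u s := pi_mem_stdSimplex fun i => E.d_mem (x₁ i) (u i) (s i)
  W x₁ x₂ s v := ∏ i, E.W (x₁ i) (x₂ i) (s i) (v.1 i, v.2 i)
  W_mem x₁ x₂ s := ⟨fun v => Finset.prod_nonneg fun i _ => (E.W_mem _ _ _).1 _, by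
    rw [sum_arrow_prod_prod fun i => E.W (x₁ i) (x₂ i) (s i)]
    exact Finset.prod_eq_one fun i _ => (E.W_mem _ _ _).2⟩

variable {n : ℕ}

lemma pow_outGivenXUS (x₁ : Fin n → X₁) (u : Fin n → U) (s : Fin n → S)
    (v : (Fin n → Y) × (Fin n → Z)) :
    (E.pow n).outGivenXUS x₁ u s v = ∏ i, E.outGivenXUS (x₁ i) (u i) (s i) (v.1 i, v.2 i) := by
  simp only [outGivenXUS, pow, ← Finset.prod_mul_distrib]
  exact sum_pi_prod fun i x₂ => E.d (x₁ i) (u i) (s i) x₂ * E.W (x₁ i) x₂ (s i) (v.1 i, v.2 i)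

lemma pow_outGivenX (x₁ : Fin n → X₁) (s : Fin n → S) (v : (Fin n → Y) × (Fin n → Z)) :
    (E.pow n).outGivenX x₁ s v = ∏ i, E.outGivenX (x₁ i) (s i) (v.1 i, v.2 i) := by
  simp only [outGivenX, pow_outGivenXUS]
  simp only [pow, ← Finset.prod_mul_distrib]
  exact sum_pi_prod fun i u => E.b (x₁ i) u *
    (E.ρ (x₁ i) u (s i) * E.outGivenXUS (x₁ i) u (s i) (v.1 i, v.2 i))

lemma pow_out (s : Fin n → S) (v : (Fin n → Y) × (Fin n → Z)) :
    (E.pow n).out s v = ∏ i, E.out (s i) (v.1 i, v.2 i) := by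
  simp only [out, pow_outGivenX]
  simp only [pow, ← Finset.prod_mul_distrib]
  exact sum_pi_prod fun i x₁ => E.a x₁ * E.outGivenX x₁ (s i) (v.1 i, v.2 i)

lemma pow_outZ (x₁ : Fin n → X₁) (x₂ : Fin n → X₂) (s : Fin n → S) (z : Fin n → Z) :
    (E.pow n).outZ x₁ x₂ s z = ∏ i, E.outZ (x₁ i) (x₂ i) (s i) (z i) := by
  simp only [outZ, pow]
  exact sum_pi_prod fun i y => E.W (x₁ i) (x₂ i) (s i) (y, z i)

lemma pow_lawYGivenXU (x₁ : Fin n → X₁) (u : Fin n → U) (y : Fin n → Y) :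
    (E.pow n).lawYGivenXU x₁ u y = ∏ i, E.lawYGivenXU (x₁ i) (u i) (y i) := by
  simp only [lawYGivenXU, pow_outGivenXUS]
  simp only [pow]
  have h : ∀ s : Fin n → S, ∑ z : Fin n → Z, ∏ i, E.outGivenXUS (x₁ i) (u i) (s i) (y i, z i)
      = ∏ i, ∑ z, E.outGivenXUS (x₁ i) (u i) (s i) (y i, z) := fun s =>
    sum_pi_prod fun i z => E.outGivenXUS (x₁ i) (u i) (s i) (y i, z)
  simp only [h, ← Finset.prod_mul_distrib]
  exact sum_pi_prod fun i s => E.ρ (x₁ i) (u i) s * ∑ z, E.outGivenXUS (x₁ i) (u i) s (y i, z)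

lemma pow_lawY (y : Fin n → Y) : (E.pow n).lawY y = ∏ i, E.lawY (y i) := by
  simp only [lawY, pow_out]
  have h : ∀ s : Fin n → S, ∑ z : Fin n → Z, ∏ i, E.out (s i) (y i, z i)
      = ∏ i, ∑ z, E.out (s i) (y i, z) := fun s => sum_pi_prod fun i z => E.out (s i) (y i, z)
  simp only [h]
  exact sum_pi_prod fun i s => ∑ z, E.out s (y i, z)

lemma pow_lawSZ (s : Fin n → S) (z : Fin n → Z) :
    (E.pow n).lawSZ s z = ∏ i, E.lawSZ (s i) (z i) := by
  simp only [lawSZ, pow_out]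
  exact sum_pi_prod fun i y => E.out (s i) (y, z i)

lemma pow_lawSZGivenX (x₁ : Fin n → X₁) (s : Fin n → S) (z : Fin n → Z) :
    (E.pow n).lawSZGivenX x₁ s z = ∏ i, E.lawSZGivenX (x₁ i) (s i) (z i) := by
  simp only [lawSZGivenX, pow_outGivenX]
  exact sum_pi_prod fun i y => E.outGivenX (x₁ i) (s i) (y, z i)

lemma pow_lawZGivenXUS (x₁ : Fin n → X₁) (u : Fin n → U) (s : Fin n → S) (z : Fin n → Z) :
    (E.pow n).lawZGivenXUS x₁ u s z = ∏ i, E.lawZGivenXUS (x₁ i) (u i) (s i) (z i) := by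
  simp only [lawZGivenXUS, pow_outGivenXUS]
  exact sum_pi_prod fun i y => E.outGivenXUS (x₁ i) (u i) (s i) (y, z i)

lemma pow_mean (φ : (Fin n → X₁) → (Fin n → U) → (Fin n → S) → (Fin n → X₂) →
    (Fin n → Y) × (Fin n → Z) → ℝ) :
    (E.pow n).mean φ = expect (fun _ : Fin n => E.joint) fun t => φ (fun i => (t i).1)
      (fun i => (t i).2.2.1) (fun i => (t i).2.1) (fun i => (t i).2.2.2.1)
      (fun i => (t i).2.2.2.2.1, fun i => (t i).2.2.2.2.2) := by
  rw [mean_eq_sum_joint, expect]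
  simp only [sum_arrow_prod, Fintype.sum_prod_type]
  refine Finset.sum_congr rfl fun x₁ _ => Finset.sum_congr rfl fun s _ =>
    Finset.sum_congr rfl fun u _ => Finset.sum_congr rfl fun x₂ _ =>
    Finset.sum_congr rfl fun y _ => Finset.sum_congr rfl fun z _ => ?_
  congr 1
  simp only [joint, pow, Finset.prod_mul_distrib]

/-! ### The single-letter laws of an ensemble -/

lemma law_joint_xus (x₁ : X₁) (u : U) (s : S) :
    law E.joint (fun t => (t.1, t.2.2.1, t.2.1)) (x₁, u, s)
      = E.ρ x₁ u s * (E.a x₁ * E.b x₁ u) := by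
  classical
  rw [law_eq_sum_ite]
  simp only [Fintype.sum_prod_type, Prod.mk.injEq, ite_and, Finset.sum_ite_irrel,
    Finset.sum_const_zero, Finset.sum_ite_eq', Finset.mem_univ, if_true, joint]
  have h : ∀ x₂, ∑ y, ∑ z, E.W x₁ x₂ s (y, z) = 1 := fun x₂ => by
    rw [← Fintype.sum_prod_type (f := E.W x₁ x₂ s)]; exact (E.W_mem _ _ _).2
  simp only [← Finset.mul_sum, h, mul_one]
  rw [← Finset.sum_mul, (E.d_mem _ _ _).2]
  ring

lemma law_joint_xs (x₁ : X₁) (s : S) :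
    law E.joint (fun t => (t.1, t.2.1)) (x₁, s) = E.σ s * E.a x₁ := by
  have h := sum_law_prod_left E.joint (fun t => t.2.2.1) (fun t => (t.1, t.2.1)) (x₁, s)
  have h2 : ∀ u, law E.joint (fun t => (t.2.2.1, t.1, t.2.1)) (u, x₁, s)
      = E.a x₁ * (E.b x₁ u * E.ρ x₁ u s) := by
    intro u
    rw [mul_comm (E.b _ _), mul_left_comm, ← law_joint_xus]
    classical
    simp only [law_eq_sum_ite, Prod.mk.injEq]
    exact Finset.sum_congr rfl fun t _ => if_congr (by tauto) rfl rfl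
  rw [← h]
  simp only [h2, ← Finset.mul_sum, E.sum_b_ρ]
  ring

lemma law_joint_x (x₁ : X₁) : law E.joint (fun t => t.1) x₁ = E.a x₁ := by
  have h := sum_law_prod_left E.joint (fun t => t.2.1) (fun t => t.1) x₁
  have h2 : ∀ s, law E.joint (fun t => (t.2.1, t.1)) (s, x₁) = E.σ s * E.a x₁ := by
    intro s
    rw [← law_joint_xs]
    classical
    simp only [law_eq_sum_ite, Prod.mk.injEq]
    exact Finset.sum_congr rfl fun t _ => if_congr (by tauto) rfl rfl
  rw [← h]
  simp only [h2, ← Finset.sum_mul, E.σ_mem.2, one_mul]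

lemma law_joint_s (s : S) : law E.joint (fun t => t.2.1) s = E.σ s := by
  rw [← sum_law_prod_left E.joint (fun t => t.1) (fun t => t.2.1) s]
  simp only [law_joint_xs, ← Finset.mul_sum, E.a_mem.2, mul_one]

lemma joint_mem_stdSimplex : E.joint ∈ stdSimplex ℝ (X₁ × S × U × X₂ × Y × Z) :=
  ⟨E.joint_nonneg, by
    rw [← sum_law E.joint fun t => t.2.1]; simp only [law_joint_s, E.σ_mem.2]⟩

lemma law_joint_xuy (x₁ : X₁) (u : U) (y : Y) :
    law E.joint (fun t => (t.1, t.2.2.1, t.2.2.2.2.1)) (x₁, u, y)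
      = E.lawYGivenXU x₁ u y * (E.a x₁ * E.b x₁ u) := by
  classical
  rw [law_eq_sum_ite]
  simp only [Fintype.sum_prod_type, Prod.mk.injEq, ite_and, Finset.sum_ite_irrel,
    Finset.sum_const_zero, Finset.sum_ite_eq', Finset.mem_univ, if_true, joint]
  simp only [lawYGivenXU, outGivenXUS, Finset.mul_sum, Finset.sum_mul]
  refine Finset.sum_congr rfl fun s _ => ?_
  rw [Finset.sum_comm]
  exact Finset.sum_congr rfl fun _ _ => Finset.sum_congr rfl fun _ _ => by ring

lemma law_joint_xusz (x₁ : X₁) (u : U) (s : S) (z : Z) :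
    law E.joint (fun t => (t.1, t.2.2.1, t.2.1, t.2.2.2.2.2)) (x₁, u, s, z)
      = E.lawZGivenXUS x₁ u s z * (E.ρ x₁ u s * (E.a x₁ * E.b x₁ u)) := by
  classical
  rw [law_eq_sum_ite]
  simp only [Fintype.sum_prod_type, Prod.mk.injEq, ite_and, Finset.sum_ite_irrel,
    Finset.sum_const_zero, Finset.sum_ite_eq', Finset.mem_univ, if_true, joint]
  simp only [lawZGivenXUS, outGivenXUS, Finset.sum_mul]
  rw [Finset.sum_comm]
  exact Finset.sum_congr rfl fun _ _ => Finset.sum_congr rfl fun _ _ => by ring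

lemma law_joint_xsz (x₁ : X₁) (s : S) (z : Z) :
    law E.joint (fun t => (t.1, t.2.1, t.2.2.2.2.2)) (x₁, s, z)
      = E.lawSZGivenX x₁ s z * E.a x₁ := by
  classical
  rw [law_eq_sum_ite]
  simp only [Fintype.sum_prod_type, Prod.mk.injEq, ite_and, Finset.sum_ite_irrel,
    Finset.sum_const_zero, Finset.sum_ite_eq', Finset.mem_univ, if_true, joint]
  simp only [lawSZGivenX, outGivenX, outGivenXUS, Finset.mul_sum, Finset.sum_mul]
  rw [sum_comm_three]
  exact Finset.sum_congr rfl fun _ _ => Finset.sum_congr rfl fun _ _ =>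
    Finset.sum_congr rfl fun _ _ => by ring

lemma law_joint_sz (s : S) (z : Z) :
    law E.joint (fun t => (t.2.1, t.2.2.2.2.2)) (s, z) = E.lawSZ s z := by
  rw [← sum_law_prod_left E.joint (fun t => t.1) (fun t => (t.2.1, t.2.2.2.2.2)) (s, z)]
  simp only [law_joint_xsz, lawSZ, out, lawSZGivenX]
  simp only [Finset.sum_mul]
  rw [Finset.sum_comm]
  exact Finset.sum_congr rfl fun _ _ => Finset.sum_congr rfl fun _ _ => by ring

lemma law_joint_y (y : Y) : law E.joint (fun t => t.2.2.2.2.1) y = E.lawY y := by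
  classical
  rw [law_eq_sum_ite]
  simp only [Fintype.sum_prod_type, Finset.sum_ite_irrel,
    Finset.sum_const_zero, Finset.sum_ite_eq', Finset.mem_univ, if_true, joint]
  simp only [lawY, out, outGivenX, outGivenXUS, Finset.mul_sum]
  symm
  rw [sum_comm_three]
  refine Finset.sum_congr rfl fun x₁ _ => Finset.sum_congr rfl fun s _ => ?_
  rw [← sum_comm_three fun u x₂ z => _]
  exact Finset.sum_congr rfl fun _ _ => Finset.sum_congr rfl fun _ _ =>
    Finset.sum_congr rfl fun _ _ => by ring

/-- If the backward law is normalised, then `(X₁, U)` has the law `P(x₁) P(u | x₁)`. -/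
lemma law_joint_xu (hρ : ∀ x₁ u, E.b x₁ u * ∑ s, E.ρ x₁ u s = E.b x₁ u) (x₁ : X₁) (u : U) :
    law E.joint (fun t => (t.1, t.2.2.1)) (x₁, u) = E.a x₁ * E.b x₁ u := by
  have h := sum_law_prod_left E.joint (fun t => t.2.1) (fun t => (t.1, t.2.2.1)) (x₁, u)
  have h2 : ∀ s, law E.joint (fun t => (t.2.1, t.1, t.2.2.1)) (s, x₁, u)
      = E.a x₁ * (E.b x₁ u * E.ρ x₁ u s) := by
    intro s
    rw [mul_comm (E.b _ _), mul_left_comm, ← law_joint_xus]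
    classical
    simp only [law_eq_sum_ite, Prod.mk.injEq]
    exact Finset.sum_congr rfl fun t _ => if_congr (by tauto) rfl rfl
  rw [← h]
  simp only [h2, ← Finset.mul_sum, hρ]

end Ensemble

/-! ### The law of large numbers for likelihood ratios -/

section LargeNumbers

variable {Ω α β : Type*} [Fintype Ω] [Fintype α] [Fintype β]

/-- The expectation of a logarithmic likelihood is a difference of entropies. -/
lemma sum_mul_logb_eq {p : Ω → ℝ} (hp : ∀ ω, 0 ≤ p ω) (A : Ω → α) (B : Ω → β) (f : Ω → ℝ)
    (h : ∀ ω, f ω * law p B (B ω) = law p A (A ω)) :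
    ∑ ω, p ω * Real.logb 2 (f ω) = entropy p B - entropy p A := by
  rw [entropy_eq, entropy_eq, neg_sub_neg, ← Finset.sum_sub_distrib]
  refine Finset.sum_congr rfl fun ω _ => ?_
  rcases (hp ω).eq_or_lt with h0 | h0
  · simp [← h0]
  · have hA := law_pos hp A h0
    have hB := law_pos hp B h0
    have hf : f ω ≠ 0 := fun hf => by
      have := h ω
      rw [hf, zero_mul] at this
      exact hA.ne this
    rw [← h ω, Real.logb_mul hf hB.ne']
    ring

/-- A product of i.i.d. likelihood ratios falls below `2 ^ (n t)` with vanishing probability if `t`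
is less than the expectation of the logarithm of the ratio. -/
lemma tendsto_expect_ind_prod_lt {p : Ω → ℝ} (hp : p ∈ stdSimplex ℝ Ω) {f g : Ω → ℝ}
    (hf : ∀ ω, 0 < p ω → 0 < f ω) (hg : ∀ ω, 0 < p ω → 0 < g ω) {t : ℝ}
    (ht : t < ∑ ω, p ω * Real.logb 2 (f ω) - ∑ ω, p ω * Real.logb 2 (g ω)) :
    Tendsto (fun n : ℕ => expect (fun _ : Fin n => p) fun ω =>
      ind (∏ i, f (ω i) < 2 ^ ((n : ℝ) * t) * ∏ i, g (ω i))) atTop (𝓝 0) := by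
  set m := ∑ ω, p ω * Real.logb 2 (f ω) - ∑ ω, p ω * Real.logb 2 (g ω) with hm
  let D : Ω → ℝ := fun ω => Real.logb 2 (f ω) - Real.logb 2 (g ω) - m
  have hD : ∑ ω, p ω * D ω = 0 := by
    simp only [D, mul_sub, Finset.sum_sub_distrib, ← Finset.sum_mul, hp.2]
    linarith
  set V := ∑ ω, p ω * D ω ^ 2
  have hε : 0 < m - t := sub_pos.2 ht
  have hub : ∀ n : ℕ, n ≠ 0 → expect (fun _ : Fin n => p) (fun ω =>
      ind (∏ i, f (ω i) < 2 ^ ((n : ℝ) * t) * ∏ i, g (ω i))) ≤ V / (m - t) ^ 2 * (1 / n) := by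
    intro n hn
    have hn' : (0 : ℝ) < n := by exact_mod_cast hn.bot_lt
    have hvar : expect (fun _ : Fin n => p)
        (fun ω => 1 / (n * (m - t)) ^ 2 * (∑ i, D (ω i)) ^ 2) = V / (m - t) ^ 2 * (1 / n) := by
      rw [expect_const_mul, expect_sq_sum _ (fun _ => hp.2) (fun _ => D) fun _ => hD]
      simp only [Finset.sum_const, Finset.card_univ, Fintype.card_fin, nsmul_eq_mul]
      change 1 / (n * (m - t)) ^ 2 * (n * V) = _
      field_simp
    rw [← hvar]
    refine Finset.sum_le_sum fun ω _ => ?_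
    rcases (Finset.prod_nonneg fun i _ => hp.1 (ω i) : 0 ≤ ∏ i, p (ω i)).eq_or_lt with h0 | h0
    · rw [← h0, zero_mul, zero_mul]
    refine mul_le_mul_of_nonneg_left ?_ h0.le
    dsimp only
    have hpos : ∀ i, 0 < p (ω i) := fun i => (hp.1 _).lt_of_ne' fun h =>
      h0.ne' (Finset.prod_eq_zero (Finset.mem_univ i) h)
    by_cases hlt : ∏ i, f (ω i) < 2 ^ ((n : ℝ) * t) * ∏ i, g (ω i)
    · rw [ind_of_true hlt]
      have hfp : 0 < ∏ i, f (ω i) := Finset.prod_pos fun i _ => hf _ (hpos i)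
      have hgp : 0 < ∏ i, g (ω i) := Finset.prod_pos fun i _ => hg _ (hpos i)
      have h1 := Real.logb_lt_logb one_lt_two hfp hlt
      rw [Real.logb_mul (by positivity) hgp.ne', Real.logb_rpow two_pos (by norm_num),
        Real.logb_prod _ _ fun i _ => (hf _ (hpos i)).ne',
        Real.logb_prod _ _ fun i _ => (hg _ (hpos i)).ne'] at h1
      have h2 : ∑ i, D (ω i) = ∑ i, Real.logb 2 (f (ω i)) - ∑ i, Real.logb 2 (g (ω i)) - n * m := by
        simp [D, Finset.sum_sub_distrib]
      have h3 : n * (m - t) ≤ -∑ i, D (ω i) := by rw [h2]; linarith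
      rw [one_div, inv_mul_eq_div, one_le_div (by positivity), ← neg_sq (∑ i, D (ω i))]
      exact pow_le_pow_left₀ (by positivity) h3 2
    · rw [ind_of_false hlt]; positivity
  refine squeeze_zero' (Eventually.of_forall fun n => ?_)
    ((eventually_ne_atTop 0).mono hub) ?_
  · exact Finset.sum_nonneg fun ω _ => mul_nonneg (Finset.prod_nonneg fun i _ => hp.1 _)
      (ind_nonneg _)
  · simpa using (tendsto_one_div_atTop_nhds_zero_nat (𝕜 := ℝ)).const_mul (V / (m - t) ^ 2)

end LargeNumbers

namespace Ensemble

variable {X₁ U S X₂ Y Z : Type*} [Fintype X₁] [Fintype U] [Fintype S] [Fintype X₂]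
    [Fintype Y] [Fintype Z] (E : Ensemble X₁ U S X₂ Y Z)

/-! ### Exponents of the tests -/

/-- The entropy `H(Z | X₁ X₂ S)` left in the second output by the channel noise. -/
def outNoise : ℝ := -∑ t, E.joint t * Real.logb 2 (E.outZ t.1 t.2.2.2.1 t.2.1 t.2.2.2.2.2)

/-- The information `I(X₁ U; Y)`. -/
def infoY : ℝ := entropy E.joint (fun t => t.2.2.2.2.1) + entropy E.joint (fun t => (t.1, t.2.2.1))
  - entropy E.joint (fun t => (t.1, t.2.2.1, t.2.2.2.2.1))

/-- The information `I(U; S | X₁) = I(X₁ U; S)`. -/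
def infoS : ℝ := entropy E.joint (fun t => t.2.1) + entropy E.joint (fun t => (t.1, t.2.2.1))
  - entropy E.joint (fun t => (t.1, t.2.2.1, t.2.1))

variable {E} in
lemma joint_pos {t : X₁ × S × U × X₂ × Y × Z} (ht : 0 < E.joint t) :
    0 < E.ρ t.1 t.2.2.1 t.2.1 ∧ 0 < E.outZ t.1 t.2.2.2.1 t.2.1 t.2.2.2.2.2 := by
  have h0 := ht.ne'
  simp only [joint, mul_ne_zero_iff] at h0
  obtain ⟨-, -, -, h1, h2⟩ := h0
  refine ⟨(E.ρ_nonneg _ _ _).lt_of_ne' h1, ((E.W_mem _ _ _).1 _).lt_of_ne' h2 |>.trans_le ?_⟩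
  exact Finset.single_le_sum (f := fun y => E.W t.1 t.2.2.2.1 t.2.1 (y, t.2.2.2.2.2))
    (fun y _ => (E.W_mem _ _ _).1 _) (Finset.mem_univ _)

lemma sum_joint_mul_logb_mul {f g : X₁ × S × U × X₂ × Y × Z → ℝ}
    (hf : ∀ t, 0 < E.joint t → 0 < f t) (hg : ∀ t, 0 < E.joint t → 0 < g t) :
    ∑ t, E.joint t * Real.logb 2 (f t * g t)
      = ∑ t, E.joint t * Real.logb 2 (f t) + ∑ t, E.joint t * Real.logb 2 (g t) := by
  rw [← Finset.sum_add_distrib]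
  refine Finset.sum_congr rfl fun t _ => ?_
  rcases (E.joint_nonneg t).eq_or_lt with h0 | h0
  · simp [← h0]
  · rw [Real.logb_mul (hf t h0).ne' (hg t h0).ne']; ring

lemma lawY_pos {t : X₁ × S × U × X₂ × Y × Z} (ht : 0 < E.joint t) : 0 < E.lawY t.2.2.2.2.1 := by
  rw [← law_joint_y]; exact law_pos E.joint_nonneg (fun t => t.2.2.2.2.1) ht

lemma lawSZ_pos {t : X₁ × S × U × X₂ × Y × Z} (ht : 0 < E.joint t) :
    0 < E.lawSZ t.2.1 t.2.2.2.2.2 := by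
  rw [← law_joint_sz]; exact law_pos E.joint_nonneg (fun t => (t.2.1, t.2.2.2.2.2)) ht

lemma σ_pos {t : X₁ × S × U × X₂ × Y × Z} (ht : 0 < E.joint t) : 0 < E.σ t.2.1 := by
  rw [← law_joint_s]; exact law_pos E.joint_nonneg (fun t => t.2.1) ht

lemma lawYGivenXU_pos {t : X₁ × S × U × X₂ × Y × Z} (ht : 0 < E.joint t) :
    0 < E.lawYGivenXU t.1 t.2.2.1 t.2.2.2.2.1 := by
  have h := law_pos E.joint_nonneg (fun t => (t.1, t.2.2.1, t.2.2.2.2.1)) ht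
  rw [law_joint_xuy] at h
  exact (E.lawYGivenXU_nonneg _ _ _).lt_of_ne' (left_ne_zero_of_mul h.ne')

lemma lawSZGivenX_pos {t : X₁ × S × U × X₂ × Y × Z} (ht : 0 < E.joint t) :
    0 < E.lawSZGivenX t.1 t.2.1 t.2.2.2.2.2 := by
  have h := law_pos E.joint_nonneg (fun t => (t.1, t.2.1, t.2.2.2.2.2)) ht
  rw [law_joint_xsz] at h
  exact pos_of_mul_pos_left h (E.a_mem.1 _)

lemma lawZGivenXUS_pos {t : X₁ × S × U × X₂ × Y × Z} (ht : 0 < E.joint t) :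
    0 < E.lawZGivenXUS t.1 t.2.2.1 t.2.1 t.2.2.2.2.2 := by
  have h := law_pos E.joint_nonneg (fun t => (t.1, t.2.2.1, t.2.1, t.2.2.2.2.2)) ht
  rw [law_joint_xusz] at h
  exact pos_of_mul_pos_left h
    (mul_nonneg (E.ρ_nonneg _ _ _) (mul_nonneg (E.a_mem.1 _) ((E.b_mem _).1 _)))

lemma sum_joint_mul_logb_ρ (hρ : ∀ x₁ u, E.b x₁ u * ∑ s, E.ρ x₁ u s = E.b x₁ u) :
    ∑ t, E.joint t * Real.logb 2 (E.ρ t.1 t.2.2.1 t.2.1)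
    = entropy E.joint (fun t => (t.1, t.2.2.1))
      - entropy E.joint (fun t => (t.1, t.2.2.1, t.2.1)) :=
  sum_mul_logb_eq E.joint_nonneg (fun t => (t.1, t.2.2.1, t.2.1)) (fun t => (t.1, t.2.2.1))
    (fun t => E.ρ t.1 t.2.2.1 t.2.1) fun t => by rw [E.law_joint_xu hρ, E.law_joint_xus]

lemma tendsto_mean_testY (hρ : ∀ x₁ u, E.b x₁ u * ∑ s, E.ρ x₁ u s = E.b x₁ u)
    {r : ℝ} (hr : r < E.infoY) :
    Tendsto (fun n : ℕ => (E.pow n).mean fun x₁ u _ _ v =>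
      ind (¬ (E.pow n).testY (2 ^ ((n : ℝ) * r)) x₁ u v.1)) atTop (𝓝 0) := by
  simp only [pow_mean, testY, pow_lawY, pow_lawYGivenXU, not_le]
  refine tendsto_expect_ind_prod_lt E.joint_mem_stdSimplex
    (f := fun t => E.lawYGivenXU t.1 t.2.2.1 t.2.2.2.2.1) (g := fun t => E.lawY t.2.2.2.2.1)
    (fun t => E.lawYGivenXU_pos) (fun t => E.lawY_pos) (hr.trans_eq ?_)
  rw [sum_mul_logb_eq E.joint_nonneg (fun t => (t.1, t.2.2.1, t.2.2.2.2.1))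
    (fun t => (t.1, t.2.2.1)) (fun t => E.lawYGivenXU t.1 t.2.2.1 t.2.2.2.2.1)
    (fun t => by rw [E.law_joint_xu hρ, E.law_joint_xuy])]
  simp only [← law_joint_y]
  rw [infoY, entropy_eq E.joint fun t => t.2.2.2.2.1]
  ring

lemma tendsto_mean_testXUX (hρ : ∀ x₁ u, E.b x₁ u * ∑ s, E.ρ x₁ u s = E.b x₁ u)
    {r : ℝ} (hr : r < E.infoS + (condEntropy E.joint
      (fun t => t.2.2.2.2.2) (fun t => t.2.1) - E.outNoise)) :
    Tendsto (fun n : ℕ => (E.pow n).mean fun x₁ u s x₂ v =>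
      ind (¬ (E.pow n).testXUX (2 ^ ((n : ℝ) * r)) x₁ u x₂ s v.2)) atTop (𝓝 0) := by
  simp only [pow_mean, testXUX, pow_lawSZ, pow_outZ, not_le]
  simp only [pow, ← Finset.prod_mul_distrib]
  refine tendsto_expect_ind_prod_lt E.joint_mem_stdSimplex
    (f := fun t => E.ρ t.1 t.2.2.1 t.2.1 * E.outZ t.1 t.2.2.2.1 t.2.1 t.2.2.2.2.2)
    (g := fun t => E.lawSZ t.2.1 t.2.2.2.2.2)
    (fun t ht => mul_pos (joint_pos ht).1 (joint_pos ht).2) (fun t => E.lawSZ_pos)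
    (hr.trans_eq ?_)
  rw [E.sum_joint_mul_logb_mul (fun t ht => (joint_pos ht).1) (fun t ht => (joint_pos ht).2),
    E.sum_joint_mul_logb_ρ hρ]
  simp only [← law_joint_sz]
  rw [infoS, outNoise, condEntropy, entropy_congr E.joint_nonneg
    (A := fun t => (t.2.2.2.2.2, t.2.1)) (B := fun t => (t.2.1, t.2.2.2.2.2))
    (fun _ _ => by simp; tauto), entropy_eq E.joint fun t => (t.2.1, t.2.2.2.2.2)]
  ring

/-- `X₁` and the state are independent. -/
lemma entropy_xs : entropy E.joint (fun t => (t.1, t.2.1))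
    = entropy E.joint (fun t => t.1) + entropy E.joint (fun t => t.2.1) := by
  have h := sum_mul_logb_eq E.joint_nonneg (fun t => (t.1, t.2.1)) (fun t => t.1)
    (fun t => E.σ t.2.1) fun t => by rw [E.law_joint_x, E.law_joint_xs]
  have h2 := entropy_eq E.joint fun t => t.2.1
  simp only [law_joint_s] at h2
  linarith

lemma tendsto_mean_testUX (hρ : ∀ x₁ u, E.b x₁ u * ∑ s, E.ρ x₁ u s = E.b x₁ u)
    {r : ℝ} (hr : r < E.infoS + (condEntropy E.joint
      (fun t => t.2.2.2.2.2) (fun t => (t.2.1, t.1)) - E.outNoise)) :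
    Tendsto (fun n : ℕ => (E.pow n).mean fun x₁ u s x₂ v =>
      ind (¬ (E.pow n).testUX (2 ^ ((n : ℝ) * r)) x₁ u x₂ s v.2)) atTop (𝓝 0) := by
  simp only [pow_mean, testUX, pow_lawSZGivenX, pow_outZ, not_le]
  simp only [pow, ← Finset.prod_mul_distrib]
  refine tendsto_expect_ind_prod_lt E.joint_mem_stdSimplex
    (f := fun t => E.ρ t.1 t.2.2.1 t.2.1 * E.outZ t.1 t.2.2.2.1 t.2.1 t.2.2.2.2.2)
    (g := fun t => E.lawSZGivenX t.1 t.2.1 t.2.2.2.2.2)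
    (fun t ht => mul_pos (joint_pos ht).1 (joint_pos ht).2) (fun t => E.lawSZGivenX_pos)
    (hr.trans_eq ?_)
  rw [E.sum_joint_mul_logb_mul (fun t ht => (joint_pos ht).1) (fun t ht => (joint_pos ht).2),
    E.sum_joint_mul_logb_ρ hρ, sum_mul_logb_eq E.joint_nonneg
      (fun t => (t.1, t.2.1, t.2.2.2.2.2)) (fun t => t.1)
      (fun t => E.lawSZGivenX t.1 t.2.1 t.2.2.2.2.2)
      fun t => by rw [E.law_joint_x, E.law_joint_xsz]]
  rw [infoS, outNoise, condEntropy, entropy_congr E.joint_nonneg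
    (A := fun t => (t.2.2.2.2.2, t.2.1, t.1)) (B := fun t => (t.1, t.2.1, t.2.2.2.2.2))
    (fun _ _ => by simp; tauto), entropy_congr E.joint_nonneg
    (A := fun t => (t.2.1, t.1)) (B := fun t => (t.1, t.2.1))
    (fun _ _ => by simp; tauto), entropy_xs]
  ring

lemma tendsto_mean_testX {r : ℝ} (hr : r < condEntropy E.joint
      (fun t => t.2.2.2.2.2) (fun t => (t.1, t.2.2.1, t.2.1)) - E.outNoise) :
    Tendsto (fun n : ℕ => (E.pow n).mean fun x₁ u s x₂ v =>
      ind (¬ (E.pow n).testX (2 ^ ((n : ℝ) * r)) x₁ u x₂ s v.2)) atTop (𝓝 0) := by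
  simp only [pow_mean, testX, pow_lawZGivenXUS, pow_outZ, not_le]
  refine tendsto_expect_ind_prod_lt E.joint_mem_stdSimplex
    (f := fun t => E.outZ t.1 t.2.2.2.1 t.2.1 t.2.2.2.2.2)
    (g := fun t => E.lawZGivenXUS t.1 t.2.2.1 t.2.1 t.2.2.2.2.2)
    (fun t ht => (joint_pos ht).2) (fun t => E.lawZGivenXUS_pos) (hr.trans_eq ?_)
  rw [sum_mul_logb_eq E.joint_nonneg
      (fun t => (t.1, t.2.2.1, t.2.1, t.2.2.2.2.2)) (fun t => (t.1, t.2.2.1, t.2.1))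
      (fun t => E.lawZGivenXUS t.1 t.2.2.1 t.2.1 t.2.2.2.2.2)
      fun t => by rw [E.law_joint_xus, E.law_joint_xusz]]
  rw [outNoise, condEntropy, entropy_congr E.joint_nonneg
    (A := fun t => (t.2.2.2.2.2, t.1, t.2.2.1, t.2.1))
    (B := fun t => (t.1, t.2.2.1, t.2.1, t.2.2.2.2.2)) (fun _ _ => by simp; tauto)]
  ring

lemma tendsto_tailProb (hρ : ∀ x₁ u, E.b x₁ u * ∑ s, E.ρ x₁ u s = E.b x₁ u) {r : ℝ}
    (hr : E.infoS < r) :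
    Tendsto (fun n : ℕ => (E.pow n).tailProb (2 ^ ((n : ℝ) * r))) atTop (𝓝 0) := by
  simp only [tailProb_eq_mean, pow_mean]
  have h : ∑ t, E.joint t * Real.logb 2 (E.σ t.2.1)
      - ∑ t, E.joint t * Real.logb 2 (E.ρ t.1 t.2.2.1 t.2.1) = -E.infoS := by
    rw [E.sum_joint_mul_logb_ρ hρ, infoS, entropy_eq E.joint fun t => t.2.1]
    simp only [law_joint_s]
    ring
  have ht := tendsto_expect_ind_prod_lt E.joint_mem_stdSimplex (f := fun t => E.σ t.2.1)
    (g := fun t => E.ρ t.1 t.2.2.1 t.2.1) (fun t => E.σ_pos) (fun t ht => (joint_pos ht).1)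
    (t := -r) (by rw [h]; linarith)
  refine ht.congr fun n => congrArg _ (funext fun t => congrArg ind (propext ?_))
  simp only [pow, mul_neg, Real.rpow_neg zero_le_two]
  rw [inv_mul_eq_div, lt_div_iff₀ (by positivity), mul_comm]

lemma infoS_nonneg : 0 ≤ E.infoS := by
  have h := condEntropy_le_entropy E.joint_mem_stdSimplex (fun t => t.2.1)
    (fun t => (t.1, t.2.2.1))
  rw [condEntropy, entropy_congr E.joint_nonneg (A := fun t => (t.2.1, t.1, t.2.2.1))
    (B := fun t => (t.1, t.2.2.1, t.2.1)) (fun _ _ => by simp; tauto)] at h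
  rw [infoS]
  linarith

end Ensemble

/-! ### Rates -/

lemma tendsto_two_rpow {c : ℝ} (hc : c < 0) :
    Tendsto (fun n : ℕ => (2 : ℝ) ^ ((n : ℝ) * c)) atTop (𝓝 0) := by
  have h : ∀ n : ℕ, (2 : ℝ) ^ ((n : ℝ) * c) = ((2 : ℝ) ^ c) ^ n := fun n => by
    rw [mul_comm, Real.rpow_mul zero_le_two, Real.rpow_natCast]
  simp only [h]
  exact tendsto_pow_atTop_nhds_zero_of_lt_one (by positivity)
    (Real.rpow_lt_one_of_one_lt_of_neg one_lt_two hc)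

lemma numMessages_zero (n : ℕ) : numMessages n 0 = 1 := by simp [numMessages]

lemma one_le_numMessages (n : ℕ) (R : ℝ) : (1 : ℝ) ≤ numMessages n R := by
  exact_mod_cast numMessages_pos n R

/-- The expected number of wrong codewords that pass a test vanishes if there are none, or if their
rate is less than the exponent of the test. -/
lemma tendsto_numMessages_sub_one_mul_div {R c t k : ℝ} (hR : 0 ≤ R) (h : R = 0 ∨ R + c < t)
    {G : ℕ → ℝ} (hG0 : ∀ n, 0 ≤ G n) (hG : ∀ n : ℕ, G n ≤ k * 2 ^ ((n : ℝ) * c)) :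
    Tendsto (fun n : ℕ => ((numMessages n R : ℝ) - 1) * G n / 2 ^ ((n : ℝ) * t)) atTop (𝓝 0) := by
  rcases h with rfl | h
  · simp [numMessages_zero]
  have hlim : Tendsto (fun n : ℕ => 2 * k * (2 : ℝ) ^ ((n : ℝ) * (R + c - t))) atTop (𝓝 0) := by
    simpa using (tendsto_two_rpow (by linarith : R + c - t < 0)).const_mul (2 * k)
  refine squeeze_zero (fun n => ?_) (fun n => ?_) hlim
  · exact div_nonneg (mul_nonneg (by linarith [one_le_numMessages n R]) (hG0 n)) (by positivity)
  · rw [div_le_iff₀ (by positivity)]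
    calc ((numMessages n R : ℝ) - 1) * G n
        ≤ (2 * 2 ^ ((n : ℝ) * R)) * (k * 2 ^ ((n : ℝ) * c)) :=
          mul_le_mul (by linarith [numMessages_le n hR]) (hG n) (hG0 n) (by positivity)
      _ = 2 * k * 2 ^ ((n : ℝ) * (R + c - t)) * 2 ^ ((n : ℝ) * t) := by
          rw [mul_assoc (2 * k), ← Real.rpow_add two_pos,
            show (n : ℝ) * (R + c - t) + n * t = n * R + n * c by ring, Real.rpow_add two_pos]
          ring

lemma numMessages_mul_le (n : ℕ) {R R' : ℝ} (hR : 0 ≤ R) (hR' : 0 ≤ R') :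
    (numMessages n R : ℝ) * numMessages n R' ≤ 4 * 2 ^ ((n : ℝ) * (R + R')) := by
  rw [mul_add, Real.rpow_add two_pos]
  calc _ ≤ (2 * (2 : ℝ) ^ ((n : ℝ) * R)) * (2 * 2 ^ ((n : ℝ) * R')) :=
        mul_le_mul (numMessages_le n hR) (numMessages_le n hR') (by positivity) (by positivity)
    _ = _ := by ring

lemma numMessages_add_le (n : ℕ) (R R' : ℝ) :
    numMessages n (R + R') ≤ numMessages n R' * numMessages n R := by
  refine Nat.ceil_le.2 ?_
  rw [mul_add, Real.rpow_add two_pos, mul_comm, Nat.cast_mul]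
  exact mul_le_mul (rpow_le_numMessages n R') (rpow_le_numMessages n R) (by positivity)
    (by positivity)

/-- The cells of the partition of `Fin M` into intervals of length `b` have at most `b` elements. -/
lemma card_siblings_le {M a b : ℕ} (h : M ≤ b * a) (w : Fin M) :
    ((Ensemble.siblings (fun w : Fin M => (⟨w / b, Nat.div_lt_of_lt_mul (w.2.trans_le h)⟩ : Fin a))
      w).card : ℝ) ≤ (b : ℝ) - 1 := by
  have hb : 0 < b := Nat.pos_of_ne_zero fun hb => by
    have := w.2.trans_le h
    simp [hb] at this
  have hcard : (Ensemble.siblings (fun w : Fin M =>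
      (⟨w / b, Nat.div_lt_of_lt_mul (w.2.trans_le h)⟩ : Fin a)) w).card
      ≤ ((Finset.range b).erase (w % b)).card := by
    refine Finset.card_le_card_of_injOn (fun k : Fin M => (k : ℕ) % b) ?_ ?_
    · intro k hk
      simp only [Ensemble.siblings, Finset.coe_filter, Finset.mem_erase, Finset.mem_univ,
        and_true, Fin.mk.injEq, Set.mem_ofPred_eq] at hk
      simp only [Finset.coe_erase, Finset.coe_range, Set.mem_sdiff, Set.mem_Iio,
        Set.mem_singleton_iff]
      refine ⟨Nat.mod_lt _ hb, fun hmod => hk.1 (Fin.ext ?_)⟩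
      rw [← Nat.div_add_mod (k : ℕ) b, ← Nat.div_add_mod (w : ℕ) b, hk.2, hmod]
    · intro k hk k' hk' hmod
      simp only [Ensemble.siblings, Finset.coe_filter, Finset.mem_erase, Finset.mem_univ,
        and_true, Fin.mk.injEq, Set.mem_ofPred_eq] at hk hk'
      dsimp only at hmod
      exact Fin.ext (by
        rw [← Nat.div_add_mod (k : ℕ) b, ← Nat.div_add_mod (k' : ℕ) b, hk.2, hk'.2, hmod])
  rw [Finset.card_erase_of_mem (Finset.mem_range.2 (Nat.mod_lt _ hb)), Finset.card_range] at hcard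
  refine (Nat.cast_le.2 hcard).trans_eq ?_
  rw [Nat.cast_sub hb, Nat.cast_one]

lemma exists_between_or {P : Prop} {c m : ℝ} (h : P ∨ c < m) : ∃ t < m, P ∨ c < t := by
  rcases h with h | h
  · exact ⟨m - 1, by linarith, Or.inl h⟩
  · obtain ⟨t, h1, h2⟩ := exists_between h
    exact ⟨t, h2, Or.inr h1⟩

/-! ### Achievability by random coding -/

section Achievability

variable {X₁ X₂ S Y Z U : Type*} [Fintype X₁] [Fintype X₂] [Fintype S] [Fintype Y] [Fintype Z]
  [Fintype U]

lemma errorProb_le (ch : Channel X₁ X₂ S Y Z) {n M₁ M₂ : ℕ} (c : Code X₁ X₂ S Y Z n M₁ M₂)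
    (hM₁ : 0 < M₁) (hM₂ : 0 < M₂) {B : ℝ}
    (h : ∑ w₁, ∑ w₂, ∑ s : Fin n → S, (∏ i, ch.stateLaw (s i)) *
      ∑ v : (Fin n → Y) × (Fin n → Z), (∏ i, ch.trans (c.enc₁ w₁ i) (c.enc₂ w₁ w₂ s i) (s i)
        (v.1 i, v.2 i)) * ind (¬ (c.dec₁ v.1 = w₁ ∧ c.dec₂ v.2 s = (w₁, w₂)))
      ≤ M₁ * (M₂ * B)) : errorProb ch c ≤ B := by
  have h1 : (0 : ℝ) < M₁ := by exact_mod_cast hM₁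
  have h2 : (0 : ℝ) < M₂ := by exact_mod_cast hM₂
  rw [errorProb, one_div, inv_mul_le_iff₀ (by positivity), mul_assoc]
  refine le_of_eq_of_le ?_ h
  refine Finset.sum_congr rfl fun w₁ _ => Finset.sum_congr rfl fun w₂ _ =>
    Finset.sum_congr rfl fun s _ => ?_
  rw [Fintype.sum_prod_type, Finset.mul_sum]
  refine Finset.sum_congr rfl fun y _ => ?_
  rw [Finset.mul_sum]
  refine Finset.sum_congr rfl fun z _ => ?_
  split_ifs with hc
  · rw [ind_of_false (not_not.2 hc), mul_zero, mul_zero]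
  · rw [ind_of_true hc, mul_one]

lemma errorProb_nonneg (ch : Channel X₁ X₂ S Y Z) {n M₁ M₂ : ℕ} (c : Code X₁ X₂ S Y Z n M₁ M₂) :
    0 ≤ errorProb ch c := by
  refine mul_nonneg (by positivity) (Finset.sum_nonneg fun w₁ _ => Finset.sum_nonneg fun w₂ _ =>
    Finset.sum_nonneg fun s _ => Finset.sum_nonneg fun y _ => Finset.sum_nonneg fun z _ => ?_)
  split_ifs
  · exact le_rfl
  · exact mul_nonneg (Finset.prod_nonneg fun i _ => ch.stateLaw_mem.1 _)
      (Finset.prod_nonneg fun i _ => (ch.trans_mem _ _ _).1 _)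

/-- Random coding achieves the rates `(R₁, Ra + Rb)`, where the part `Ra` of the second rate is
carried by `U`, and `r` is the rate of the bins.  Constraints on codewords of rate zero are void. -/
lemma Ensemble.achievable (E : Ensemble X₁ U S X₂ Y Z) (ch : Channel X₁ X₂ S Y Z)
    (hσ : E.σ = ch.stateLaw) (hW : E.W = ch.trans)
    (hρ : ∀ x₁ u, E.b x₁ u * ∑ s, E.ρ x₁ u s = E.b x₁ u)
    {R₁ Ra Rb r : ℝ} (hR₁ : 0 ≤ R₁) (hRa : 0 ≤ Ra) (hRb : 0 ≤ Rb) (hr : E.infoS < r)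
    (hY : R₁ = 0 ∨ R₁ + (Ra + r) < E.infoY)
    (hC : R₁ = 0 ∨ R₁ + (Ra + Rb + r) < E.infoS + (condEntropy E.joint
      (fun t => t.2.2.2.2.2) (fun t => t.2.1) - E.outNoise))
    (hB : Ra + Rb = 0 ∨ Ra + Rb + r < E.infoS + (condEntropy E.joint
      (fun t => t.2.2.2.2.2) (fun t => (t.2.1, t.1)) - E.outNoise))
    (hD : Rb = 0 ∨ Rb + 0 < condEntropy E.joint
      (fun t => t.2.2.2.2.2) (fun t => (t.1, t.2.2.1, t.2.1)) - E.outNoise) :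
    Achievable ch (R₁, Ra + Rb) := by
  classical
  obtain ⟨tY, htY, hY⟩ := exists_between_or hY
  obtain ⟨tC, htC, hC⟩ := exists_between_or hC
  obtain ⟨tB, htB, hB⟩ := exists_between_or hB
  obtain ⟨tD, htD, hD⟩ := exists_between_or hD
  have hr0 : 0 ≤ r := E.infoS_nonneg.trans hr.le
  obtain ⟨κ, hκ, hκr⟩ := exists_between hr
  -- the truncation level `2 ^ (n κ)` of soft covering lies between `2 ^ (n I)`, with `I` the
  -- information, and the bin size, and the slack `2 ^ (-n η)` halves the remaining gap
  set η : ℝ := (r - κ) / 2 with hη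
  have hη0 : 0 < η := by rw [hη]; linarith
  have h2 : ∀ x : ℝ, (0 : ℝ) < 2 ^ x := fun x => Real.rpow_pos_of_pos two_pos x
  let B : ℕ → ℝ := fun n =>
    (E.pow n).codingBound (numMessages n R₁) (numMessages n (Ra + Rb)) (numMessages n Ra)
      ((numMessages n Rb : ℝ) - 1) (numMessages n r) (2 ^ ((n : ℝ) * tY)) (2 ^ ((n : ℝ) * tC))
      (2 ^ ((n : ℝ) * tB)) (2 ^ ((n : ℝ) * tD))
    + ((E.pow n).tailProb (2 ^ ((n : ℝ) * κ)) + (2 ^ ((n : ℝ) * (-η))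
      + 2 ^ ((n : ℝ) * κ) / (numMessages n r * 2 ^ ((n : ℝ) * (-η)))))
  have hcode : ∀ n, ∃ c : Code X₁ X₂ S Y Z n (numMessages n R₁) (numMessages n (Ra + Rb)),
      errorProb ch c ≤ B n := by
    intro n
    have : ∀ R, Nonempty (Fin (numMessages n R)) := fun R => ⟨⟨0, numMessages_pos n R⟩⟩
    have hM := numMessages_add_le n Ra Rb
    -- `u` carries the quotient of the second message by the number of messages of rate `Rb`
    obtain ⟨enc₁, enc₂, dec₁, dec₂, h⟩ := (E.pow n).exists_code
      (𝒲₁ := Fin (numMessages n R₁)) (Λ := Fin (numMessages n r))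
      (fun w : Fin (numMessages n (Ra + Rb)) =>
        (⟨w / numMessages n Rb, Nat.div_lt_of_lt_mul (w.2.trans_le hM)⟩ : Fin (numMessages n Ra)))
      (h2 (n * tY)) (h2 (n * tC)) (h2 (n * tB)) (h2 (n * tD)) (h2 (n * κ)) (h2 (n * (-η)))
      (card_siblings_le hM)
    simp only [Fintype.card_fin] at h
    refine ⟨⟨enc₁, enc₂, dec₁, dec₂⟩, errorProb_le ch _ (numMessages_pos _ _)
      (numMessages_pos _ _) (le_of_eq_of_le ?_ h)⟩
    simp only [Ensemble.pow, hσ, hW]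
  choose c hc using hcode
  refine ⟨hR₁, add_nonneg hRa hRb, c, squeeze_zero (fun n => errorProb_nonneg ch _) hc ?_⟩
  have lY := tendsto_numMessages_sub_one_mul_div hR₁ hY (fun n => by positivity)
    (fun n => numMessages_mul_le n hRa hr0)
  have lC := tendsto_numMessages_sub_one_mul_div hR₁ hC (fun n => by positivity)
    (fun n => numMessages_mul_le n (add_nonneg hRa hRb) hr0)
  have lB := tendsto_numMessages_sub_one_mul_div (add_nonneg hRa hRb) hB (fun n => by positivity)
    (fun n => numMessages_le n hr0)
  have lD := tendsto_numMessages_sub_one_mul_div (k := 1) hRb hD (fun n => zero_le_one)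
    (fun n => by simp)
  have lδ : Tendsto (fun n : ℕ => (2 : ℝ) ^ ((n : ℝ) * κ)
      / (numMessages n r * 2 ^ ((n : ℝ) * (-η)))) atTop (𝓝 0) := by
    refine squeeze_zero (fun n => by positivity) (fun n => ?_)
      (tendsto_two_rpow (neg_lt_zero.2 hη0))
    rw [div_le_iff₀ (mul_pos (by exact_mod_cast numMessages_pos n r) (h2 _))]
    calc (2 : ℝ) ^ ((n : ℝ) * κ)
        = 2 ^ ((n : ℝ) * (-η)) * (2 ^ ((n : ℝ) * r) * 2 ^ ((n : ℝ) * (-η))) := by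
          rw [← Real.rpow_add two_pos, ← Real.rpow_add two_pos]
          congr 1
          rw [hη]
          ring
      _ ≤ _ := by
          gcongr
          exact rpow_le_numMessages n r
  have l := ((((((((E.tendsto_mean_testY hρ htY).add (E.tendsto_mean_testXUX hρ htC)).add
    (E.tendsto_mean_testUX hρ htB)).add (E.tendsto_mean_testX htD)).add lY).add lC).add lB).add
    lD).add ((E.tendsto_tailProb hρ hκ).add ((tendsto_two_rpow (neg_lt_zero.2 hη0)).add lδ))
  simp only [add_zero] at l
  refine l.congr fun n => ?_
  simp only [B, Ensemble.codingBound, mul_one, mul_assoc]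

end Achievability

/-! ### The ensemble of a single-letter law -/

section SingleLetter

variable {X₁ X₂ S Y Z U : Type*} [Fintype X₁] [Fintype X₂] [Fintype S] [Fintype Y] [Fintype Z]
  [Fintype U]

/-- The conditional law `P(u | x₁, s)`. -/
def uGivenXS (pUX₂ : X₁ → S → U × X₂ → ℝ) (x₁ : X₁) (s : S) (u : U) : ℝ := ∑ x₂, pUX₂ x₁ s (u, x₂)

/-- The conditional law `P(u | x₁)`. -/
def uGivenX (ch : Channel X₁ X₂ S Y Z) (pUX₂ : X₁ → S → U × X₂ → ℝ) (x₁ : X₁) (u : U) : ℝ :=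
  ∑ s, ch.stateLaw s * uGivenXS pUX₂ x₁ s u

lemma uGivenXS_nonneg {pUX₂ : X₁ → S → U × X₂ → ℝ}
    (hUX₂ : ∀ x₁ s, pUX₂ x₁ s ∈ stdSimplex ℝ (U × X₂)) (x₁ : X₁) (s : S) (u : U) :
    0 ≤ uGivenXS pUX₂ x₁ s u :=
  Finset.sum_nonneg fun _ _ => (hUX₂ _ _).1 _

lemma sum_uGivenXS {pUX₂ : X₁ → S → U × X₂ → ℝ}
    (hUX₂ : ∀ x₁ s, pUX₂ x₁ s ∈ stdSimplex ℝ (U × X₂)) (x₁ : X₁) (s : S) :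
    ∑ u, uGivenXS pUX₂ x₁ s u = 1 := by
  rw [← (hUX₂ x₁ s).2, Fintype.sum_prod_type]; rfl

lemma uGivenX_nonneg (ch : Channel X₁ X₂ S Y Z) {pUX₂ : X₁ → S → U × X₂ → ℝ}
    (hUX₂ : ∀ x₁ s, pUX₂ x₁ s ∈ stdSimplex ℝ (U × X₂)) (x₁ : X₁) (u : U) :
    0 ≤ uGivenX ch pUX₂ x₁ u :=
  Finset.sum_nonneg fun _ _ => mul_nonneg (ch.stateLaw_mem.1 _) (uGivenXS_nonneg hUX₂ _ _ _)

lemma uGivenX_mul_div (ch : Channel X₁ X₂ S Y Z) {pUX₂ : X₁ → S → U × X₂ → ℝ}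
    (hUX₂ : ∀ x₁ s, pUX₂ x₁ s ∈ stdSimplex ℝ (U × X₂)) (x₁ : X₁) (u : U) (s : S) :
    uGivenX ch pUX₂ x₁ u * (ch.stateLaw s * uGivenXS pUX₂ x₁ s u / uGivenX ch pUX₂ x₁ u)
      = ch.stateLaw s * uGivenXS pUX₂ x₁ s u := by
  by_cases h : uGivenX ch pUX₂ x₁ u = 0
  · rw [h, zero_mul]
    exact ((Finset.sum_eq_zero_iff_of_nonneg fun s _ => mul_nonneg (ch.stateLaw_mem.1 _)
      (uGivenXS_nonneg hUX₂ _ _ _)).1 h s (Finset.mem_univ s)).symm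
  · field_simp

open Classical in
/-- The conditional law `P(x₂ | x₁, u, s)`. Where the condition has probability zero, the law
`P(x₂ | x₁, s)` stands in. -/
def x₂GivenXUS (pUX₂ : X₁ → S → U × X₂ → ℝ) (x₁ : X₁) (u : U) (s : S) (x₂ : X₂) : ℝ :=
  if uGivenXS pUX₂ x₁ s u = 0 then ∑ u, pUX₂ x₁ s (u, x₂)
  else pUX₂ x₁ s (u, x₂) / uGivenXS pUX₂ x₁ s u

lemma x₂GivenXUS_mem {pUX₂ : X₁ → S → U × X₂ → ℝ}
    (hUX₂ : ∀ x₁ s, pUX₂ x₁ s ∈ stdSimplex ℝ (U × X₂)) (x₁ : X₁) (u : U) (s : S) :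
    x₂GivenXUS pUX₂ x₁ u s ∈ stdSimplex ℝ X₂ := by
  by_cases h : uGivenXS pUX₂ x₁ s u = 0
  · refine ⟨fun x₂ => ?_, ?_⟩
    · simp only [x₂GivenXUS, h, if_true]
      exact Finset.sum_nonneg fun _ _ => (hUX₂ _ _).1 _
    · simp only [x₂GivenXUS, h, if_true]
      rw [← (hUX₂ x₁ s).2, Fintype.sum_prod_type_right]
  · refine ⟨fun x₂ => ?_, ?_⟩
    · simp only [x₂GivenXUS, h, if_false]
      exact div_nonneg ((hUX₂ _ _).1 _) (uGivenXS_nonneg hUX₂ _ _ _)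
    · simp only [x₂GivenXUS, h, if_false, ← Finset.sum_div]
      exact div_self h

lemma uGivenXS_mul_x₂GivenXUS {pUX₂ : X₁ → S → U × X₂ → ℝ}
    (hUX₂ : ∀ x₁ s, pUX₂ x₁ s ∈ stdSimplex ℝ (U × X₂)) (x₁ : X₁) (u : U) (s : S) (x₂ : X₂) :
    uGivenXS pUX₂ x₁ s u * x₂GivenXUS pUX₂ x₁ u s x₂ = pUX₂ x₁ s (u, x₂) := by
  by_cases h : uGivenXS pUX₂ x₁ s u = 0
  · rw [h, zero_mul]
    exact ((Finset.sum_eq_zero_iff_of_nonneg fun x₂ _ => (hUX₂ _ _).1 _).1 h x₂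
      (Finset.mem_univ x₂)).symm
  · simp only [x₂GivenXUS, h, if_false]
    field_simp

/-- The random coding ensemble of an input law `P(x₁)` and a conditional law `P(u, x₂ | x₁, s)`. -/
def Ensemble.ofLaws (ch : Channel X₁ X₂ S Y Z) {pX₁ : X₁ → ℝ} (hX₁ : pX₁ ∈ stdSimplex ℝ X₁)
    {pUX₂ : X₁ → S → U × X₂ → ℝ} (hUX₂ : ∀ x₁ s, pUX₂ x₁ s ∈ stdSimplex ℝ (U × X₂)) :
    Ensemble X₁ U S X₂ Y Z where
  a := pX₁
  a_mem := hX₁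
  b := uGivenX ch pUX₂
  b_mem x₁ := ⟨uGivenX_nonneg ch hUX₂ x₁, by
    simp only [uGivenX]
    rw [Finset.sum_comm]
    simp only [← Finset.mul_sum, sum_uGivenXS hUX₂, mul_one, ch.stateLaw_mem.2]⟩
  ρ x₁ u s := ch.stateLaw s * uGivenXS pUX₂ x₁ s u / uGivenX ch pUX₂ x₁ u
  ρ_nonneg x₁ u s := div_nonneg (mul_nonneg (ch.stateLaw_mem.1 _) (uGivenXS_nonneg hUX₂ _ _ _))
    (uGivenX_nonneg ch hUX₂ _ _)
  σ := ch.stateLaw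
  σ_mem := ch.stateLaw_mem
  sum_b_ρ x₁ s := by
    simp only [uGivenX_mul_div ch hUX₂, ← Finset.mul_sum, sum_uGivenXS hUX₂, mul_one]
  d := x₂GivenXUS pUX₂
  d_mem := x₂GivenXUS_mem hUX₂
  W := ch.trans
  W_mem := ch.trans_mem

lemma Ensemble.joint_ofLaws (ch : Channel X₁ X₂ S Y Z) {pX₁ : X₁ → ℝ}
    (hX₁ : pX₁ ∈ stdSimplex ℝ X₁) {pUX₂ : X₁ → S → U × X₂ → ℝ}
    (hUX₂ : ∀ x₁ s, pUX₂ x₁ s ∈ stdSimplex ℝ (U × X₂)) :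
    (Ensemble.ofLaws ch hX₁ hUX₂).joint = jointLaw ch pX₁ pUX₂ := by
  funext ⟨x₁, s, u, x₂, y, z⟩
  simp only [joint, ofLaws, jointLaw]
  have h := uGivenX_mul_div ch hUX₂ x₁ u s
  rw [← uGivenXS_mul_x₂GivenXUS hUX₂]
  linear_combination (pX₁ x₁ * x₂GivenXUS pUX₂ x₁ u s x₂ * ch.trans x₁ x₂ s (y, z)) * h

end SingleLetter

/-- A point strictly inside the single-letter bounds splits the second rate between `U` and `X₂`:
as much as the last bound allows goes to `X₂`. Here `A, B, C, D` stand for the four information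
quantities. -/
lemma exists_rate_splitting {A B C D ε : ℝ} {R : ℝ × ℝ} (h2 : 0 ≤ R.2)
    (hA : R.1 ≤ A) (hB : R.2 ≤ B) (hC : R.1 + R.2 ≤ C) (hD : R.1 + R.2 ≤ A + D) (hε : 0 < ε) :
    ∃ Ra Rb : ℝ, 0 ≤ Ra ∧ 0 ≤ Rb ∧ Ra + Rb = max (R.2 - ε) 0 ∧
      (max (R.1 - ε) 0 = 0 ∨ max (R.1 - ε) 0 + Ra + ε / 4 < A) ∧
      (max (R.1 - ε) 0 = 0 ∨ max (R.1 - ε) 0 + (Ra + Rb) + ε / 4 < C) ∧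
      (Ra + Rb = 0 ∨ Ra + Rb + ε / 4 < B) ∧ (Rb = 0 ∨ Rb < D) := by
  have hB' : max (R.2 - ε) 0 = 0 ∨ max (R.2 - ε) 0 + ε / 4 < B := by
    rcases max_cases (R.2 - ε) 0 with ⟨h, -⟩ | ⟨h, -⟩
    · right; rw [h]; linarith
    · exact Or.inl h
  by_cases hR1 : R.1 - ε ≤ 0
  · exact ⟨max (R.2 - ε) 0, 0, le_max_right _ _, le_rfl, add_zero _, Or.inl (max_eq_right hR1),
      Or.inl (max_eq_right hR1), by rwa [add_zero], Or.inl rfl⟩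
  rw [max_eq_left (not_le.1 hR1).le]
  have hC' : R.1 - ε + max (R.2 - ε) 0 + ε / 4 < C := by
    rcases max_cases (R.2 - ε) 0 with ⟨h, -⟩ | ⟨h, -⟩ <;> rw [h] <;> linarith
  by_cases hDε : D - ε ≤ 0
  · refine ⟨max (R.2 - ε) 0, 0, le_max_right _ _, le_rfl, add_zero _, Or.inr ?_,
      Or.inr (by rwa [add_zero]), by rwa [add_zero], Or.inl rfl⟩
    rcases max_cases (R.2 - ε) 0 with ⟨h, -⟩ | ⟨h, -⟩ <;> rw [h] <;> linarith
  have hsum : max (R.2 - ε) 0 - min (max (R.2 - ε) 0) (D - ε) + min (max (R.2 - ε) 0) (D - ε)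
      = max (R.2 - ε) 0 := sub_add_cancel _ _
  refine ⟨max (R.2 - ε) 0 - min (max (R.2 - ε) 0) (D - ε), min (max (R.2 - ε) 0) (D - ε),
    sub_nonneg.2 (min_le_left _ _), le_min (le_max_right _ _) (not_le.1 hDε).le, hsum,
    Or.inr ?_, Or.inr (by rwa [hsum]), by rwa [hsum], Or.inr ?_⟩
  · rcases min_cases (max (R.2 - ε) 0) (D - ε) with ⟨h, -⟩ | ⟨h, -⟩ <;> rw [h]
    · linarith
    · rcases max_cases (R.2 - ε) 0 with ⟨h, -⟩ | ⟨h, -⟩ <;> rw [h] <;> linarith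
  · exact (min_le_right _ _).trans_lt (by linarith)

section Achievability

variable {X₁ X₂ S Y Z U : Type*} [Fintype X₁] [Fintype X₂] [Fintype S] [Fintype Y] [Fintype Z]
  [Fintype U]

/-- Achievability: every nonnegative rate pair of the single-letter region is a limit of achievable
pairs. -/
lemma mem_capacityRegion_of_mem_rateRegion (ch : Channel X₁ X₂ S Y Z) {R : ℝ × ℝ}
    (h1 : 0 ≤ R.1) (h2 : 0 ≤ R.2) (hR : R ∈ rateRegion ch U) : R ∈ capacityRegion ch := by
  obtain ⟨pX₁, hX₁, pUX₂, hUX₂, hR⟩ := hR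
  let E := Ensemble.ofLaws ch hX₁ hUX₂
  have hE : E.joint = jointLaw ch pX₁ pUX₂ := Ensemble.joint_ofLaws ch hX₁ hUX₂
  have hρ : ∀ x₁ u, E.b x₁ u * ∑ s, E.ρ x₁ u s = E.b x₁ u := fun x₁ u => by
    rw [Finset.mul_sum]
    exact Finset.sum_congr rfl fun s _ => uGivenX_mul_div ch hUX₂ x₁ u s
  rw [← hE, rateBounds_jointLaw_iff ch hE E.joint_nonneg] at hR
  change _ ∧ _ ≤ _ - E.outNoise ∧ _ ≤ _ - E.outNoise ∧ _ ≤ _ + (_ - E.outNoise) at hR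
  have hA : entropy E.joint (fun t => t.2.2.2.2.1)
      - condEntropy E.joint (fun t => t.2.1) (fun t => t.1)
        + (entropy E.joint (fun t => (t.2.2.1, t.2.1, t.1))
          - entropy E.joint (fun t => (t.2.2.1, t.1, t.2.2.2.2.1))) = E.infoY - E.infoS := by
    rw [Ensemble.infoY, Ensemble.infoS, condEntropy, entropy_congr E.joint_nonneg
      (A := fun t => (t.2.2.1, t.2.1, t.1)) (B := fun t => (t.1, t.2.2.1, t.2.1))
      (fun _ _ => by simp; tauto), entropy_congr E.joint_nonneg
      (A := fun t => (t.2.2.1, t.1, t.2.2.2.2.1)) (B := fun t => (t.1, t.2.2.1, t.2.2.2.2.1))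
      (fun _ _ => by simp; tauto), entropy_congr E.joint_nonneg
      (A := fun t => (t.2.1, t.1)) (B := fun t => (t.1, t.2.1))
      (fun _ _ => by simp; tauto), E.entropy_xs]
    ring
  rw [hA] at hR
  obtain ⟨hA, hB, hC, hD⟩ := hR
  have hach : ∀ ε : ℝ, 0 < ε → Achievable ch (max (R.1 - ε) 0, max (R.2 - ε) 0) := by
    intro ε hε
    obtain ⟨Ra, Rb, hRa, hRb, hsum, k1, k2, k3, k4⟩ :=
      exists_rate_splitting h2 hA hB hC hD hε
    rw [← hsum]
    exact E.achievable ch rfl rfl hρ (r := E.infoS + ε / 4) (le_max_right _ _) hRa hRb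
      (by linarith) (k1.imp_right fun h => by linarith) (k2.imp_right fun h => by linarith)
      (k3.imp_right fun h => by linarith) (k4.imp_right fun h => by linarith)
  have hlim : Tendsto (fun ε : ℝ => (max (R.1 - ε) 0, max (R.2 - ε) 0)) (𝓝[>] 0) (𝓝 R) := by
    have hc : Continuous fun ε : ℝ => (max (R.1 - ε) 0, max (R.2 - ε) 0) := by fun_prop
    have := hc.tendsto 0
    simp only [sub_zero, max_eq_left h1, max_eq_left h2] at this
    exact this.mono_left nhdsWithin_le_nhds
  exact mem_closure_of_tendsto hlim (eventually_nhdsWithin_of_forall fun ε hε => hach ε hε)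

end Achievability

end CognitiveIC

theorem theorem12 {X₁ X₂ S Y Z : Type*} [Fintype X₁] [Fintype X₂] [Fintype S] [Fintype Y]
    [Fintype Z] (ch : CognitiveIC.Channel X₁ X₂ S Y Z) :
    CognitiveIC.capacityRegion ch =
      {R : ℝ × ℝ | 0 ≤ R.1 ∧ 0 ≤ R.2 ∧
        ∃ k : ℕ, k ≤ Fintype.card X₁ * Fintype.card X₂ * Fintype.card S + 1 ∧
        ∃ pX₁ ∈ stdSimplex ℝ X₁,
        ∃ pUX₂ : X₁ → S → Fin k × X₂ → ℝ,
          (∀ x₁ s, pUX₂ x₁ s ∈ stdSimplex ℝ (Fin k × X₂)) ∧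
          CognitiveIC.RateBounds (CognitiveIC.jointLaw ch pX₁ pUX₂) R} :=
  Set.Subset.antisymm
    (fun _ hR => CognitiveIC.exists_mem_rateRegion_of_mem_capacityRegion ch hR)
    fun _ ⟨h1, h2, _, _, hR⟩ => CognitiveIC.mem_capacityRegion_of_mem_rateRegion ch h1 h2 hR

end
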